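/- Fix a field $\mathbb K$ of characteristic $0$. A \emph{shuffle operad} is a monoid for the shuffle composition product in collections $P=(P(k))_{k\ge 1}$ of $\mathbb K$-vector spaces; its elementary compositions are denoted $f\circ_{i,\tau}g$ ($g$ is inserted at input $i$ of $f$, along a shuffle $\tau$) and its unit is $1\in P(1)$. A \emph{shuffle $n$-operad} ($n\in\mathbb N\cup\{\omega\}$) is a strict $n$-category internal to shuffle operads, with sources $s_k$, targets $t_k$, identities $a\mapsto 1_a$ (usually omitted) and compositions $\star_k$ along $k$-cells; $s=s_{n-1}$, $t=t_{n-1}$ on $n$-cells. A \emph{cellular extension} $X$ of an $n$-operad $P$ is a family of sets $(X(k))_{k\ge1}$ of $(n+1)$-generators, each with a source and a target that are $n$-cells of $P$ of the same arity and are parallel (same $s$ and same $t$; no condition if $n=0$); $P[X]$ is the free $(n+1)$-operad on $(P,X)$. For $n\ge 1$, the extension is \emph{acyclic} if for all parallel $n$-cells $f,g$ of $P$ there is an $(n+1)$-cell of $P[X]$ with source $f$ and target $g$. A \emph{shuffle $\omega$-polygraph} $X=(X_0,X_1,\dots)$ consists of a family of sets $X_0=(X_0(k))_{k\ge1}$ and,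 for every $n\ge 1$, a cellular extension $X_{n}$ of the free $(n-1)$-operad $X_0^*[X_1]\cdots[X_{n-1}]$; let $X^*$ be the resulting free $\omega$-operad and $X^*_n$ its operad of $n$-cells. The operad $\overline X$ \emph{presented} by $X$ is the coequalizer of $s_0,t_0:X_1^*\rightrightarrows X_0^*$ in shuffle operads. It is regarded as an $\omega$-operad with only identity cells in positive dimensions, and $\pi:X^*\to\overline X$ denotes the canonical projection. One says that $X$ is a \emph{polygraphic resolution} of an operad $P$ if $\overline X\cong P$ and the cellular extensions $X_k$ are acyclic for all $k\ge2$. A \emph{linear $\omega$-functor} between $\omega$-operads is a degree-$0$, arity-preserving linear map compatible with sources, targets, identities and the compositions $\star_k$ (but not necessarily with shuffle composition). A \emph{unital section} of $X$ is a linear $\omega$-functor $\iota:\overline X\to X^*$ with $\pi\iota=\mathrm{id}$ and $\iota(1)=1$; write $\widehat a=\iota\pi(a)$. A \emph{homotopy} $\eta:F\Rightarrow G$ between linear $\omega$-functors $F,G:P\to Q$ is a linear, arity-preserving map sending $n$-cells of $P$ to $(n+1)$-cells of $Q$ such that (i) for every $n$-cell $a$, $\; s_n(\eta_a)=(\cdots(F(a)\star_0\eta_{t_0(a)})\star_1\cdots)\star_{n-1}\eta_{t_{n-1}(a)}$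 and $t_n(\eta_a)=\eta_{s_{n-1}(a)}\star_{n-1}(\cdots\star_1(\eta_{s_0(a)}\star_0G(a))\cdots)$; (ii) for all $0\le k<n$ and every $\star_k$-composable pair $(a,b)$ of $n$-cells, $$\eta_{a\star_kb}=\bigl(F(s_{k+1}(a))\star_0\eta_{t_0(b)}\star_1\cdots\star_{k-1}\eta_{t_{k-1}(b)}\star_k\eta_b\bigr)\star_{k+1}\bigl(\eta_a\star_k\eta_{s_{k-1}(a)}\star_{k-1}\cdots\star_1\eta_{s_0(a)}\star_0G(t_{k+1}(b))\bigr),$$ bracketed as in (i); (iii) $\eta_{1_a}=1_{\eta_a}$ for every cell $a$. An \emph{$\iota$-contraction} of $X$ is a homotopy $\sigma:\mathrm{id}_{X^*}\Rightarrow\iota\pi$ such that $\sigma_a=1_a$ for every cell $a$ in the image of $\iota$ or of $\sigma$. It is a \emph{right} $\iota$-contraction if, for all $n\ge0$, all $n$-cells $f,g$ of $X^*$ and every compatible elementary composition $\circ_{i,\tau}$, $$\sigma_{f\circ_{i,\tau}g}=(s_0(f)\circ_{i,\tau}\sigma_g)\star_0\sigma_{f\circ_{i,\tau}\widehat g}.$$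 \textbf{Proposition.} Let $X$ be a shuffle $\omega$-polygraph with a fixed unital section $\iota$. Then $X$ is a polygraphic resolution of the operad $\overline X$ that it presents if and only if $X$ admits a right $\iota$-contraction. -/

import Mathlib

universe u

/-- A shuffle surjection `{0, …, m - 1} → {0, …, k - 1}`: its fibres have the prescribed sizes
`n i ≥ 1`, and the minima of the fibres are increasing. These are the ordered partitions over which
shuffle composition is taken. -/
structure ShuffleSurjection {k : ℕ+} (n : Fin k → ℕ+) (m : ℕ+) where
  toFun : Fin m → Fin k
  card_fiber : ∀ i, (Finset.univ.filter (fun a => toFun a = i)).card = n i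
  min_lt : ∀ i j, i < j → ∀ b, toFun b = j → ∃ a, toFun a = i ∧ a < b

namespace ShuffleSurjection

variable {k m l : ℕ+} {n : Fin k → ℕ+} {p : Fin m → ℕ+}

/-- The increasing enumeration of the fibre over `i`. -/
def enum (f : ShuffleSurjection n m) (i : Fin k) : Fin (n i) ↪o Fin m :=
  Finset.orderEmbOfFin _ (f.card_fiber i)

theorem toFun_enum (f : ShuffleSurjection n m) (i : Fin k) (a : Fin (n i)) : f.toFun (f.enum i a) = i := by
  exact (Finset.mem_filter.1 (Finset.orderEmbOfFin_mem _ (f.card_fiber i) a)).2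

theorem exists_enum (f : ShuffleSurjection n m) {i : Fin k} {a : Fin m} (h : f.toFun a = i) :
    ∃ b, f.enum i b = a := by
  have : a ∈ Set.range (f.enum i) := by
    unfold enum
    rw [Finset.range_orderEmbOfFin]
    simpa using h
  exact this

/-- The position of `a` in the fibre over `i`. -/
noncomputable def idx (f : ShuffleSurjection n m) {i : Fin k} (a : Fin m) (h : f.toFun a = i) : Fin (n i) :=
  (f.exists_enum h).choose

theorem enum_idx (f : ShuffleSurjection n m) {i : Fin k} (a : Fin m) (h : f.toFun a = i) :
    f.enum i (f.idx a h) = a :=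
  (f.exists_enum h).choose_spec

theorem toFun_surjective (f : ShuffleSurjection n m) : Function.Surjective f.toFun := by
  intro i
  have h : 0 < (Finset.univ.filter (fun a => f.toFun a = i)).card := by
    rw [f.card_fiber]
    exact (n i).pos
  obtain ⟨a, ha⟩ := Finset.card_pos.1 h
  exact ⟨a, by simpa using ha⟩

/-- The sizes of the fibres of the composite of two shuffle surjections. -/
def compArity (f : ShuffleSurjection n m) (f' : ShuffleSurjection p l) (i : Fin k) : ℕ+ :=
  ⟨(Finset.univ.filter (fun b => f.toFun (f'.toFun b) = i)).card, by
    obtain ⟨b, hb⟩ := (f.toFun_surjective.comp f'.toFun_surjective) i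
    exact Finset.card_pos.2 ⟨b, by simpa using hb⟩⟩

/-- The composite of two shuffle surjections. -/
def comp (f : ShuffleSurjection n m) (f' : ShuffleSurjection p l) : ShuffleSurjection (compArity f f') l where
  toFun b := f.toFun (f'.toFun b)
  card_fiber _ := rfl
  min_lt i j hij b hb := by
    obtain ⟨a, ha, hab⟩ := f.min_lt i j hij _ hb
    obtain ⟨c, hc, hcb⟩ := f'.min_lt _ _ hab b rfl
    exact ⟨c, by rw [hc, ha], hcb⟩

theorem enum_comp_mem (f : ShuffleSurjection n m) (f' : ShuffleSurjection p l) (i : Fin k)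
    (b : Fin (compArity f f' i)) : f.toFun (f'.toFun ((f.comp f').enum i b)) = i :=
  (f.comp f').toFun_enum i b

/-- The restriction of `f'` to the part of its domain that lies over `i`. -/
noncomputable def restr (f : ShuffleSurjection n m) (f' : ShuffleSurjection p l) (i : Fin k) :
    ShuffleSurjection (fun a : Fin (n i) => p (f.enum i a)) (compArity f f' i) where
  toFun b := f.idx (f'.toFun ((f.comp f').enum i b)) (enum_comp_mem f f' i b)
  card_fiber a := by
    rw [← f'.card_fiber (f.enum i a)]
    refine Finset.card_bij (fun b _ => (f.comp f').enum i b) ?_ ?_ ?_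
    · intro b hb
      simp only [Finset.mem_filter, Finset.mem_univ, true_and] at hb ⊢
      rw [← hb, enum_idx]
    · intro b _ b' _ h
      exact ((f.comp f').enum i).injective h
    · intro c hc
      simp only [Finset.mem_filter, Finset.mem_univ, true_and] at hc
      have hc' : (f.comp f').toFun c = i := by
        change f.toFun (f'.toFun c) = i
        rw [hc, toFun_enum]
      obtain ⟨b, hb⟩ := (f.comp f').exists_enum hc'
      refine ⟨b, ?_, hb⟩
      simp only [Finset.mem_filter, Finset.mem_univ, true_and]
      apply (f.enum i).injective
      rw [enum_idx, hb, hc]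
  min_lt a a' haa b hb := by
    have h1 : f'.toFun ((f.comp f').enum i b) = f.enum i a' := by rw [← hb, enum_idx]
    obtain ⟨c, hc, hcb⟩ := f'.min_lt _ _ ((f.enum i).strictMono haa) _ h1
    have hc' : (f.comp f').toFun c = i := by
      change f.toFun (f'.toFun c) = i
      rw [hc, toFun_enum]
    obtain ⟨d, hd⟩ := (f.comp f').exists_enum hc'
    refine ⟨d, ?_, ?_⟩
    · apply (f.enum i).injective
      rw [enum_idx, hd, hc]
    · rw [← hd] at hcb
      exact ((f.comp f').enum i).lt_iff_lt.1 hcb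

theorem enum_restr (f : ShuffleSurjection n m) (f' : ShuffleSurjection p l) (i : Fin k)
    (b : Fin (compArity f f' i)) :
    f.enum i ((f.restr f' i).toFun b) = f'.toFun ((f.comp f').enum i b) :=
  enum_idx _ _ (enum_comp_mem f f' i b)

theorem enum_eq_of_strictMono (f : ShuffleSurjection n m) (i : Fin k) {N : ℕ} (φ : Fin N → Fin m)
    (hφ : StrictMono φ) (hr : ∀ a, f.toFun a = i ↔ ∃ b, φ b = a) :
    N = n i ∧ ∀ b (h : b < N) (h' : b < n i), φ ⟨b, h⟩ = f.enum i ⟨b, h'⟩ := by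
  have hN : N = n i := by
    rw [← f.card_fiber i, ← Fintype.card_fin N, ← Finset.card_univ,
      ← Finset.card_image_of_injective _ hφ.injective]
    congr 1
    ext a
    simp [hr]
  refine ⟨hN, ?_⟩
  subst hN
  intro b h h'
  have : φ = f.enum i := by
    refine (hφ.range_inj (f.enum i).strictMono).1 ?_
    ext a
    rw [Set.mem_range, ← hr]
    constructor
    · intro h
      exact f.exists_enum h
    · rintro ⟨b, rfl⟩
      exact f.toFun_enum i b
  rw [this]

/-- Enumerating a fibre of `f'` directly, or inside the part lying over `i`. -/
theorem enum_comp_enum_restr (f : ShuffleSurjection n m) (f' : ShuffleSurjection p l) (i : Fin k) (a : Fin (n i))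
    (b : Fin (p (f.enum i a))) :
    (f.comp f').enum i ((f.restr f' i).enum a b) = f'.enum (f.enum i a) b := by
  refine (f'.enum_eq_of_strictMono (f.enum i a)
    (fun b => (f.comp f').enum i ((f.restr f' i).enum a b)) ?_ ?_).2 b b.2 b.2
  · intro b b' h
    exact ((f.comp f').enum i).strictMono (((f.restr f' i).enum a).strictMono h)
  · intro c
    constructor
    · intro hc
      have hc' : (f.comp f').toFun c = i := by
        change f.toFun (f'.toFun c) = i
        rw [hc, toFun_enum]
      obtain ⟨d, rfl⟩ := (f.comp f').exists_enum hc'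
      have hd : (f.restr f' i).toFun d = a := by
        apply (f.enum i).injective
        rw [enum_restr, hc]
      obtain ⟨b, rfl⟩ := (f.restr f' i).exists_enum hd
      exact ⟨b, rfl⟩
    · rintro ⟨b, rfl⟩
      rw [← enum_restr, toFun_enum]

theorem arity_unique {n' : Fin k → ℕ+} (f : ShuffleSurjection n m) (f' : ShuffleSurjection n' m)
    (h : ∀ b, f.toFun b = f'.toFun b) : n = n' := by
  funext i
  apply PNat.coe_injective
  rw [← f.card_fiber, ← f'.card_fiber]
  simp only [h]

theorem enum_congr {n' : Fin k → ℕ+} (f : ShuffleSurjection n m) (f' : ShuffleSurjection n' m)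
    (hf : ∀ b, f.toFun b = f'.toFun b) (i : Fin k) (b : ℕ) (h : b < n i) (h' : b < n' i) :
    f.enum i ⟨b, h⟩ = f'.enum i ⟨b, h'⟩ := by
  obtain rfl := arity_unique f f' hf
  obtain rfl : f = f' := by
    cases f; cases f'
    congr
    exact funext hf
  rfl

theorem restr_comp_restr {q : Fin l → ℕ+} {r : ℕ+} (f : ShuffleSurjection n m)
    (f' : ShuffleSurjection p l) (f'' : ShuffleSurjection q r) (i : Fin k)
    (b : Fin (compArity (f.comp f') f'' i)) :
    ((f.restr f' i).comp ((f.comp f').restr f'' i)).toFun b =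
      (f.restr (f'.comp f'') i).toFun b := by
  apply (f.enum i).injective
  refine (enum_restr f f' i (((f.comp f').restr f'' i).toFun b)).trans ?_
  refine (congrArg f'.toFun (enum_restr (f.comp f') f'' i b)).trans ?_
  exact (enum_restr f (f'.comp f'') i b).symm

theorem restr_restr {q : Fin l → ℕ+} {r : ℕ+} (f : ShuffleSurjection n m)
    (f' : ShuffleSurjection p l) (f'' : ShuffleSurjection q r) (i : Fin k) (a : Fin (n i)) :
    compArity (f.restr f' i) ((f.comp f').restr f'' i) a = compArity f' f'' (f.enum i a) ∧
    ∀ b h h', ((f.restr f' i).restr ((f.comp f').restr f'' i) a).toFun ⟨b, h⟩ =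
      (f'.restr f'' (f.enum i a)).toFun ⟨b, h'⟩ := by
  refine ⟨congrFun (arity_unique ((f.restr f' i).comp ((f.comp f').restr f'' i))
    (f.restr (f'.comp f'') i) (restr_comp_restr f f' f'' i)) a, fun b h h' => ?_⟩
  apply (f'.enum (f.enum i a)).injective
  rw [enum_restr, ← enum_comp_enum_restr, enum_restr, enum_restr, ← enum_comp_enum_restr]
  congr 2
  exact enum_congr _ _ (restr_comp_restr f f' f'' i) a b h h'

/-- The identity surjection. -/
def refl (k : ℕ+) : ShuffleSurjection (fun _ : Fin k => 1) k where
  toFun b := b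
  card_fiber i := Finset.card_eq_one.2 ⟨i, by ext; simp⟩
  min_lt i j hij b hb := ⟨i, rfl, hb ▸ hij⟩

theorem eq_id_of_ones (f : ShuffleSurjection n m) (hn : ∀ i, n i = 1) :
    k = m ∧ ∀ b h h', f.toFun ⟨b, h⟩ = ⟨b, h'⟩ := by
  have hinj : Function.Injective f.toFun := by
    intro a b hab
    have hc := f.card_fiber (f.toFun b)
    rw [hn, PNat.one_coe, Finset.card_eq_one] at hc
    obtain ⟨c, hc⟩ := hc
    have ha : a ∈ ({c} : Finset _) := by
      rw [← hc]
      simpa using hab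
    have hb : b ∈ ({c} : Finset _) := by
      rw [← hc]
      simp
    rw [Finset.mem_singleton] at ha hb
    rw [ha, hb]
  have hmono : StrictMono f.toFun := by
    intro a b hab
    by_contra h
    rcases (not_lt.1 h).lt_or_eq with h | h
    · obtain ⟨c, hc, hca⟩ := f.min_lt _ _ h a rfl
      rw [hinj hc] at hca
      exact lt_asymm hab hca
    · exact hab.ne (hinj h.symm)
  have hkm : k = m := by
    apply PNat.coe_injective
    have := Fintype.card_of_bijective ⟨hinj, f.toFun_surjective⟩
    simpa using this.symm
  subst hkm
  refine ⟨rfl, fun b h h' => ?_⟩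
  have hid : f.toFun = id := by
    refine (hmono.range_inj strictMono_id).1 ?_
    rw [f.toFun_surjective.range_eq, Set.range_id]
  rw [hid, id]

end ShuffleSurjection

/-- Shuffle tree monomials on an indexed set `X`: either the trivial tree, or a root labelled by a
generator `x` of arity `k` with `k` subtrees grafted along a shuffle surjection. -/
inductive TreeMonomial (X : ℕ+ → Type u) : ℕ+ → Type u
  | unit : TreeMonomial X 1
  | node {k : ℕ+} {n : Fin k → ℕ+} {m : ℕ+} (f : ShuffleSurjection n m) (x : X k)
      (v : ∀ i, TreeMonomial X (n i)) : TreeMonomial X m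

namespace TreeMonomial
variable {X : ℕ+ → Type u}

theorem arity_of_unit {n : Fin (1 : ℕ+) → ℕ+} {m : ℕ+} (f : ShuffleSurjection n m) : n 0 = m := by
  apply PNat.coe_injective
  rw [← f.card_fiber 0]
  have : (Finset.univ.filter (fun a => f.toFun a = 0)) = Finset.univ := by
    refine Finset.filter_true_of_mem fun a _ => ?_
    exact Subsingleton.elim (α := Fin 1) _ _
  rw [this]
  simp

/-- Grafting of the trees `w i` onto the leaves of a tree. -/
noncomputable def comp : ∀ {k : ℕ+}, TreeMonomial X k → ∀ {n : Fin k → ℕ+} {m : ℕ+}, ShuffleSurjection n m →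
    (∀ i, TreeMonomial X (n i)) → TreeMonomial X m
  | _, unit, _, _, f, w => arity_of_unit f ▸ w 0
  | _, node f x v, _, _, f', w =>
    node (f.comp f') x fun i => (v i).comp (f.restr f' i) fun a => w (f.enum i a)

theorem comp_heq {k : ℕ+} (t : TreeMonomial X k) {n n' : Fin k → ℕ+} {m m' : ℕ+} (hn : n = n')
    (hm : m = m') (f : ShuffleSurjection n m) (f' : ShuffleSurjection n' m')
    (hf : ∀ b h h', f.toFun ⟨b, h⟩ = f'.toFun ⟨b, h'⟩)
    (w : ∀ i, TreeMonomial X (n i)) (w' : ∀ i, TreeMonomial X (n' i)) (hw : ∀ i, HEq (w i) (w' i)) :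
    HEq (t.comp f w) (t.comp f' w') := by
  subst hn hm
  have h1 : f = f' := by
    cases f; cases f'
    congr
    ext b : 1
    exact hf b b.2 b.2
  have h2 : w = w' := funext fun i => eq_of_heq (hw i)
  subst h1 h2
  rfl

theorem comp_assoc {k : ℕ+} (t : TreeMonomial X k) : ∀ {n : Fin k → ℕ+} {m l : ℕ+} {p : Fin m → ℕ+}
    (f : ShuffleSurjection n m) (f' : ShuffleSurjection p l) (w : ∀ i, TreeMonomial X (n i)) (w' : ∀ a, TreeMonomial X (p a)),
    (t.comp f w).comp f' w' =
      t.comp (f.comp f') fun i => (w i).comp (f.restr f' i) fun a => w' (f.enum i a) := by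
  induction t with
  | unit =>
    intro n m l p f f' w w'
    have hm := arity_of_unit f
    subst hm
    have he : ∀ a, f.enum 0 a = a := by
      intro a
      have h := (f.enum_eq_of_strictMono 0 (id : Fin (n 0) → Fin (n 0)) strictMono_id fun b =>
        ⟨fun _ => ⟨b, rfl⟩, fun _ => Subsingleton.elim (α := Fin 1) _ _⟩).2 a a.2 a.2
      exact h.symm
    have hl : ∀ b h h', (f.comp f').enum 0 ⟨b, h⟩ = ⟨b, h'⟩ := by
      intro b h h'
      exact (((f.comp f').enum_eq_of_strictMono 0 (id : Fin l → Fin l) strictMono_id fun b =>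
        ⟨fun _ => ⟨b, rfl⟩, fun _ => Subsingleton.elim (α := Fin 1) _ _⟩).2 b h' h).symm
    apply eq_of_heq
    simp only [comp]
    refine HEq.trans ?_ (eqRec_heq_self _ _).symm
    refine comp_heq (w 0) ?_ (arity_of_unit (f.comp f')).symm _ _ ?_ _ _ ?_
    · funext a
      rw [he]
    · intro b h h'
      apply (f.enum 0).injective
      rw [ShuffleSurjection.enum_restr, he, hl]
    · intro a
      rw [he]
  | node g x v ih =>
    intro n' m' l p f f' w w'
    simp only [comp, ih]
    congr 1
    funext i
    refine eq_of_heq (comp_heq (v i) ?_ rfl _ _ ?_ _ _ ?_)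
    · exact ShuffleSurjection.arity_unique _ _ (ShuffleSurjection.restr_comp_restr g f f' i)
    · intro b h h'
      exact ShuffleSurjection.restr_comp_restr g f f' i ⟨b, h⟩
    · intro a
      refine comp_heq _ ?_ (ShuffleSurjection.restr_restr g f f' i a).1 _ _
        (ShuffleSurjection.restr_restr g f f' i a).2 _ _ ?_
      · funext b
        rw [ShuffleSurjection.enum_comp_enum_restr]
      · intro b
        rw [ShuffleSurjection.enum_comp_enum_restr]

theorem node_heq {k : ℕ+} (x : X k) {n n' : Fin k → ℕ+} {m : ℕ+} (hn : n = n')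
    (f : ShuffleSurjection n m) (f' : ShuffleSurjection n' m) (hf : ∀ b, f.toFun b = f'.toFun b)
    (v : ∀ i, TreeMonomial X (n i)) (v' : ∀ i, TreeMonomial X (n' i))
    (hv : ∀ i, HEq (v i) (v' i)) : node f x v = node f' x v' := by
  subst hn
  obtain rfl : f = f' := by
    cases f; cases f'
    congr
    exact funext hf
  obtain rfl : v = v' := funext fun i => eq_of_heq (hv i)
  rfl

theorem comp_units {k : ℕ+} (t : TreeMonomial X k) : ∀ {n : Fin k → ℕ+} {m : ℕ+}
    (f : ShuffleSurjection n m) (w : ∀ i, TreeMonomial X (n i)), (∀ i, n i = 1) →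
    (∀ i, HEq (w i) (unit : TreeMonomial X 1)) → HEq (t.comp f w) t := by
  induction t with
  | unit =>
    intro n m f w _ hw
    simp only [comp]
    exact (eqRec_heq_self _ _).trans (hw 0)
  | node g x v ih =>
    intro n m f w hn hw
    obtain ⟨rfl, hf⟩ := f.eq_id_of_ones hn
    simp only [comp]
    apply heq_of_eq
    have hg : ∀ b, (g.comp f).toFun b = g.toFun b := by
      intro b
      change g.toFun (f.toFun b) = _
      rw [hf]
    refine node_heq x (ShuffleSurjection.arity_unique _ _ hg) _ _ hg _ _ fun i => ?_
    exact ih i _ _ (fun a => hn _) fun a => hw _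

end TreeMonomial

/-- A shuffle operad over `K`, that is, a monoid for the shuffle composition product in collections
of vector spaces indexed by nonempty finite ordinals. -/
structure ShuffleOperad (K : Type u) [Field K] where
  obj : ℕ+ → Type u
  [addCommGroup : ∀ k, AddCommGroup (obj k)]
  [module : ∀ k, Module K (obj k)]
  one : obj 1
  comp : ∀ {k : ℕ+} {n : Fin k → ℕ+} {m : ℕ+}, ShuffleSurjection n m →
    obj k →ₗ[K] MultilinearMap K (fun i => obj (n i)) (obj m)
  comp_one : ∀ {k : ℕ+} (f : ShuffleSurjection (fun _ : Fin k => 1) k) (u : obj k),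
    comp f u (fun _ => one) = u
  one_comp : ∀ {m : ℕ+} (f : ShuffleSurjection (fun _ : Fin (1 : ℕ+) => m) m) (u : obj m),
    comp f one (fun _ => u) = u
  assoc : ∀ {k : ℕ+} {n : Fin k → ℕ+} {m : ℕ+} {p : Fin m → ℕ+} {l : ℕ+}
    (f : ShuffleSurjection n m) (f' : ShuffleSurjection p l) (u : obj k) (v : ∀ i, obj (n i))
    (w : ∀ a, obj (p a)),
    comp f' (comp f u v) w =
      comp (f.comp f') u fun i => comp (f.restr f' i) (v i) fun a => w (f.enum i a)

namespace ShuffleOperad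

instance (K : Type u) [Field K] : CoeFun (ShuffleOperad K) (fun _ => ℕ+ → Type u) := ⟨obj⟩

attribute [instance] addCommGroup module

variable {K : Type u} [Field K]

/-- The multilinear extension of a map defined on families of basis elements. -/
noncomputable def multilinearExtension {k : ℕ} {S : Fin k → Type u} {T : Type u}
    (φ : (∀ i, S i) → T) : MultilinearMap K (fun i => S i →₀ K) (T →₀ K) := by
  classical
  exact (MultilinearMap.fromDFinsuppEquiv (κ := S) (R := K) (M := fun _ _ => K) (N := T →₀ K)
    (fun p => MultilinearMap.mkPiRing K (Fin k) (Finsupp.single (φ p) 1))).compLinearMap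
      fun i => (finsuppLequivDFinsupp K).toLinearMap

theorem multilinearExtension_single {k : ℕ} {S : Fin k → Type u} {T : Type u}
    (φ : (∀ i, S i) → T) (p : ∀ i, S i) :
    multilinearExtension (K := K) φ (fun i => Finsupp.single (p i) 1) =
      Finsupp.single (φ p) 1 := by
  classical
  simp [multilinearExtension, MultilinearMap.fromDFinsuppEquiv_single]

/-- Grafting, extended multilinearly to linear combinations of tree monomials. -/
noncomputable def freeComp (X : ℕ+ → Type u) {k : ℕ+} {n : Fin k → ℕ+} {m : ℕ+}
    (f : ShuffleSurjection n m) :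
    (TreeMonomial X k →₀ K) →ₗ[K]
      MultilinearMap K (fun i => TreeMonomial X (n i) →₀ K) (TreeMonomial X m →₀ K) :=
  Finsupp.linearCombination K fun t => multilinearExtension fun w => t.comp f w

theorem freeComp_single (X : ℕ+ → Type u) {k : ℕ+} {n : Fin k → ℕ+} {m : ℕ+}
    (f : ShuffleSurjection n m) (t : TreeMonomial X k) (w : ∀ i, TreeMonomial X (n i)) :
    freeComp (K := K) X f (Finsupp.single t 1) (fun i => Finsupp.single (w i) 1) =
      Finsupp.single (t.comp f w) 1 := by
  rw [freeComp, Finsupp.linearCombination_single, one_smul, multilinearExtension_single]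

/-- Two multilinear expressions in the inputs that agree on monomials agree. -/
theorem ext_single {k : ℕ} {S : Fin k → Type u} {M : Type u} [AddCommMonoid M] [Module K M]
    (φ ψ : MultilinearMap K (fun i => S i →₀ K) M)
    (h : ∀ p : ∀ i, S i, φ (fun i => Finsupp.single (p i) 1) =
      ψ (fun i => Finsupp.single (p i) 1)) (v : ∀ i, S i →₀ K) : φ v = ψ v := by
  have : φ = ψ := Module.Basis.ext_multilinear (fun i => Finsupp.basisSingleOne) (by simpa using h)
  rw [this]

/-- The position of each input of a two-level composite. -/
noncomputable def _root_.ShuffleSurjection.sigmaEquiv {k m : ℕ+} {n : Fin k → ℕ+}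
    (f : ShuffleSurjection n m) : (Σ i, Fin (n i)) ≃ Fin m where
  toFun x := f.enum x.1 x.2
  invFun a := ⟨f.toFun a, f.idx a rfl⟩
  left_inv := by
    rintro ⟨i, b⟩
    have h : f.toFun (f.enum i b) = i := f.toFun_enum i b
    refine Sigma.ext h ?_
    have key : ∀ (j : Fin k) (hj : f.toFun (f.enum i b) = j) (hi : i = j),
        HEq (f.idx (f.enum i b) hj) b := by
      intro j hj hi
      subst hi
      apply heq_of_eq
      apply (f.enum i).injective
      rw [f.enum_idx]
    exact key _ rfl h.symm
  right_inv a := f.enum_idx a rfl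

section twoLevel

variable {k m : ℕ+} {n : Fin k → ℕ+} {p : Fin m → ℕ+} {q : Fin k → ℕ+} {M : ℕ+ → Type u}
  [∀ i, AddCommMonoid (M i)] [∀ i, Module K (M i)] {N : Type u} [AddCommMonoid N] [Module K N]

/-- A two-level composite, as a multilinear map in the inputs of the upper level. -/
noncomputable def twoLevel (f : ShuffleSurjection n m)
    (g : MultilinearMap K (fun i => M (q i)) N)
    (h : ∀ i, MultilinearMap K (fun a : Fin (n i) => M (p (f.enum i a))) (M (q i))) :
    MultilinearMap K (fun a => M (p a)) N :=
  (MultilinearMap.domDomCongrLinearEquiv' K K (fun a => M (p a)) N f.sigmaEquiv.symm).symm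
    (g.compMultilinearMap h)

theorem twoLevel_apply (f : ShuffleSurjection n m) (g : MultilinearMap K (fun i => M (q i)) N)
    (h : ∀ i, MultilinearMap K (fun a : Fin (n i) => M (p (f.enum i a))) (M (q i)))
    (w : ∀ a, M (p a)) : twoLevel f g h w = g fun i => h i fun a => w (f.enum i a) := rfl

end twoLevel

/-- Evaluation of a linear family of multilinear maps at fixed inputs. -/
def evalAt {k : ℕ} {A N : Type u} {M : Fin k → Type u} [AddCommMonoid A] [Module K A]
    [AddCommMonoid N] [Module K N] [∀ i, AddCommMonoid (M i)] [∀ i, Module K (M i)]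
    (φ : A →ₗ[K] MultilinearMap K M N) (w : ∀ i, M i) : A →ₗ[K] N where
  toFun x := φ x w
  map_add' x y := by rw [map_add]; rfl
  map_smul' c x := by rw [map_smul]; rfl

theorem ext_linear {S M : Type u} [AddCommMonoid M] [Module K M] (φ ψ : (S →₀ K) →ₗ[K] M)
    (h : ∀ s, φ (Finsupp.single s 1) = ψ (Finsupp.single s 1)) (u : S →₀ K) : φ u = ψ u := by
  have : φ = ψ := by
    refine Module.Basis.ext Finsupp.basisSingleOne fun s => ?_
    simpa using h s
  rw [this]

/-- The free shuffle operad on an indexed set: linear combinations of tree monomials. -/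
noncomputable def free (K : Type u) [Field K] (X : ℕ+ → Type u) : ShuffleOperad K where
  obj k := TreeMonomial X k →₀ K
  one := Finsupp.single TreeMonomial.unit 1
  comp f := freeComp X f
  comp_one f u := by
    refine ext_linear (evalAt (freeComp X f) _) LinearMap.id (fun t => ?_) u
    refine (freeComp_single X f t fun _ => TreeMonomial.unit).trans ?_
    rw [eq_of_heq (t.comp_units f (fun _ => TreeMonomial.unit) (fun _ => rfl) fun _ => HEq.rfl)]
    rfl
  one_comp {m} f u := by
    have : Subsingleton (Fin (1 : ℕ+)) := inferInstanceAs (Subsingleton (Fin 1))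
    let L : MultilinearMap K (fun _ : Fin (1 : ℕ+) => TreeMonomial X m →₀ K)
        (TreeMonomial X m →₀ K) :=
      MultilinearMap.ofSubsingleton K _ _ (0 : Fin (1 : ℕ+)) LinearMap.id
    refine ext_single (freeComp X f (Finsupp.single TreeMonomial.unit 1)) L (fun w => ?_)
      (fun _ => u)
    rw [freeComp_single]
    rfl
  assoc {k n m p l} f f' u v w := by
    refine ext_single (freeComp X f' (freeComp X f u v))
      (twoLevel (K := K) (p := p) (M := fun k => TreeMonomial X k →₀ K) f (freeComp X (f.comp f') u)
        fun i => freeComp X (f.restr f' i) (v i)) (fun w => ?_) w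
    rw [twoLevel_apply]
    refine ext_single ((evalAt (freeComp X f') _).compMultilinearMap (freeComp X f u))
      ((freeComp X (f.comp f') u).compLinearMap fun i => evalAt (freeComp X (f.restr f' i)) _)
      (fun v => ?_) v
    refine ext_linear ((evalAt (freeComp X f') _).comp (evalAt (freeComp X f) _))
      (evalAt (freeComp X (f.comp f')) _) (fun t => ?_) u
    change freeComp X f' (freeComp X f (Finsupp.single t 1) fun i => Finsupp.single (v i) 1)
      (fun a => Finsupp.single (w a) 1) = freeComp X (f.comp f') (Finsupp.single t 1)
        fun i => freeComp X (f.restr f' i) (Finsupp.single (v i) 1)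
          fun a => Finsupp.single (w (f.enum i a)) 1
    simp only [freeComp_single]
    rw [TreeMonomial.comp_assoc]

/-- Morphisms of shuffle operads. -/
structure Hom (P Q : ShuffleOperad K) where
  map : ∀ {k : ℕ+}, P k →ₗ[K] Q k
  map_one : map P.one = Q.one
  map_comp : ∀ {k : ℕ+} {n : Fin k → ℕ+} {m : ℕ+} (f : ShuffleSurjection n m) (u : P k)
    (v : ∀ i, P (n i)), map (P.comp f u v) = Q.comp f (map u) fun i => map (v i)

namespace Hom

/-- The identity morphism. -/
def id (P : ShuffleOperad K) : Hom P P where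
  map := LinearMap.id
  map_one := rfl
  map_comp _ _ _ := rfl

/-- The composite of two morphisms, first `φ` and then `ψ`. -/
def comp {P Q R : ShuffleOperad K} (ψ : Hom Q R) (φ : Hom P Q) : Hom P R where
  map := ψ.map.comp φ.map
  map_one := by simp [φ.map_one, ψ.map_one]
  map_comp f u v := by simp [φ.map_comp, ψ.map_comp]

end Hom

/-- The value in `Q` of a tree monomial, given the values `φ` of the generators. -/
noncomputable def evalTree {X : ℕ+ → Type u} (Q : ShuffleOperad K) (φ : ∀ k, X k → Q k) :
    ∀ {k : ℕ+}, TreeMonomial X k → Q k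
  | _, .unit => Q.one
  | _, .node f x v => Q.comp f (φ _ x) fun i => evalTree Q φ (v i)

theorem evalTree_comp {X : ℕ+ → Type u} (Q : ShuffleOperad K) (φ : ∀ k, X k → Q k) {k : ℕ+}
    (t : TreeMonomial X k) : ∀ {n : Fin k → ℕ+} {m : ℕ+} (f : ShuffleSurjection n m)
    (w : ∀ i, TreeMonomial X (n i)),
    evalTree Q φ (t.comp f w) = Q.comp f (evalTree Q φ t) fun i => evalTree Q φ (w i) := by
  induction t with
  | unit =>
    intro n m f w
    obtain rfl := TreeMonomial.arity_of_unit f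
    have hs : ∀ i : Fin (1 : ℕ+), i = 0 := fun i => Subsingleton.elim (α := Fin 1) _ _
    have key : ∀ {n' : Fin (1 : ℕ+) → ℕ+} (_ : n' = n) (f : ShuffleSurjection n' (n 0))
        (w' : ∀ i, Q (n' i)) (x : Q (n 0)) (_ : ∀ i, HEq (w' i) x),
        Q.comp f Q.one w' = x := by
      intro n' hn' f w' x hw
      obtain rfl : n' = fun _ => n 0 := by
        rw [hn']
        funext i
        rw [hs i]
      obtain rfl : w' = fun _ => x := funext fun i => eq_of_heq (hw i)
      exact Q.one_comp f x
    refine (key rfl f _ _ fun i => ?_).symm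
    rw [hs i]
    rfl
  | node g x v ih =>
    intro n m f w
    simp only [TreeMonomial.comp, evalTree, ih, Q.assoc]

theorem map_evalTree {X : ℕ+ → Type u} {Q R : ShuffleOperad K} (ψ : Hom Q R)
    (φ : ∀ k, X k → Q k) {k : ℕ+} (t : TreeMonomial X k) :
    ψ.map (evalTree Q φ t) = evalTree R (fun k x => ψ.map (φ k x)) t := by
  induction t with
  | unit => exact ψ.map_one
  | node f x v ih => simp only [evalTree, ψ.map_comp, ih]

/-- The morphism from the free shuffle operad that extends `φ`. -/
noncomputable def lift {X : ℕ+ → Type u} {Q : ShuffleOperad K} (φ : ∀ k, X k → Q k) :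
    Hom (free K X) Q where
  map := Finsupp.linearCombination K fun t => evalTree Q φ t
  map_one := by
    change Finsupp.linearCombination K _ (Finsupp.single _ 1) = _
    rw [Finsupp.linearCombination_single, one_smul]
    rfl
  map_comp {k n m} f u v := by
    let L : ∀ {k : ℕ+}, (TreeMonomial X k →₀ K) →ₗ[K] Q k :=
      Finsupp.linearCombination K fun t => evalTree Q φ t
    have hL : ∀ {k : ℕ+} (t : TreeMonomial X k), L (Finsupp.single t 1) = evalTree Q φ t :=
      fun t => by simp only [L, Finsupp.linearCombination_single, one_smul]
    refine ext_single (L.compMultilinearMap (freeComp X f u))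
      ((Q.comp f (L u)).compLinearMap fun _ => L) (fun v => ?_) v
    refine ext_linear (L.comp (evalAt (freeComp X f) _)) ((evalAt (Q.comp f) _).comp L)
      (fun t => ?_) u
    change L (freeComp X f (Finsupp.single t 1) fun i => Finsupp.single (v i) 1) =
      Q.comp f (L (Finsupp.single t 1)) fun i => L (Finsupp.single (v i) 1)
    rw [freeComp_single]
    simp only [hL, evalTree_comp]

/-- The inclusion of the generators into the free shuffle operad. -/
noncomputable def of {X : ℕ+ → Type u} {k : ℕ+} (x : X k) : free K X k :=
  Finsupp.single (.node (.refl k) x fun _ => .unit) 1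

theorem lift_of {X : ℕ+ → Type u} {Q : ShuffleOperad K} (φ : ∀ k, X k → Q k) {k : ℕ+} (x : X k) :
    (lift φ).map (of x) = φ k x := by
  change Finsupp.linearCombination K _ (Finsupp.single _ 1) = _
  rw [Finsupp.linearCombination_single, one_smul]
  exact Q.comp_one _ _

theorem map_lift {X : ℕ+ → Type u} {Q R : ShuffleOperad K} (ψ : Hom Q R) (φ : ∀ k, X k → Q k)
    {k : ℕ+} (u : free K X k) : ψ.map ((lift φ).map u) = (lift fun k x => ψ.map (φ k x)).map u := by
  refine ext_linear (ψ.map.comp (lift φ).map) (lift fun k x => ψ.map (φ k x)).map (fun t => ?_) u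
  change ψ.map (Finsupp.linearCombination K _ (Finsupp.single _ 1)) =
    Finsupp.linearCombination K _ (Finsupp.single _ 1)
  rw [Finsupp.linearCombination_single, one_smul, Finsupp.linearCombination_single, one_smul]
  exact map_evalTree ψ φ t

section quotient

variable (P : ShuffleOperad K) (r : ∀ k, P k → P k → Prop)

/-- Membership in the operadic ideal generated by the differences `a - b` with `r a b`. -/
inductive IdealGen : ∀ k, P k → Prop
  | base {k : ℕ+} (a b : P k) : r k a b → IdealGen k (a - b)
  | zero {k : ℕ+} : IdealGen k 0
  | add {k : ℕ+} (a b : P k) : IdealGen k a → IdealGen k b → IdealGen k (a + b)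
  | smul {k : ℕ+} (c : K) (a : P k) : IdealGen k a → IdealGen k (c • a)
  | root {k : ℕ+} {n : Fin k → ℕ+} {m : ℕ+} (f : ShuffleSurjection n m) (u : P k)
      (v : ∀ i, P (n i)) : IdealGen k u → IdealGen m (P.comp f u v)
  | input {k : ℕ+} {n : Fin k → ℕ+} {m : ℕ+} (f : ShuffleSurjection n m) (u : P k)
      (v : ∀ i, P (n i)) (i : Fin k) : IdealGen (n i) (v i) → IdealGen m (P.comp f u v)

/-- The ideal generated by the differences `a - b` with `r a b`. -/
def ideal (k : ℕ+) : Submodule K (P k) where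
  carrier := {a | IdealGen P r k a}
  add_mem' := fun ha hb => .add _ _ ha hb
  zero_mem' := .zero
  smul_mem' := fun c _ ha => .smul c _ ha

theorem comp_sub_comp_mem {k : ℕ+} {n : Fin k → ℕ+} {m : ℕ+} (f : ShuffleSurjection n m)
    (u u' : P k) (hu : u - u' ∈ ideal P r k) (v v' : ∀ i, P (n i))
    (hv : ∀ i, v i - v' i ∈ ideal P r (n i)) :
    P.comp f u v - P.comp f u' v' ∈ ideal P r m := by
  have h1 : P.comp f u v - P.comp f u' v ∈ ideal P r m := by
    have : P.comp f u v - P.comp f u' v = P.comp f (u - u') v := by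
      rw [map_sub]; rfl
    rw [this]
    exact .root f _ v hu
  have h2 : ∀ s : Finset (Fin k),
      P.comp f u' (s.piecewise v v') - P.comp f u' v' ∈ ideal P r m := by
    intro s
    induction s using Finset.induction_on with
    | empty => simp
    | insert i s hi ih =>
      have hd : P.comp f u' (Function.update (s.piecewise v v') i (v i - v' i)) ∈
          ideal P r m := by
        refine .input f u' _ i ?_
        rw [Function.update_self]
        exact hv i
      rw [MultilinearMap.map_update_sub, ← Finset.piecewise_insert] at hd
      have he : Function.update (s.piecewise v v') i (v' i) = s.piecewise v v' := by
        rw [Function.update_eq_self_iff]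
        simp [hi]
      rw [he] at hd
      have := (ideal P r m).add_mem hd ih
      rwa [sub_add_sub_cancel] at this
  have h3 := (ideal P r m).add_mem h1 (h2 Finset.univ)
  rw [Finset.piecewise_univ] at h3
  rwa [sub_add_sub_cancel] at h3

/-- Composition in the quotient, through representatives. -/
noncomputable def quotCompFun {k : ℕ+} {n : Fin k → ℕ+} {m : ℕ+} (f : ShuffleSurjection n m)
    (U : P k ⧸ ideal P r k) (V : ∀ i, P (n i) ⧸ ideal P r (n i)) : P m ⧸ ideal P r m :=
  Submodule.Quotient.mk (P.comp f (Function.surjInv (Submodule.Quotient.mk_surjective _) U)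
    fun i => Function.surjInv (Submodule.Quotient.mk_surjective _) (V i))

theorem quotCompFun_mk {k : ℕ+} {n : Fin k → ℕ+} {m : ℕ+} (f : ShuffleSurjection n m)
    (u : P k) (v : ∀ i, P (n i)) :
    quotCompFun P r f (Submodule.Quotient.mk u) (fun i => Submodule.Quotient.mk (v i)) =
      Submodule.Quotient.mk (P.comp f u v) := by
  refine (Submodule.Quotient.eq _).2 (comp_sub_comp_mem P r f _ _ ?_ _ _ fun i => ?_)
  · exact (Submodule.Quotient.eq _).1 (Function.surjInv_eq _ _)
  · exact (Submodule.Quotient.eq _).1 (Function.surjInv_eq _ _)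

theorem exists_rep {k : ℕ} {n : Fin k → ℕ+} (V : ∀ i, P (n i) ⧸ ideal P r (n i)) :
    ∃ v : ∀ i, P (n i), V = fun i => Submodule.Quotient.mk (v i) := by
  choose v hv using fun i => Submodule.Quotient.mk_surjective _ (V i)
  exact ⟨v, funext fun i => (hv i).symm⟩

theorem update_mk {k : ℕ} {n : Fin k → ℕ+} (v : ∀ i, P (n i)) (i : Fin k) (x : P (n i)) :
    Function.update (fun j => (Submodule.Quotient.mk (v j) : P (n j) ⧸ ideal P r (n j))) i
      (Submodule.Quotient.mk x) = fun j => Submodule.Quotient.mk (Function.update v i x j) := by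
  funext j
  by_cases h : j = i
  · subst h
    simp
  · simp [h]

/-- Composition in the quotient, as a multilinear map. -/
noncomputable def quotComp {k : ℕ+} {n : Fin k → ℕ+} {m : ℕ+} (f : ShuffleSurjection n m) :
    (P k ⧸ ideal P r k) →ₗ[K]
      MultilinearMap K (fun i => P (n i) ⧸ ideal P r (n i)) (P m ⧸ ideal P r m) where
  toFun U := MultilinearMap.mk' (quotCompFun P r f U)
    (fun V i x y => by
      obtain ⟨v, rfl⟩ := exists_rep P r V
      obtain ⟨x, rfl⟩ := Submodule.Quotient.mk_surjective _ x
      obtain ⟨y, rfl⟩ := Submodule.Quotient.mk_surjective _ y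
      obtain ⟨U, rfl⟩ := Submodule.Quotient.mk_surjective _ U
      rw [← Submodule.Quotient.mk_add]
      rw [update_mk P r v i (x + y), update_mk P r v i x, update_mk P r v i y]
      simp only [quotCompFun_mk, MultilinearMap.map_update_add]
      rfl)
    (fun V i c x => by
      obtain ⟨v, rfl⟩ := exists_rep P r V
      obtain ⟨x, rfl⟩ := Submodule.Quotient.mk_surjective _ x
      obtain ⟨U, rfl⟩ := Submodule.Quotient.mk_surjective _ U
      rw [← Submodule.Quotient.mk_smul]
      rw [update_mk P r v i (c • x), update_mk P r v i x]
      simp only [quotCompFun_mk, MultilinearMap.map_update_smul]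
      rfl)
  map_add' U U' := by
    ext V
    obtain ⟨v, rfl⟩ := exists_rep P r V
    obtain ⟨U, rfl⟩ := Submodule.Quotient.mk_surjective _ U
    obtain ⟨U', rfl⟩ := Submodule.Quotient.mk_surjective _ U'
    change quotCompFun P r f (Submodule.Quotient.mk (U + U')) _ =
      quotCompFun P r f (Submodule.Quotient.mk U) _ + quotCompFun P r f (Submodule.Quotient.mk U') _
    rw [quotCompFun_mk, quotCompFun_mk, quotCompFun_mk, map_add]
    rfl
  map_smul' c U := by
    ext V
    obtain ⟨v, rfl⟩ := exists_rep P r V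
    obtain ⟨U, rfl⟩ := Submodule.Quotient.mk_surjective _ U
    change quotCompFun P r f (Submodule.Quotient.mk (c • U)) _ =
      c • quotCompFun P r f (Submodule.Quotient.mk U) _
    rw [quotCompFun_mk, quotCompFun_mk, map_smul]
    rfl

theorem quotComp_mk {k : ℕ+} {n : Fin k → ℕ+} {m : ℕ+} (f : ShuffleSurjection n m)
    (u : P k) (v : ∀ i, P (n i)) :
    quotComp P r f (Submodule.Quotient.mk u) (fun i => Submodule.Quotient.mk (v i)) =
      Submodule.Quotient.mk (P.comp f u v) :=
  quotCompFun_mk P r f u v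

/-- The quotient of a shuffle operad by the ideal generated by `a - b`, for `r a b`. -/
noncomputable def quot : ShuffleOperad K where
  obj k := P k ⧸ ideal P r k
  one := Submodule.Quotient.mk P.one
  comp f := quotComp P r f
  comp_one f U := by
    obtain ⟨u, rfl⟩ := Submodule.Quotient.mk_surjective _ U
    rw [quotComp_mk P r f u fun _ => P.one, P.comp_one]
  one_comp f U := by
    obtain ⟨u, rfl⟩ := Submodule.Quotient.mk_surjective _ U
    rw [quotComp_mk P r f P.one fun _ => u, P.one_comp]
  assoc f f' U V W := by
    obtain ⟨u, rfl⟩ := Submodule.Quotient.mk_surjective _ U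
    obtain ⟨v, rfl⟩ := exists_rep P r V
    obtain ⟨w, rfl⟩ := exists_rep P r W
    simp only [quotComp_mk]
    rw [P.assoc]

/-- The projection onto the quotient. -/
def quotMk : Hom P (quot P r) where
  map := Submodule.mkQ _
  map_one := rfl
  map_comp f u v := (quotComp_mk P r f u v).symm

variable {P r}

theorem quotMk_eq {k : ℕ+} {a b : P k} (h : r k a b) : (quotMk P r).map a = (quotMk P r).map b :=
  (Submodule.Quotient.eq _).2 (.base a b h)

theorem quotMk_surjective {k : ℕ+} (U : quot P r k) : ∃ u, (quotMk P r).map u = U :=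
  Submodule.Quotient.mk_surjective _ U

theorem map_eq_zero_of_ideal {Q : ShuffleOperad K} (φ : Hom P Q)
    (h : ∀ k a b, r k a b → φ.map a = φ.map b) {k : ℕ+} {a : P k} (ha : IdealGen P r k a) :
    φ.map a = 0 := by
  induction ha with
  | base a b hab => rw [map_sub, h _ _ _ hab, sub_self]
  | zero => exact map_zero _
  | add a b _ _ iha ihb => rw [map_add, iha, ihb, add_zero]
  | smul c a _ ih => rw [map_smul, ih, smul_zero]
  | root f u v _ ih => rw [φ.map_comp, ih, map_zero]; rfl
  | input f u v i _ ih =>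
    rw [φ.map_comp]
    exact MultilinearMap.map_coord_zero _ i ih

/-- The universal property of the quotient. -/
def quotLift {Q : ShuffleOperad K} (φ : Hom P Q) (h : ∀ k a b, r k a b → φ.map a = φ.map b) :
    Hom (quot P r) Q where
  map := Submodule.liftQ _ φ.map fun _ ha => map_eq_zero_of_ideal φ h ha
  map_one := φ.map_one
  map_comp f U V := by
    obtain ⟨u, rfl⟩ := Submodule.Quotient.mk_surjective _ U
    obtain ⟨v, rfl⟩ := exists_rep P r V
    change Submodule.liftQ _ φ.map _ (quotComp P r f _ _) = _
    rw [quotComp_mk]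
    exact φ.map_comp f u v

theorem quotLift_mk {Q : ShuffleOperad K} (φ : Hom P Q) (h : ∀ k a b, r k a b → φ.map a = φ.map b)
    {k : ℕ+} (a : P k) : (quotLift φ h).map ((quotMk P r).map a) = φ.map a := rfl

end quotient

theorem Hom.ext_map {K : Type u} [Field K] {P Q : ShuffleOperad K} {φ ψ : Hom P Q}
    (h : ∀ {m : ℕ+} (a : P m), φ.map a = ψ.map a) : φ = ψ := by
  obtain ⟨φ, _, _⟩ := φ
  obtain ⟨ψ, _, _⟩ := ψ
  have : @φ = @ψ := by
    funext m
    exact LinearMap.ext h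
  subst this
  rfl

end ShuffleOperad

section

open ShuffleOperad

/-- A shuffle `n`-operad, that is, an `n`-category in shuffle operads, in the single-sorted
presentation: `top` is the operad of `n`-cells, and `src k a`, `tgt k a` are the identity `n`-cells
on the `k`-source and the `k`-target of `a` (so that the `k`-cells are the image of `src k`).
By linearity and unitality, the `⋆ₖ`-composite of a composable pair is necessarily
`a - tgt k a + b`, and this formula satisfies all the axioms of an `n`-category in vector spaces;
what remains is that `⋆ₖ` is a morphism of shuffle operads, which is the field `exchange`. -/
structure NOperad (K : Type u) [Field K] (n : ℕ) where
  top : ShuffleOperad K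
  src : ℕ → Hom top top
  tgt : ℕ → Hom top top
  src_top : ∀ k, n ≤ k → ∀ {m : ℕ+} (a : top m), (src k).map a = a
  tgt_top : ∀ k, n ≤ k → ∀ {m : ℕ+} (a : top m), (tgt k).map a = a
  src_src : ∀ j k, j ≤ k → ∀ {m : ℕ+} (a : top m), (src j).map ((src k).map a) = (src j).map a
  src_tgt : ∀ j k, j < k → ∀ {m : ℕ+} (a : top m), (src j).map ((tgt k).map a) = (src j).map a
  tgt_src : ∀ j k, j < k → ∀ {m : ℕ+} (a : top m), (tgt j).map ((src k).map a) = (tgt j).map a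
  tgt_tgt : ∀ j k, j ≤ k → ∀ {m : ℕ+} (a : top m), (tgt j).map ((tgt k).map a) = (tgt j).map a
  src_id_src : ∀ j k, j ≤ k → ∀ {m : ℕ+} (a : top m), (src k).map ((src j).map a) = (src j).map a
  src_id_tgt : ∀ j k, j ≤ k → ∀ {m : ℕ+} (a : top m), (src k).map ((tgt j).map a) = (tgt j).map a
  tgt_id_src : ∀ j k, j ≤ k → ∀ {m : ℕ+} (a : top m), (tgt k).map ((src j).map a) = (src j).map a
  tgt_id_tgt : ∀ j k, j ≤ k → ∀ {m : ℕ+} (a : top m), (tgt k).map ((tgt j).map a) = (tgt j).map a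
  exchange : ∀ k, k < n → ∀ {r : ℕ+} {p : Fin r → ℕ+} {m : ℕ+} (f : ShuffleSurjection p m)
    (a b : top r) (v w : ∀ i, top (p i)), (tgt k).map a = (src k).map b →
    (∀ i, (tgt k).map (v i) = (src k).map (w i)) →
    top.comp f (a - (tgt k).map a + b) (fun i => v i - (tgt k).map (v i) + w i) =
      top.comp f a v - (tgt k).map (top.comp f a v) + top.comp f b w

/-- A cellular extension of an `n`-operad: an indexed set of `(n + 1)`-generators, whose sources and
targets are parallel `n`-cells. -/
structure CellExt {K : Type u} [Field K] {n : ℕ} (S : NOperad K n) where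
  gen : ℕ+ → Type u
  src : ∀ k, gen k → S.top k
  tgt : ∀ k, gen k → S.top k
  src_globular : ∀ j, j < n → ∀ k (x : gen k), (S.src j).map (src k x) = (S.src j).map (tgt k x)
  tgt_globular : ∀ j, j < n → ∀ k (x : gen k), (S.tgt j).map (src k x) = (S.tgt j).map (tgt k x)

namespace CellExt

variable {K : Type u} [Field K] {n : ℕ} {S : NOperad K n} (E : CellExt S)

/-- The free shuffle operad on the generators of `E` and on the `n`-cells of `S`, the latter standing
for their identities. -/
noncomputable abbrev Pre : ShuffleOperad K := free K fun k => S.top k ⊕ E.gen k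

/-- The formal identity on an `n`-cell. -/
noncomputable def preId {k : ℕ+} (a : S.top k) : E.Pre k := of (Sum.inl a)

/-- The `n`-source. -/
noncomputable def preSrc : Hom E.Pre S.top := lift fun k => Sum.elim id (E.src k)

/-- The `n`-target. -/
noncomputable def preTgt : Hom E.Pre S.top := lift fun k => Sum.elim id (E.tgt k)

/-- The composite `a ⋆ₖ b = a - tₖ(a) + b`. -/
noncomputable def preStar (k : ℕ) {m : ℕ+} (a b : E.Pre m) : E.Pre m :=
  a - E.preId ((S.tgt k).map (E.preTgt.map a)) + b

/-- The `k`-target of `a` is the `k`-source of `b`. -/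
def PreComposable (k : ℕ) {m : ℕ+} (a b : E.Pre m) : Prop :=
  (S.tgt k).map (E.preTgt.map a) = (S.src k).map (E.preSrc.map b)

/-- The relations of the free extension: identities form a morphism of operads, and all the
compositions `⋆ₖ`, for `k ≤ n`, are compatible with shuffle composition. -/
inductive Rel : ∀ k : ℕ+, E.Pre k → E.Pre k → Prop
  | add {k : ℕ+} (a b : S.top k) : Rel k (E.preId (a + b)) (E.preId a + E.preId b)
  | smul {k : ℕ+} (c : K) (a : S.top k) : Rel k (E.preId (c • a)) (c • E.preId a)
  | one : Rel 1 (E.preId S.top.one) E.Pre.one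
  | comp {r : ℕ+} {p : Fin r → ℕ+} {m : ℕ+} (f : ShuffleSurjection p m) (a : S.top r)
      (v : ∀ i, S.top (p i)) :
      Rel m (E.preId (S.top.comp f a v)) (E.Pre.comp f (E.preId a) fun i => E.preId (v i))
  | exchange {k : ℕ} (hk : k ≤ n) {r : ℕ+} {p : Fin r → ℕ+} {m : ℕ+} (f : ShuffleSurjection p m)
      (a b : E.Pre r) (v w : ∀ i, E.Pre (p i)) (h : E.PreComposable k a b)
      (hv : ∀ i, E.PreComposable k (v i) (w i)) :
      Rel m (E.Pre.comp f (E.preStar k a b) fun i => E.preStar k (v i) (w i))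
        (E.preStar k (E.Pre.comp f a v) (E.Pre.comp f b w))

/-- The operad of `(n + 1)`-cells of the free extension. -/
noncomputable def freeTop : ShuffleOperad K := quot E.Pre E.Rel

/-- The projection onto the operad of `(n + 1)`-cells. -/
noncomputable def proj : Hom E.Pre E.freeTop := quotMk E.Pre E.Rel

variable {E} in
theorem proj_eq {k : ℕ+} {a b : E.Pre k} (h : E.Rel k a b) : E.proj.map a = E.proj.map b := quotMk_eq h

theorem proj_surjective {k : ℕ+} (a : E.freeTop k) : ∃ b, E.proj.map b = a := quotMk_surjective a

theorem preSrc_id {k : ℕ+} (a : S.top k) : E.preSrc.map (E.preId a) = a := lift_of _ _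

theorem preTgt_id {k : ℕ+} (a : S.top k) : E.preTgt.map (E.preId a) = a := lift_of _ _

theorem src_preTgt {j : ℕ} (hj : j < n) {k : ℕ+} (a : E.Pre k) :
    (S.src j).map (E.preTgt.map a) = (S.src j).map (E.preSrc.map a) := by
  unfold preTgt preSrc
  rw [map_lift, map_lift]
  congr 3
  funext k x
  rcases x with x | x
  · rfl
  · exact (E.src_globular j hj k x).symm

theorem tgt_preSrc {j : ℕ} (hj : j < n) {k : ℕ+} (a : E.Pre k) :
    (S.tgt j).map (E.preSrc.map a) = (S.tgt j).map (E.preTgt.map a) := by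
  unfold preTgt preSrc
  rw [map_lift, map_lift]
  congr 3
  funext k x
  rcases x with x | x
  · rfl
  · exact E.tgt_globular j hj k x

theorem preSrc_rel {k : ℕ+} {a b : E.Pre k} (h : E.Rel k a b) :
    E.preSrc.map a = E.preSrc.map b := by
  induction h with
  | add a b => rw [map_add, preSrc_id, preSrc_id, preSrc_id]
  | smul c a => rw [map_smul, preSrc_id, preSrc_id]
  | one => rw [preSrc_id, E.preSrc.map_one]
  | comp f a v => simp only [E.preSrc.map_comp, preSrc_id]
  | exchange hk f a b v w h hv =>
    rename_i k r p m
    rcases hk.lt_or_eq with hk | rfl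
    · have hs : ∀ {m : ℕ+} (a b : E.Pre m), E.preSrc.map (E.preStar k a b) =
          E.preSrc.map a - (S.tgt k).map (E.preSrc.map a) + E.preSrc.map b := by
        intro m a b
        rw [preStar, map_add, map_sub, preSrc_id, E.tgt_preSrc hk]
      rw [E.preSrc.map_comp]
      simp only [hs]
      rw [S.exchange k hk]
      · rw [E.preSrc.map_comp, E.preSrc.map_comp]
      · rw [E.tgt_preSrc hk]; exact h
      · intro i; rw [E.tgt_preSrc hk]; exact hv i
    · have hs : ∀ {m : ℕ+} (a b : E.Pre m), E.PreComposable k a b →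
          E.preSrc.map (E.preStar k a b) = E.preSrc.map a := by
        intro m a b h
        rw [PreComposable, S.src_top _ le_rfl] at h
        rw [preStar, map_add, map_sub, preSrc_id, h, sub_add_cancel]
      have hc : E.PreComposable k (E.Pre.comp f a v) (E.Pre.comp f b w) := by
        unfold PreComposable at *
        simp only [Hom.map_comp, h, hv]
      rw [hs _ _ hc, E.preSrc.map_comp, E.preSrc.map_comp, hs _ _ h]
      congr 1
      funext i
      exact hs _ _ (hv i)

theorem preTgt_rel {k : ℕ+} {a b : E.Pre k} (h : E.Rel k a b) :
    E.preTgt.map a = E.preTgt.map b := by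
  induction h with
  | add a b => rw [map_add, preTgt_id, preTgt_id, preTgt_id]
  | smul c a => rw [map_smul, preTgt_id, preTgt_id]
  | one => rw [preTgt_id, E.preTgt.map_one]
  | comp f a v => simp only [E.preTgt.map_comp, preTgt_id]
  | exchange hk f a b v w h hv =>
    rename_i k r p m
    rcases hk.lt_or_eq with hk | rfl
    · have hs : ∀ {m : ℕ+} (a b : E.Pre m), E.preTgt.map (E.preStar k a b) =
          E.preTgt.map a - (S.tgt k).map (E.preTgt.map a) + E.preTgt.map b := by
        intro m a b
        rw [preStar, map_add, map_sub, preTgt_id]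
      rw [E.preTgt.map_comp]
      simp only [hs]
      rw [S.exchange k hk]
      · rw [E.preTgt.map_comp, E.preTgt.map_comp]
      · rw [E.src_preTgt hk]; exact h
      · intro i; rw [E.src_preTgt hk]; exact hv i
    · have hs : ∀ {m : ℕ+} (a b : E.Pre m),
          E.preTgt.map (E.preStar k a b) = E.preTgt.map b := by
        intro m a b
        rw [preStar, map_add, map_sub, preTgt_id, S.tgt_top _ le_rfl, sub_self, zero_add]
      rw [hs, E.preTgt.map_comp, E.preTgt.map_comp, hs]
      simp only [hs]

/-- The source map from `(n + 1)`-cells to `n`-cells. -/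
noncomputable def freeSrc : Hom E.freeTop S.top := quotLift E.preSrc fun _ _ _ h => E.preSrc_rel h

/-- The target map from `(n + 1)`-cells to `n`-cells. -/
noncomputable def freeTgt : Hom E.freeTop S.top := quotLift E.preTgt fun _ _ _ h => E.preTgt_rel h

/-- The identity map from `n`-cells to `(n + 1)`-cells. -/
noncomputable def freeId : Hom S.top E.freeTop where
  map :=
    { toFun := fun a => E.proj.map (E.preId a)
      map_add' := fun a b => by rw [← map_add]; exact proj_eq (.add a b)
      map_smul' := fun c a => by
        rw [RingHom.id_apply, ← map_smul]; exact proj_eq (.smul c a) }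
  map_one := (proj_eq (Rel.one (E := E))).trans E.proj.map_one
  map_comp f a v := (proj_eq (.comp f a v)).trans (E.proj.map_comp _ _ _)

theorem freeSrc_id {k : ℕ+} (a : S.top k) : E.freeSrc.map (E.freeId.map a) = a := E.preSrc_id a

theorem freeTgt_id {k : ℕ+} (a : S.top k) : E.freeTgt.map (E.freeId.map a) = a := E.preTgt_id a

theorem src_freeTgt {j : ℕ} (hj : j < n) {k : ℕ+} (a : E.freeTop k) :
    (S.src j).map (E.freeTgt.map a) = (S.src j).map (E.freeSrc.map a) := by
  obtain ⟨a, rfl⟩ := E.proj_surjective a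
  exact E.src_preTgt hj a

theorem tgt_freeSrc {j : ℕ} (hj : j < n) {k : ℕ+} (a : E.freeTop k) :
    (S.tgt j).map (E.freeSrc.map a) = (S.tgt j).map (E.freeTgt.map a) := by
  obtain ⟨a, rfl⟩ := E.proj_surjective a
  exact E.tgt_preSrc hj a

open Classical in
/-- The identity `(n + 1)`-cell on the `k`-source. -/
noncomputable def srcHom (k : ℕ) : Hom E.freeTop E.freeTop :=
  if k ≤ n then E.freeId.comp ((S.src k).comp E.freeSrc) else Hom.id _

open Classical in
/-- The identity `(n + 1)`-cell on the `k`-target. -/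
noncomputable def tgtHom (k : ℕ) : Hom E.freeTop E.freeTop :=
  if k ≤ n then E.freeId.comp ((S.tgt k).comp E.freeTgt) else Hom.id _

theorem srcHom_le {k : ℕ} (h : k ≤ n) {m : ℕ+} (a : E.freeTop m) :
    (E.srcHom k).map a = E.freeId.map ((S.src k).map (E.freeSrc.map a)) := by
  rw [srcHom, if_pos h]; rfl

theorem tgtHom_le {k : ℕ} (h : k ≤ n) {m : ℕ+} (a : E.freeTop m) :
    (E.tgtHom k).map a = E.freeId.map ((S.tgt k).map (E.freeTgt.map a)) := by
  rw [tgtHom, if_pos h]; rfl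

theorem srcHom_lt {k : ℕ} (h : n < k) {m : ℕ+} (a : E.freeTop m) : (E.srcHom k).map a = a := by
  rw [srcHom, if_neg h.not_ge]; rfl

theorem tgtHom_lt {k : ℕ} (h : n < k) {m : ℕ+} (a : E.freeTop m) : (E.tgtHom k).map a = a := by
  rw [tgtHom, if_neg h.not_ge]; rfl

/-- The free `(n + 1)`-operad `S[E]` on an `n`-operad with a cellular extension. -/
noncomputable def freeExtension : NOperad K (n + 1) where
  top := E.freeTop
  src := E.srcHom
  tgt := E.tgtHom
  src_top k hk _ a := E.srcHom_lt hk a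
  tgt_top k hk _ a := E.tgtHom_lt hk a
  src_src j k hjk _ a := by
    rcases le_or_gt k n with hk | hk
    · rw [E.srcHom_le hk, E.srcHom_le (hjk.trans hk), E.srcHom_le (hjk.trans hk), freeSrc_id,
        S.src_src j k hjk]
    · rw [E.srcHom_lt hk]
  src_tgt j k hjk _ a := by
    rcases le_or_gt k n with hk | hk
    · rw [E.tgtHom_le hk, E.srcHom_le (hjk.le.trans hk), E.srcHom_le (hjk.le.trans hk), freeSrc_id,
        S.src_tgt j k hjk, E.src_freeTgt (hjk.trans_le hk)]
    · rw [E.tgtHom_lt hk]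
  tgt_src j k hjk _ a := by
    rcases le_or_gt k n with hk | hk
    · rw [E.srcHom_le hk, E.tgtHom_le (hjk.le.trans hk), E.tgtHom_le (hjk.le.trans hk), freeTgt_id,
        S.tgt_src j k hjk, E.tgt_freeSrc (hjk.trans_le hk)]
    · rw [E.srcHom_lt hk]
  tgt_tgt j k hjk _ a := by
    rcases le_or_gt k n with hk | hk
    · rw [E.tgtHom_le hk, E.tgtHom_le (hjk.trans hk), E.tgtHom_le (hjk.trans hk), freeTgt_id,
        S.tgt_tgt j k hjk]
    · rw [E.tgtHom_lt hk]
  src_id_src j k hjk _ a := by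
    rcases le_or_gt k n with hk | hk
    · rw [E.srcHom_le hk, E.srcHom_le (hjk.trans hk), freeSrc_id, S.src_id_src j k hjk]
    · rw [E.srcHom_lt hk]
  src_id_tgt j k hjk _ a := by
    rcases le_or_gt k n with hk | hk
    · rw [E.srcHom_le hk, E.tgtHom_le (hjk.trans hk), freeSrc_id, S.src_id_tgt j k hjk]
    · rw [E.srcHom_lt hk]
  tgt_id_src j k hjk _ a := by
    rcases le_or_gt k n with hk | hk
    · rw [E.tgtHom_le hk, E.srcHom_le (hjk.trans hk), freeTgt_id, S.tgt_id_src j k hjk]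
    · rw [E.tgtHom_lt hk]
  tgt_id_tgt j k hjk _ a := by
    rcases le_or_gt k n with hk | hk
    · rw [E.tgtHom_le hk, E.tgtHom_le (hjk.trans hk), freeTgt_id, S.tgt_id_tgt j k hjk]
    · rw [E.tgtHom_lt hk]
  exchange k hk r p m f a b v w h hv := by
    have hk := Nat.lt_succ_iff.1 hk
    have hmk : ∀ {m : ℕ+} (a : E.Pre m), (E.tgtHom k).map (E.proj.map a) =
        E.proj.map (E.preId ((S.tgt k).map (E.preTgt.map a))) := by
      intro m a
      rw [E.tgtHom_le hk]
      rfl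
    have hcomp : ∀ {m : ℕ+} (a b : E.Pre m), (E.tgtHom k).map (E.proj.map a) =
        (E.srcHom k).map (E.proj.map b) → E.PreComposable k a b := by
      intro m a b h
      rw [E.tgtHom_le hk, E.srcHom_le hk] at h
      have := congrArg (fun x => E.freeSrc.map x) h
      simp only [freeSrc_id] at this
      exact this
    obtain ⟨a, rfl⟩ := E.proj_surjective a
    obtain ⟨b, rfl⟩ := E.proj_surjective b
    obtain ⟨v, rfl⟩ : ∃ v' : ∀ i, E.Pre (p i), v = fun i => E.proj.map (v' i) :=
      exists_rep E.Pre E.Rel v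
    obtain ⟨w, rfl⟩ : ∃ w' : ∀ i, E.Pre (p i), w = fun i => E.proj.map (w' i) :=
      exists_rep E.Pre E.Rel w
    have key := proj_eq (Rel.exchange hk f a b v w (hcomp _ _ h) fun i => hcomp _ _ (hv i))
    have hs : ∀ {m : ℕ+} (a b : E.Pre m), E.proj.map (E.preStar k a b) =
        E.proj.map a - (E.tgtHom k).map (E.proj.map a) +
          E.proj.map b := by
      intro m a b
      rw [preStar, map_add, map_sub, hmk]
    rw [Hom.map_comp, hs] at key
    simp only [hs] at key
    simp only [Hom.map_comp E.proj] at key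
    exact key

end CellExt

/-- A shuffle operad, as a `0`-operad. -/
def NOperad.ofOperad {K : Type u} [Field K] (P : ShuffleOperad K) : NOperad K 0 where
  top := P
  src _ := Hom.id P
  tgt _ := Hom.id P
  src_top _ _ _ _ := rfl
  tgt_top _ _ _ _ := rfl
  src_src _ _ _ _ _ := rfl
  src_tgt _ _ _ _ _ := rfl
  tgt_src _ _ _ _ _ := rfl
  tgt_tgt _ _ _ _ _ := rfl
  src_id_src _ _ _ _ _ := rfl
  src_id_tgt _ _ _ _ _ := rfl
  tgt_id_src _ _ _ _ _ := rfl
  tgt_id_tgt _ _ _ _ _ := rfl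
  exchange _ hk := absurd hk (Nat.not_lt_zero _)

/-- A reflexive globular object in shuffle operads. -/
structure GlobularOperad (K : Type u) [Field K] where
  cell : ℕ → ShuffleOperad K
  s : ∀ n, Hom (cell (n + 1)) (cell n)
  t : ∀ n, Hom (cell (n + 1)) (cell n)
  i : ∀ n, Hom (cell n) (cell (n + 1))
  s_s : ∀ n {m : ℕ+} (a : cell (n + 2) m),
    (s n).map ((s (n + 1)).map a) = (s n).map ((t (n + 1)).map a)
  t_t : ∀ n {m : ℕ+} (a : cell (n + 2) m),
    (t n).map ((t (n + 1)).map a) = (t n).map ((s (n + 1)).map a)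
  s_i : ∀ n {m : ℕ+} (a : cell n m), (s n).map ((i n).map a) = a
  t_i : ∀ n {m : ℕ+} (a : cell n m), (t n).map ((i n).map a) = a

namespace GlobularOperad

variable {K : Type u} [Field K] (P : GlobularOperad K)

/-- `P.src n k a` is the `k`-source of the `n`-cell `a`, seen as an `n`-cell. -/
def src : ∀ n : ℕ, ℕ → Hom (P.cell n) (P.cell n)
  | 0, _ => Hom.id _
  | n + 1, k => if k ≤ n then (P.i n).comp ((src n k).comp (P.s n)) else Hom.id _

/-- `P.tgt n k a` is the `k`-target of the `n`-cell `a`, seen as an `n`-cell. -/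
def tgt : ∀ n : ℕ, ℕ → Hom (P.cell n) (P.cell n)
  | 0, _ => Hom.id _
  | n + 1, k => if k ≤ n then (P.i n).comp ((tgt n k).comp (P.t n)) else Hom.id _

/-- The pair `(a, b)` is `⋆ₖ`-composable: the `k`-target of `a` is the `k`-source of `b`. -/
def Composable {n : ℕ} (k : ℕ) {m : ℕ+} (a b : P.cell n m) : Prop :=
  (P.tgt n k).map a = (P.src n k).map b

theorem src_le {n k : ℕ} (h : k ≤ n) {m : ℕ+} (a : P.cell (n + 1) m) :
    (P.src (n + 1) k).map a = (P.i n).map ((P.src n k).map ((P.s n).map a)) := by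
  rw [src, if_pos h]; rfl

theorem tgt_le {n k : ℕ} (h : k ≤ n) {m : ℕ+} (a : P.cell (n + 1) m) :
    (P.tgt (n + 1) k).map a = (P.i n).map ((P.tgt n k).map ((P.t n).map a)) := by
  rw [tgt, if_pos h]; rfl

theorem src_ge {n k : ℕ} (h : n ≤ k) {m : ℕ+} (a : P.cell n m) : (P.src n k).map a = a := by
  cases n with
  | zero => rfl
  | succ n => rw [src, if_neg (by omega)]; rfl

theorem tgt_ge {n k : ℕ} (h : n ≤ k) {m : ℕ+} (a : P.cell n m) : (P.tgt n k).map a = a := by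
  cases n with
  | zero => rfl
  | succ n => rw [tgt, if_neg (by omega)]; rfl

end GlobularOperad

/-- A shuffle `ω`-operad, that is, a strict `ω`-category in shuffle operads. The composite
`star k a b` of two `n`-cells is meaningful only for `k < n` and `⋆ₖ`-composable pairs `(a, b)`. -/
structure OmegaOperad (K : Type u) [Field K] extends GlobularOperad K where
  star : ∀ {n : ℕ} (k : ℕ) {m : ℕ+}, cell n m → cell n m → cell n m
  s_star_self : ∀ {n : ℕ} {m : ℕ+} (a b : cell (n + 1) m),
    toGlobularOperad.Composable n a b → (s n).map (star n a b) = (s n).map a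
  t_star_self : ∀ {n : ℕ} {m : ℕ+} (a b : cell (n + 1) m),
    toGlobularOperad.Composable n a b → (t n).map (star n a b) = (t n).map b
  s_star : ∀ {n k : ℕ}, k < n → ∀ {m : ℕ+} (a b : cell (n + 1) m),
    toGlobularOperad.Composable k a b → (s n).map (star k a b) = star k ((s n).map a) ((s n).map b)
  t_star : ∀ {n k : ℕ}, k < n → ∀ {m : ℕ+} (a b : cell (n + 1) m),
    toGlobularOperad.Composable k a b → (t n).map (star k a b) = star k ((t n).map a) ((t n).map b)
  i_star : ∀ {n k : ℕ}, k < n → ∀ {m : ℕ+} (a b : cell n m),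
    toGlobularOperad.Composable k a b → (i n).map (star k a b) = star k ((i n).map a) ((i n).map b)
  src_star : ∀ {n k : ℕ}, k < n → ∀ {m : ℕ+} (a : cell n m),
    star k ((toGlobularOperad.src n k).map a) a = a
  star_tgt : ∀ {n k : ℕ}, k < n → ∀ {m : ℕ+} (a : cell n m),
    star k a ((toGlobularOperad.tgt n k).map a) = a
  star_assoc : ∀ {n k : ℕ}, k < n → ∀ {m : ℕ+} (a b c : cell n m),
    toGlobularOperad.Composable k a b → toGlobularOperad.Composable k b c →
      star k (star k a b) c = star k a (star k b c)
  interchange : ∀ {n j k : ℕ}, j < k → k < n → ∀ {m : ℕ+} (a b c d : cell n m),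
    toGlobularOperad.Composable k a b → toGlobularOperad.Composable k c d →
    toGlobularOperad.Composable j a c → toGlobularOperad.Composable j b d →
      star j (star k a b) (star k c d) = star k (star j a c) (star j b d)
  star_add : ∀ {n k : ℕ}, k < n → ∀ {m : ℕ+} (a b a' b' : cell n m),
    toGlobularOperad.Composable k a b → toGlobularOperad.Composable k a' b' →
      star k (a + a') (b + b') = star k a b + star k a' b'
  star_smul : ∀ {n k : ℕ}, k < n → ∀ (c : K) {m : ℕ+} (a b : cell n m),
    toGlobularOperad.Composable k a b → star k (c • a) (c • b) = c • star k a b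
  star_one : ∀ {n k : ℕ}, k < n → star k (cell n).one (cell n).one = (cell n).one
  star_comp : ∀ {n k : ℕ}, k < n → ∀ {r : ℕ+} {p : Fin r → ℕ+} {m : ℕ+}
    (f : ShuffleSurjection p m) (a b : cell n r) (v w : ∀ j, cell n (p j)),
    toGlobularOperad.Composable k a b → (∀ j, toGlobularOperad.Composable k (v j) (w j)) →
      star k ((cell n).comp f a v) ((cell n).comp f b w) =
        (cell n).comp f (star k a b) fun j => star k (v j) (w j)

namespace GlobularOperad

variable {K : Type u} [Field K] (P : GlobularOperad K)

theorem src_i {n k : ℕ} (h : k ≤ n) {m : ℕ+} (a : P.cell n m) :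
    (P.src (n + 1) k).map ((P.i n).map a) = (P.i n).map ((P.src n k).map a) := by
  rw [src_le _ h, s_i]

theorem tgt_i {n k : ℕ} (h : k ≤ n) {m : ℕ+} (a : P.cell n m) :
    (P.tgt (n + 1) k).map ((P.i n).map a) = (P.i n).map ((P.tgt n k).map a) := by
  rw [tgt_le _ h, t_i]

theorem src_succ_lt {n k : ℕ} (h : k < n) {m : ℕ+} (a : P.cell (n + 1) m) :
    (P.src n k).map ((P.s n).map a) = (P.src n k).map ((P.t n).map a) := by
  cases n with
  | zero => omega
  | succ n => rw [src_le _ (by omega), src_le _ (by omega), s_s]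

theorem tgt_succ_lt {n k : ℕ} (h : k < n) {m : ℕ+} (a : P.cell (n + 1) m) :
    (P.tgt n k).map ((P.s n).map a) = (P.tgt n k).map ((P.t n).map a) := by
  cases n with
  | zero => omega
  | succ n => rw [tgt_le _ (by omega), tgt_le _ (by omega), t_t]

theorem s_src {n k : ℕ} (h : k ≤ n) {m : ℕ+} (a : P.cell (n + 1) m) :
    (P.s n).map ((P.src (n + 1) k).map a) = (P.src n k).map ((P.s n).map a) := by
  rw [src_le _ h, s_i]

theorem t_src {n k : ℕ} (h : k ≤ n) {m : ℕ+} (a : P.cell (n + 1) m) :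
    (P.t n).map ((P.src (n + 1) k).map a) = (P.src n k).map ((P.s n).map a) := by
  rw [src_le _ h, t_i]

theorem s_tgt {n k : ℕ} (h : k ≤ n) {m : ℕ+} (a : P.cell (n + 1) m) :
    (P.s n).map ((P.tgt (n + 1) k).map a) = (P.tgt n k).map ((P.t n).map a) := by
  rw [tgt_le _ h, s_i]

theorem t_tgt {n k : ℕ} (h : k ≤ n) {m : ℕ+} (a : P.cell (n + 1) m) :
    (P.t n).map ((P.tgt (n + 1) k).map a) = (P.tgt n k).map ((P.t n).map a) := by
  rw [tgt_le _ h, t_i]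

theorem tgt_tgt {n j k : ℕ} (h : j ≤ k) {m : ℕ+} (a : P.cell n m) :
    (P.tgt n j).map ((P.tgt n k).map a) = (P.tgt n j).map a := by
  induction n with
  | zero => rfl
  | succ n ih =>
    rcases le_or_gt k n with hk | hk
    · rw [P.tgt_le (h.trans hk), t_tgt _ hk, ih, ← P.tgt_le (h.trans hk)]
    · rw [P.tgt_ge hk]

theorem tgt_src {n j k : ℕ} (h : j < k) {m : ℕ+} (a : P.cell n m) :
    (P.tgt n j).map ((P.src n k).map a) = (P.tgt n j).map a := by
  induction n with
  | zero => rfl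
  | succ n ih =>
    rcases le_or_gt k n with hk | hk
    · rw [P.tgt_le (h.le.trans hk), t_src _ hk, ih, P.tgt_succ_lt (by omega),
        ← P.tgt_le (h.le.trans hk)]
    · rw [P.src_ge hk]

theorem tgt_id_tgt {n j k : ℕ} (h : j ≤ k) {m : ℕ+} (a : P.cell n m) :
    (P.tgt n k).map ((P.tgt n j).map a) = (P.tgt n j).map a := by
  induction n with
  | zero => rfl
  | succ n ih =>
    rcases le_or_gt k n with hk | hk
    · rw [P.tgt_le hk, t_tgt _ (h.trans hk), ih, ← P.tgt_le (h.trans hk)]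
    · rw [P.tgt_ge hk]

theorem tgt_id_src {n j k : ℕ} (h : j ≤ k) {m : ℕ+} (a : P.cell n m) :
    (P.tgt n k).map ((P.src n j).map a) = (P.src n j).map a := by
  induction n with
  | zero => rfl
  | succ n ih =>
    rcases le_or_gt k n with hk | hk
    · rw [P.tgt_le hk, t_src _ (h.trans hk), ih, ← P.src_le (h.trans hk)]
    · rw [P.tgt_ge hk]

/-- A reflexive globular operad in which `a - tₖ(a) + b` is compatible with shuffle composition is an
`ω`-operad with this composition. -/
noncomputable def toOmegaOperad
    (h : ∀ {n k : ℕ}, k < n → ∀ {r : ℕ+} {p : Fin r → ℕ+} {m : ℕ+}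
      (f : ShuffleSurjection p m) (a b : P.cell n r) (v w : ∀ j, P.cell n (p j)),
      P.Composable k a b → (∀ j, P.Composable k (v j) (w j)) →
      (P.cell n).comp f (a - (P.tgt n k).map a + b) (fun j => v j - (P.tgt n k).map (v j) + w j) =
        (P.cell n).comp f a v - (P.tgt n k).map ((P.cell n).comp f a v) +
          (P.cell n).comp f b w) : OmegaOperad K where
  toGlobularOperad := P
  star {n} k {_} a b := a - (P.tgt n k).map a + b
  s_star_self {n m} a b hab := by
    unfold Composable at hab
    rw [hab, map_add, map_sub, s_src _ le_rfl, P.src_ge le_rfl, sub_add_cancel]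
  t_star_self {n m} a b hab := by
    rw [map_add, map_sub, t_tgt _ le_rfl, P.tgt_ge le_rfl, sub_self, zero_add]
  s_star {n k} hk m a b hab := by
    rw [map_add, map_sub, s_tgt _ hk.le, P.tgt_succ_lt hk]
  t_star {n k} hk m a b hab := by
    rw [map_add, map_sub, t_tgt _ hk.le]
  i_star {n k} hk m a b hab := by
    rw [map_add, map_sub, tgt_i _ hk.le]
  src_star {n k} hk m a := by
    rw [P.tgt_id_src le_rfl, sub_self, zero_add]
  star_tgt {n k} hk m a := sub_add_cancel _ _
  star_assoc {n k} hk m a b c hab hbc := by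
    rw [map_add, map_sub, P.tgt_tgt le_rfl]
    abel
  interchange {n j k} hjk hk m a b c d hab hcd hac hbd := by
    simp only [map_add, map_sub, P.tgt_tgt hjk.le, P.tgt_id_tgt hjk.le]
    abel
  star_add {n k} hk m a b a' b' h h' := by
    rw [map_add]
    abel
  star_smul {n k} hk c m a b h := by
    rw [map_smul, smul_add, smul_sub]
  star_one {n k} hk := by
    rw [Hom.map_one, sub_self, zero_add]
  star_comp {n k} hk r p m f a b v w hab hvw := (h hk f a b v w hab hvw).symm

end GlobularOperad

/-- A shuffle operad, as a globular object with only identities in positive dimensions. -/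
def GlobularOperad.disc {K : Type u} [Field K] (P : ShuffleOperad K) : GlobularOperad K where
  cell _ := P
  s _ := Hom.id P
  t _ := Hom.id P
  i _ := Hom.id P
  s_s _ _ _ := rfl
  t_t _ _ _ := rfl
  s_i _ _ _ := rfl
  t_i _ _ _ := rfl

theorem GlobularOperad.disc_src {K : Type u} [Field K] (P : ShuffleOperad K) (n k : ℕ) :
    (disc P).src n k = Hom.id P := by
  induction n with
  | zero => rfl
  | succ n ih =>
    rw [src, ih]
    split_ifs <;> rfl

theorem GlobularOperad.disc_tgt {K : Type u} [Field K] (P : ShuffleOperad K) (n k : ℕ) :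
    (disc P).tgt n k = Hom.id P := by
  induction n with
  | zero => rfl
  | succ n ih =>
    rw [tgt, ih]
    split_ifs <;> rfl

/-- A shuffle operad, as an `ω`-operad with only identities in positive dimensions. -/
def OmegaOperad.disc {K : Type u} [Field K] (P : ShuffleOperad K) : OmegaOperad K where
  toGlobularOperad := .disc P
  star {_} _ {_} a _ := a
  s_star_self _ _ _ := rfl
  t_star_self a b h := by
    rw [GlobularOperad.Composable, GlobularOperad.disc_src, GlobularOperad.disc_tgt] at h
    exact h
  s_star _ _ _ _ _ := rfl
  t_star _ _ _ _ _ := rfl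
  i_star _ _ _ _ _ := rfl
  src_star _ _ _ := by rw [GlobularOperad.disc_src]; rfl
  star_tgt _ _ _ := rfl
  star_assoc _ _ _ _ _ _ _ := rfl
  interchange _ _ _ _ _ _ _ _ _ _ _ := rfl
  star_add _ _ _ _ _ _ _ _ := rfl
  star_smul _ _ _ _ _ _ := rfl
  star_one _ := rfl
  star_comp _ _ _ _ _ _ _ _ _ _ _ := rfl

/-- A shuffle `ω`-polygraph: an indexed set `gen` of `0`-generators and, for every `n`, a cellular
extension `ext n` of the free `n`-operad `stage n` generated so far. Thus `ext n` is the indexed set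
of `(n + 1)`-generators. -/
structure OmegaPolygraph (K : Type u) [Field K] where
  gen : ℕ+ → Type u
  stage : ∀ n, NOperad K n
  ext : ∀ n, CellExt (stage n)
  stage_zero : stage 0 = NOperad.ofOperad (free K gen)
  stage_succ : ∀ n, stage (n + 1) = (ext n).freeExtension

namespace NOperad

variable {K : Type u} [Field K] {n : ℕ} {S : NOperad K n} {E : CellExt S} {S' : NOperad K (n + 1)}

/-- The source map of the free extension, transported along an equality. -/
noncomputable def srcOfEq (h : S' = E.freeExtension) : Hom S'.top S.top :=
  match S', h with
  | _, rfl => E.freeSrc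

/-- The target map of the free extension, transported along an equality. -/
noncomputable def tgtOfEq (h : S' = E.freeExtension) : Hom S'.top S.top :=
  match S', h with
  | _, rfl => E.freeTgt

/-- The identity map of the free extension, transported along an equality. -/
noncomputable def idOfEq (h : S' = E.freeExtension) : Hom S.top S'.top :=
  match S', h with
  | _, rfl => E.freeId

theorem srcOfEq_id (h : S' = E.freeExtension) {m : ℕ+} (a : S.top m) :
    (srcOfEq h).map ((idOfEq h).map a) = a := by
  subst h; exact E.freeSrc_id a

theorem tgtOfEq_id (h : S' = E.freeExtension) {m : ℕ+} (a : S.top m) :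
    (tgtOfEq h).map ((idOfEq h).map a) = a := by
  subst h; exact E.freeTgt_id a

theorem src_eq (h : S' = E.freeExtension) {k : ℕ} (hk : k ≤ n) {m : ℕ+} (a : S'.top m) :
    (S'.src k).map a = (idOfEq h).map ((S.src k).map ((srcOfEq h).map a)) := by
  subst h; exact E.srcHom_le hk a

theorem tgt_eq (h : S' = E.freeExtension) {k : ℕ} (hk : k ≤ n) {m : ℕ+} (a : S'.top m) :
    (S'.tgt k).map a = (idOfEq h).map ((S.tgt k).map ((tgtOfEq h).map a)) := by
  subst h; exact E.tgtHom_le hk a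

theorem src_tgtOfEq (h : S' = E.freeExtension) {j : ℕ} (hj : j < n) {m : ℕ+} (a : S'.top m) :
    (S.src j).map ((tgtOfEq h).map a) = (S.src j).map ((srcOfEq h).map a) := by
  subst h; exact E.src_freeTgt hj a

theorem tgt_srcOfEq (h : S' = E.freeExtension) {j : ℕ} (hj : j < n) {m : ℕ+} (a : S'.top m) :
    (S.tgt j).map ((srcOfEq h).map a) = (S.tgt j).map ((tgtOfEq h).map a) := by
  subst h; exact E.tgt_freeSrc hj a

end NOperad

namespace OmegaPolygraph

variable {K : Type u} [Field K] (X : OmegaPolygraph K)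

/-- The globular operad of the cells of the free `ω`-operad on `X`. -/
noncomputable def globular : GlobularOperad K where
  cell n := (X.stage n).top
  s n := NOperad.srcOfEq (X.stage_succ n)
  t n := NOperad.tgtOfEq (X.stage_succ n)
  i n := NOperad.idOfEq (X.stage_succ n)
  s_s n m a := by
    have := congrArg (NOperad.srcOfEq (X.stage_succ n)).map
      (NOperad.src_tgtOfEq (X.stage_succ (n + 1)) (Nat.lt_succ_self n) a)
    rw [NOperad.src_eq (X.stage_succ n) le_rfl, NOperad.src_eq (X.stage_succ n) le_rfl,
      NOperad.srcOfEq_id, NOperad.srcOfEq_id, (X.stage n).src_top n le_rfl,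
      (X.stage n).src_top n le_rfl] at this
    exact this.symm
  t_t n m a := by
    have := congrArg (NOperad.tgtOfEq (X.stage_succ n)).map
      (NOperad.tgt_srcOfEq (X.stage_succ (n + 1)) (Nat.lt_succ_self n) a)
    rw [NOperad.tgt_eq (X.stage_succ n) le_rfl, NOperad.tgt_eq (X.stage_succ n) le_rfl,
      NOperad.tgtOfEq_id, NOperad.tgtOfEq_id, (X.stage n).tgt_top n le_rfl,
      (X.stage n).tgt_top n le_rfl] at this
    exact this.symm
  s_i n m a := NOperad.srcOfEq_id _ a
  t_i n m a := NOperad.tgtOfEq_id _ a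

theorem globular_src (n k : ℕ) {m : ℕ+} (a : (X.stage n).top m) :
    (X.globular.src n k).map a = ((X.stage n).src k).map a := by
  induction n with
  | zero => exact ((X.stage 0).src_top k (Nat.zero_le k) a).symm
  | succ n ih =>
    rcases le_or_gt k n with hk | hk
    · rw [NOperad.src_eq (X.stage_succ n) hk]
      exact (X.globular.src_le hk a).trans
        (congrArg (X.globular.i n).map (ih ((X.globular.s n).map a)))
    · rw [(X.stage (n + 1)).src_top k hk]
      exact X.globular.src_ge hk a

theorem globular_tgt (n k : ℕ) {m : ℕ+} (a : (X.stage n).top m) :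
    (X.globular.tgt n k).map a = ((X.stage n).tgt k).map a := by
  induction n with
  | zero => exact ((X.stage 0).tgt_top k (Nat.zero_le k) a).symm
  | succ n ih =>
    rcases le_or_gt k n with hk | hk
    · rw [NOperad.tgt_eq (X.stage_succ n) hk]
      exact (X.globular.tgt_le hk a).trans
        (congrArg (X.globular.i n).map (ih ((X.globular.t n).map a)))
    · rw [(X.stage (n + 1)).tgt_top k hk]
      exact X.globular.tgt_ge hk a

/-- The free `ω`-operad on a polygraph. -/
noncomputable def free : OmegaOperad K :=
  X.globular.toOmegaOperad fun {n k} hk {r p m} f a b v w h hv => by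
    have hs : X.globular.src n k = (X.stage n).src k := Hom.ext_map fun a => X.globular_src n k a
    have ht : X.globular.tgt n k = (X.stage n).tgt k := Hom.ext_map fun a => X.globular_tgt n k a
    unfold GlobularOperad.Composable at h hv
    rw [ht, hs] at h
    rw [ht, hs] at hv
    rw [ht]
    exact (X.stage n).exchange k hk f a b v w h hv

end OmegaPolygraph

namespace ShuffleOperad

variable {K : Type u} [Field K] (P : ShuffleOperad K)

/-- The elementary composition `f ∘_{i,τ} g`: the cell `g` is grafted at the input `i` of `f`, along
a shuffle surjection `τ` whose other fibres are singletons. -/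
def elemComp {k : ℕ+} {p : Fin k → ℕ+} {m : ℕ+} (τ : ShuffleSurjection p m) (i : Fin k)
    (hp : ∀ j, j ≠ i → p j = 1) (f : P k) (g : P (p i)) : P m :=
  P.comp τ f fun j => if h : j = i then h ▸ g else hp j h ▸ P.one

end ShuffleOperad

/-- A linear `ω`-functor between `ω`-operads: it is linear and preserves sources, targets, identities
and the compositions `⋆ₖ`, but not necessarily shuffle composition. -/
structure LinearFunctor {K : Type u} [Field K] (P Q : OmegaOperad K) where
  map : ∀ n {m : ℕ+}, P.cell n m →ₗ[K] Q.cell n m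
  map_s : ∀ n {m : ℕ+} (a : P.cell (n + 1) m), map n ((P.s n).map a) = (Q.s n).map (map (n + 1) a)
  map_t : ∀ n {m : ℕ+} (a : P.cell (n + 1) m), map n ((P.t n).map a) = (Q.t n).map (map (n + 1) a)
  map_i : ∀ n {m : ℕ+} (a : P.cell n m), map (n + 1) ((P.i n).map a) = (Q.i n).map (map n a)
  map_star : ∀ {n k : ℕ}, k < n → ∀ {m : ℕ+} (a b : P.cell n m), P.Composable k a b →
    map n (P.star k a b) = Q.star k (map n a) (map n b)

namespace LinearFunctor

variable {K : Type u} [Field K] {P Q R : OmegaOperad K}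

/-- The identity functor. -/
def id (P : OmegaOperad K) : LinearFunctor P P where
  map _ := LinearMap.id
  map_s _ _ _ := rfl
  map_t _ _ _ := rfl
  map_i _ _ _ := rfl
  map_star _ _ _ _ _ := rfl

theorem map_src (F : LinearFunctor P Q) (n k : ℕ) {m : ℕ+} (a : P.cell n m) :
    F.map n ((P.src n k).map a) = (Q.src n k).map (F.map n a) := by
  induction n with
  | zero => rfl
  | succ n ih =>
    rcases le_or_gt k n with hk | hk
    · rw [P.src_le hk, Q.src_le hk, F.map_i, ih, F.map_s]
    · rw [P.src_ge hk, Q.src_ge hk]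

theorem map_tgt (F : LinearFunctor P Q) (n k : ℕ) {m : ℕ+} (a : P.cell n m) :
    F.map n ((P.tgt n k).map a) = (Q.tgt n k).map (F.map n a) := by
  induction n with
  | zero => rfl
  | succ n ih =>
    rcases le_or_gt k n with hk | hk
    · rw [P.tgt_le hk, Q.tgt_le hk, F.map_i, ih, F.map_t]
    · rw [P.tgt_ge hk, Q.tgt_ge hk]

/-- The composite of two functors, first `F` and then `G`. -/
def comp (G : LinearFunctor Q R) (F : LinearFunctor P Q) : LinearFunctor P R where
  map n _ := (G.map n).comp (F.map n)
  map_s n _ a := (congrArg (G.map n) (F.map_s n a)).trans (G.map_s n _)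
  map_t n _ a := (congrArg (G.map n) (F.map_t n a)).trans (G.map_t n _)
  map_i n _ a := (congrArg (G.map (n + 1)) (F.map_i n a)).trans (G.map_i n _)
  map_star {n k} hk _ a b h := by
    have h' : Q.Composable k (F.map n a) (F.map n b) := by
      rw [GlobularOperad.Composable, ← map_tgt, ← map_src]
      exact congrArg (F.map n) h
    exact (congrArg (G.map n) (F.map_star hk a b h)).trans (G.map_star hk _ _ h')

end LinearFunctor

namespace OmegaOperad

variable {K : Type u} [Field K] (P : OmegaOperad K)

/-- `((a ⋆₀ e 0) ⋆₁ e 1) ⋆₂ ⋯ ⋆ₖ₋₁ e (k - 1)` -/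
def starRight {n : ℕ} {m : ℕ+} (a : P.cell n m) (e : ℕ → P.cell n m) : ℕ → P.cell n m
  | 0 => a
  | k + 1 => P.star k (starRight a e k) (e k)

/-- `e (k - 1) ⋆ₖ₋₁ ⋯ ⋆₂ (e 1 ⋆₁ (e 0 ⋆₀ a))` -/
def starLeft {n : ℕ} {m : ℕ+} (e : ℕ → P.cell n m) (a : P.cell n m) : ℕ → P.cell n m
  | 0 => a
  | k + 1 => P.star k (e k) (starLeft e a k)

end OmegaOperad

/-- A homotopy between linear `ω`-functors, the identities being written explicitly: all the equations
are between `(n + 1)`-cells, for `n`-cells `a` and `b` of `P`. -/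
structure OperadHomotopy {K : Type u} [Field K] {P Q : OmegaOperad K} (F G : LinearFunctor P Q) where
  map : ∀ n {m : ℕ+}, P.cell n m →ₗ[K] Q.cell (n + 1) m
  src_map : ∀ n {m : ℕ+} (a : P.cell n m),
    (Q.src (n + 1) n).map (map n a) =
      Q.starRight ((Q.i n).map (F.map n a)) (fun j => map n ((P.tgt n j).map a)) n
  tgt_map : ∀ n {m : ℕ+} (a : P.cell n m),
    (Q.tgt (n + 1) n).map (map n a) =
      Q.starLeft (fun j => map n ((P.src n j).map a)) ((Q.i n).map (G.map n a)) n
  map_star : ∀ {n k : ℕ}, k < n → ∀ {m : ℕ+} (a b : P.cell n m), P.Composable k a b →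
    map n (P.star k a b) =
      Q.star (k + 1)
        (Q.star k
          (Q.starRight ((Q.i n).map (F.map n ((P.src n (k + 1)).map a)))
            (fun j => map n ((P.tgt n j).map b)) k)
          (map n b))
        (Q.star k (map n a)
          (Q.starLeft (fun j => map n ((P.src n j).map a))
            ((Q.i n).map (G.map n ((P.tgt n (k + 1)).map b))) k))
  map_i : ∀ n {m : ℕ+} (a : P.cell n m),
    map (n + 1) ((P.i n).map a) = (Q.i (n + 1)).map (map n a)

/-- Every pair of parallel `n`-cells of `S` is filled by an `(n + 1)`-cell of `S[E]`. -/
def CellExt.Acyclic {K : Type u} [Field K] {n : ℕ} {S : NOperad K n} (E : CellExt S) : Prop :=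
  ∀ {m : ℕ+} (f g : S.top m),
    (∀ j < n, (S.src j).map f = (S.src j).map g ∧ (S.tgt j).map f = (S.tgt j).map g) →
      ∃ A : E.freeExtension.top m, E.freeSrc.map A = f ∧ E.freeTgt.map A = g

namespace OmegaPolygraph

variable {K : Type u} [Field K] (X : OmegaPolygraph K)

/-- The shuffle operad presented by `X`: the coequalizer of the source and target maps from the
`1`-cells to the `0`-cells. -/
noncomputable def presented : ShuffleOperad K :=
  quot (X.free.cell 0) fun _ a b => ∃ c, (X.free.s 0).map c = a ∧ (X.free.t 0).map c = b

/-- The image of an `n`-cell in the presented operad. -/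
noncomputable def toPresented : ∀ n : ℕ, Hom (X.free.cell n) X.presented
  | 0 => quotMk _ _
  | n + 1 => (toPresented n).comp (X.free.s n)

theorem toPresented_t (n : ℕ) {m : ℕ+} (a : X.free.cell (n + 1) m) :
    (X.toPresented n).map ((X.free.s n).map a) = (X.toPresented n).map ((X.free.t n).map a) := by
  cases n with
  | zero => exact quotMk_eq ⟨a, rfl, rfl⟩
  | succ n => exact congrArg (X.toPresented n).map (X.free.s_s n a)

theorem toPresented_star {n k : ℕ} (hk : k < n) {m : ℕ+} (a b : X.free.cell n m)
    (h : X.free.Composable k a b) :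
    (X.toPresented n).map (X.free.star k a b) = (X.toPresented n).map a := by
  induction n with
  | zero => omega
  | succ n ih =>
    change (X.toPresented n).map ((X.free.s n).map _) = (X.toPresented n).map ((X.free.s n).map _)
    rcases (Nat.lt_succ_iff.1 hk).lt_or_eq with hk' | rfl
    · rw [X.free.s_star hk' a b h, ih hk']
      rw [GlobularOperad.Composable, X.free.tgt_le hk'.le, X.free.src_le hk'.le] at h
      have h' := congrArg (X.free.s n).map h
      rw [X.free.s_i, X.free.s_i, ← X.free.tgt_succ_lt hk'] at h'
      exact h'
    · rw [X.free.s_star_self a b h]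

/-- The canonical projection `π` from the free `ω`-operad to the presented operad. -/
noncomputable def proj : LinearFunctor X.free (OmegaOperad.disc X.presented) where
  map n _ := (X.toPresented n).map
  map_s _ _ _ := rfl
  map_t n _ a := (X.toPresented_t n a).symm
  map_i n _ a := congrArg (X.toPresented n).map (X.free.s_i n a)
  map_star hk _ a b h := X.toPresented_star hk a b h

/-- A unital section of `X`: a linear `ω`-functor `ι` with `π ∘ ι = id` and `ι(1) = 1`. -/
structure UnitalSection where
  functor : LinearFunctor (OmegaOperad.disc X.presented) X.free
  proj_map : ∀ n {m : ℕ+} (a : X.presented m), X.proj.map n (functor.map n (m := m) a) = a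
  map_one : functor.map 0 (m := 1) X.presented.one = (X.free.cell 0).one

/-- An `ι`-contraction: a homotopy `σ` from the identity to `ι ∘ π` with `σ(a) = 1_a` for all `a` in
the image of `ι` or of `σ`. -/
structure Contraction {X : OmegaPolygraph K} (ι : X.UnitalSection) extends
    OperadHomotopy (LinearFunctor.id X.free) (ι.functor.comp X.proj) where
  map_section : ∀ n {m : ℕ+} (a : X.presented m),
    map n (ι.functor.map n (m := m) a) = (X.free.i n).map (ι.functor.map n (m := m) a)
  map_map : ∀ n {m : ℕ+} (a : X.free.cell n m),
    map (n + 1) (map n a) = (X.free.i (n + 1)).map (map n a)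

/-- A right `ι`-contraction satisfies
`σ(f ∘_{i,τ} g) = (s₀(f) ∘_{i,τ} σ(g)) ⋆₀ σ(f ∘_{i,τ} ιπ(g))`. -/
def Contraction.IsRight {X : OmegaPolygraph K} {ι : X.UnitalSection} (σ : X.Contraction ι) : Prop :=
  ∀ (n : ℕ) {k : ℕ+} {p : Fin k → ℕ+} {m : ℕ+} (τ : ShuffleSurjection p m) (i : Fin k)
    (hp : ∀ j, j ≠ i → p j = 1) (f : X.free.cell n k) (g : X.free.cell n (p i)),
    σ.map n ((X.free.cell n).elemComp τ i hp f g) =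
      X.free.star 0
        ((X.free.cell (n + 1)).elemComp τ i hp
          ((X.free.i n).map ((X.free.src n 0).map f)) (σ.map n g))
        (σ.map n ((X.free.cell n).elemComp τ i hp f ((ι.functor.comp X.proj).map n g)))

/-- The polygraph `X` presents `P`: its presented operad is isomorphic to `P`. -/
def Presents (P : ShuffleOperad K) : Prop :=
  ∃ φ : Hom X.presented P, ∀ k : ℕ+, Function.Bijective (φ.map (k := k))

/-- The polygraph `X` is a polygraphic resolution of `P`: it presents `P`, and its cellular extensions
by cells of dimension at least two are acyclic. -/
def IsPolygraphicResolution (P : ShuffleOperad K) : Prop :=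
  X.Presents P ∧ ∀ n, 1 ≤ n → (X.ext n).Acyclic

end OmegaPolygraph

end

/-! Since a ⋆ₖ b is the linear expression a − tₖ(a) + b, the cells of an ω-operad behave like a
chain complex and a homotopy behaves like a contracting homotopy. Below, 1_a is the identity on a,
and â is ιπ(a).

From a contraction σ to acyclicity: parallel n-cells f, g with n ≥ 1 have the same image under π, so
σ_f and σ_g have the same n-target, while their n-sources differ by f − g. Hence 1_f plus the
normalized part of σ_f minus that of σ_g is a cell from f to g (`exists_cell_of_homotopy`).

Conversely, linear maps hₙ (`filling`) from n-cells to (n+1)-cells are built by induction on n, with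
source zero and target −Nₙ. Here N₀(a) = a − â, and Nₙ₊₁(a) = a − 1_{s(a)} + hₙ(t(a) − s(a)) is a
projector onto the loops, the cells whose source and target vanish. Connectedness for n = 0 and
acyclicity for n > 0 fill the image of Nₙ. Then σ_a is 1_a plus the sum of the identities on the
hⱼ(tⱼ a) for j ≤ n, and the homotopy axioms become telescoping linear identities (`src_contract`,
`starLeft_contract`, `contract_star`).

The right condition is the delicate point. It requires hₙ to satisfy h(u∘v) = h(u∘v̂) + 1_u∘(1_v +
h(v)) − 1_{u∘v}, and so a choice coherent with operadic composition. The remedy is to look for cells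
e(a) from a to a − N(a) with e(u∘v) = Φ(u)(e(v)), where Φ(u) is a corrected version of grafting onto
1_u. Such operations form an operad (`grafting`), and the constraints on them (`IsLift`) define a
relation compatible with the operad structure. By freeness it suffices to lift the generators one at
a time (`exists_isLift`) and to check that the constraints force the exchange relations
(`IsLift.exchange`). Evaluating Φ at units gives e, hence h (`nonempty_filling`).

The next projector inherits its composition law (`succMap_comp`) because a cell with zero 0-source
and 0-target cannot distinguish cells with the same image under π when it is grafted with them
(`comp_congr_of_core`, `comp_add_sub_congr`). A last computation, `totalFilling_elemComp`, turns the
law for h, which involves f, into the law for σ, which involves s₀(f). -/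

namespace ShuffleOperad

/-! ### The operad of grafting operations -/

variable {K : Type u} [Field K] (T : ShuffleOperad K)

/-- Grafting onto the trivial operation does nothing, up to the identification of arities. -/
theorem one_comp_eq {n : Fin (1 : ℕ+) → ℕ+} (f : ShuffleSurjection n (n 0)) (w : ∀ i, T (n i)) :
    T.comp f T.one w = w 0 := by
  have hs : ∀ i : Fin (1 : ℕ+), i = 0 := fun i => Subsingleton.elim (α := Fin 1) _ _
  have key : ∀ {n' : Fin (1 : ℕ+) → ℕ+} (_ : n' = n) (f : ShuffleSurjection n' (n 0))
      (w' : ∀ i, T (n' i)) (x : T (n 0)) (_ : ∀ i, HEq (w' i) x),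
      T.comp f T.one w' = x := by
    intro n' hn' f w' x hw
    obtain rfl : n' = fun _ => n 0 := by
      rw [hn']
      funext i
      rw [hs i]
    obtain rfl : w' = fun _ => x := funext fun i => eq_of_heq (hw i)
    exact T.one_comp f x
  refine key rfl f w (w 0) fun i => ?_
  rw [hs i]

/-- The operations of arity `k` on a collection: a multilinear operation for every way of
grafting `k` inputs along a shuffle surjection. -/
abbrev GraftingOperation (k : ℕ+) : Type u :=
  ∀ (n : Fin k → ℕ+) (m : ℕ+), ShuffleSurjection n m → MultilinearMap K (fun i => T (n i)) (T m)

variable {T}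

/-- Iterated restrictions of shuffle surjections agree only after their arities are identified, so
the operad axioms for grafting operations are compared through heterogeneous equality. -/
theorem GraftingOperation.apply_heq {k : ℕ+} (U : T.GraftingOperation k) {n n' : Fin k → ℕ+}
    {m m' : ℕ+} (hn : n = n') (hm : m = m') (f : ShuffleSurjection n m)
    (f' : ShuffleSurjection n' m') (hf : ∀ b h h', f.toFun ⟨b, h⟩ = f'.toFun ⟨b, h'⟩)
    (w : ∀ i, T (n i)) (w' : ∀ i, T (n' i)) (hw : ∀ i, HEq (w i) (w' i)) :
    HEq (U n m f w) (U n' m' f' w') := by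
  subst hn hm
  obtain rfl : f = f' := by
    cases f; cases f'
    congr
    ext b : 1
    exact hf b b.2 b.2
  obtain rfl : w = w' := funext fun i => eq_of_heq (hw i)
  rfl

theorem one_comp_heq {n : Fin (1 : ℕ+) → ℕ+} {m : ℕ+} (f : ShuffleSurjection n m)
    (w : ∀ i, T (n i)) : HEq (T.comp f T.one w) (w 0) := by
  obtain rfl := TreeMonomial.arity_of_unit f
  exact heq_of_eq (one_comp_eq T f w)

/-- Composition of grafting operations. -/
noncomputable def GraftingOperation.comp {k : ℕ+} {n : Fin k → ℕ+} {m : ℕ+}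
    (f : ShuffleSurjection n m) (U : T.GraftingOperation k) (V : ∀ i, T.GraftingOperation (n i)) :
    T.GraftingOperation m :=
  fun p l f' => twoLevel (M := T.obj) (p := p) f (U _ l (f.comp f')) fun i => V i _ _ (f.restr f' i)

theorem GraftingOperation.comp_apply {k : ℕ+} {n : Fin k → ℕ+} {m : ℕ+}
    (f : ShuffleSurjection n m) (U : T.GraftingOperation k) (V : ∀ i, T.GraftingOperation (n i))
    {p : Fin m → ℕ+} {l : ℕ+} (f' : ShuffleSurjection p l) (w : ∀ a, T (p a)) :
    GraftingOperation.comp f U V p l f' w =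
      U _ l (f.comp f') fun i => V i _ _ (f.restr f' i) fun a => w (f.enum i a) := rfl

theorem GraftingOperation.update_apply {k : ℕ+} {n q : Fin k → ℕ+}
    (V : ∀ i, T.GraftingOperation (n i)) (i : Fin k) (x : T.GraftingOperation (n i))
    {p : ∀ j, Fin (n j) → ℕ+}
    (f : ∀ j, ShuffleSurjection (p j) (q j)) (w : ∀ j a, T (p j a)) [DecidableEq (Fin k)] :
    (fun j => Function.update V i x j _ _ (f j) (w j)) =
      Function.update (fun j => V j _ _ (f j) (w j)) i (x _ _ (f i) (w i)) := by
  funext j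
  by_cases h : j = i
  · subst h
    simp
  · simp [h]

variable (T)

/-- The shuffle operad of grafting operations on a collection. -/
noncomputable def grafting : ShuffleOperad K where
  obj := T.GraftingOperation
  one _ _ f := T.comp f T.one
  comp {k n m} f :=
    { toFun := fun U => MultilinearMap.mk' (GraftingOperation.comp f U)
        (fun V i x y => by
          funext p l f'
          ext w
          simp only [GraftingOperation.comp_apply, Pi.add_apply, _root_.add_apply]
          have h := fun x => GraftingOperation.update_apply V i x (fun j => f.restr f' j)
            (fun j a => w (f.enum j a))
          rw [h, h, h]
          simp)
        (fun V i c x => by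
          funext p l f'
          ext w
          simp only [GraftingOperation.comp_apply, Pi.smul_apply, _root_.smul_apply]
          have h := fun x => GraftingOperation.update_apply V i x (fun j => f.restr f' j)
            (fun j a => w (f.enum j a))
          rw [h, h]
          simp)
      map_add' := fun _ _ => rfl
      map_smul' := fun _ _ => rfl }
  comp_one {k} f U := by
    funext p l f'
    ext w
    refine (GraftingOperation.comp_apply f U (fun _ _ _ g => T.comp g T.one) f' w).trans ?_
    have he : ∀ a b, f.enum a b = a := by
      intro a b
      have h : f.toFun (f.enum a b) = f.enum a b :=
        (f.eq_id_of_ones fun _ => rfl).2 _ (f.enum a b).2 (f.enum a b).2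
      rw [← h, f.toFun_enum]
    have hg : ∀ b, (f.comp f').toFun b = f'.toFun b := fun b =>
      (f.eq_id_of_ones fun _ => rfl).2 _ (f'.toFun b).2 (f'.toFun b).2
    refine eq_of_heq (GraftingOperation.apply_heq U (ShuffleSurjection.arity_unique _ _ hg) rfl _ _
      (fun b h h' => hg ⟨b, h⟩) _ _ fun i => ?_)
    refine (one_comp_heq (T := T) _ _).trans ?_
    rw [he]
  one_comp {m} f U := by
    funext p l f'
    ext w
    refine (GraftingOperation.comp_apply f (fun _ _ g => T.comp g T.one) (fun _ => U) f' w).trans ?_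
    refine eq_of_heq ((one_comp_heq (T := T) _ _).trans ?_)
    have he : ∀ a, f.enum 0 a = a := fun a =>
      ((f.enum_eq_of_strictMono 0 (id : Fin m → Fin m) strictMono_id fun b =>
        ⟨fun _ => ⟨b, rfl⟩, fun _ => Subsingleton.elim (α := Fin 1) _ _⟩).2 a a.2 a.2).symm
    have hl : ∀ b h h', (f.comp f').enum 0 ⟨b, h⟩ = ⟨b, h'⟩ := fun b h h' =>
      (((f.comp f').enum_eq_of_strictMono 0 (id : Fin l → Fin l) strictMono_id fun b =>
        ⟨fun _ => ⟨b, rfl⟩, fun _ => Subsingleton.elim (α := Fin 1) _ _⟩).2 b h' h).symm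
    refine GraftingOperation.apply_heq U ?_ (TreeMonomial.arity_of_unit (f.comp f')) _ _ ?_ _ _ ?_
    · funext a
      rw [he]
    · intro b h h'
      apply (f.enum 0).injective
      rw [ShuffleSurjection.enum_restr, he, hl]
    · intro a
      rw [he]
  assoc {k n m p l} f f' U V W := by
    funext q r f''
    ext w
    change GraftingOperation.comp f' (GraftingOperation.comp f U V) W q r f'' w =
      GraftingOperation.comp (f.comp f') U (fun i => GraftingOperation.comp (f.restr f' i) (V i)
        fun a => W (f.enum i a)) q r f'' w
    simp only [GraftingOperation.comp_apply]
    refine congrArg (U _ r ((f.comp f').comp f'')) (funext fun i => ?_)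
    -- Both sides apply the same `U` to the same composite surjection; what remains is the
    -- compatibility of restriction with composition, input by input.
    refine (eq_of_heq (GraftingOperation.apply_heq (V i) ?_ rfl _ _ ?_ _ _ ?_)).symm
    · exact ShuffleSurjection.arity_unique _ _ (ShuffleSurjection.restr_comp_restr f f' f'' i)
    · intro b h h'
      exact ShuffleSurjection.restr_comp_restr f f' f'' i ⟨b, h⟩
    · intro a
      refine GraftingOperation.apply_heq _ ?_ (ShuffleSurjection.restr_restr f f' f'' i a).1 _ _
        (ShuffleSurjection.restr_restr f f' f'' i a).2 _ _ ?_
      · funext b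
        rw [ShuffleSurjection.enum_comp_enum_restr]
      · intro b
        rw [ShuffleSurjection.enum_comp_enum_restr]

variable {T}

theorem grafting_comp_apply {k : ℕ+} {n : Fin k → ℕ+} {m : ℕ+}
    (f : ShuffleSurjection n m) (U : T.grafting k) (V : ∀ i, T.grafting (n i))
    {p : Fin m → ℕ+} {l : ℕ+} (f' : ShuffleSurjection p l) (w : ∀ a, T (p a)) :
    T.grafting.comp f U V p l f' w =
      U _ l (f.comp f') fun i => V i _ _ (f.restr f' i) fun a => w (f.enum i a) := rfl

variable (T)

/-- Grafting onto the elements of an operad. -/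
noncomputable def graftingOnto : Hom T T.grafting where
  map := { toFun := fun u _ _ f => T.comp f u
           map_add' := fun u v => by funext n m f; exact map_add _ _ _
           map_smul' := fun c u => by funext n m f; exact map_smul _ _ _ }
  map_one := rfl
  map_comp f u v := by
    funext p l f'
    ext w
    exact T.assoc f f' u v w

theorem graftingOnto_apply {k : ℕ+} (u : T k) {n : Fin k → ℕ+} {m : ℕ+} (f : ShuffleSurjection n m)
    (w : ∀ i, T (n i)) : T.graftingOnto.map u n m f w = T.comp f u w := rfl

/-- The value of a grafting operation at the units. -/
noncomputable def graftingEval (k : ℕ+) : T.grafting k →ₗ[K] T k where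
  toFun U := U _ k (.refl k) fun _ => T.one
  map_add' _ _ := rfl
  map_smul' _ _ := rfl

theorem graftingEval_apply {k : ℕ+} (U : T.grafting k) :
    T.graftingEval k U = U _ k (.refl k) fun _ => T.one := rfl

/-- Restricting the identity surjection gives identities, so grafting units reaches each `V i`
separately. This is what turns a morphism Φ into `grafting` into a map e with e(u∘v) = Φ(u)(e(v)).
-/
theorem graftingEval_comp {k : ℕ+} {n : Fin k → ℕ+} {m : ℕ+} (f : ShuffleSurjection n m)
    (U : T.grafting k) (V : ∀ i, T.grafting (n i)) :
    T.graftingEval m (T.grafting.comp f U V) = U n m f fun i => T.graftingEval _ (V i) := by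
  rw [graftingEval_apply, grafting_comp_apply]
  have hg : ShuffleSurjection.compArity f (.refl m) = n :=
    ShuffleSurjection.arity_unique (f.comp (.refl m)) f fun _ => rfl
  refine eq_of_heq (GraftingOperation.apply_heq U hg rfl _ _ (fun _ _ _ => rfl) _ _ fun i => ?_)
  rw [graftingEval_apply]
  refine GraftingOperation.apply_heq (V i) rfl (congrFun hg i) _ _ ?_ _ _ fun _ => HEq.rfl
  intro b h h'
  exact ((f.restr (.refl m) i).eq_id_of_ones fun _ => rfl).2 b h h'

end ShuffleOperad

/-! ### Morphisms out of free operads, chosen inside a compatible relation -/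

namespace ShuffleOperad

variable {K : Type u} [Field K]

/-- A relation between two shuffle operads that is compatible with their structure. -/
structure OperadRel (Q P : ShuffleOperad K) where
  rel : ∀ {k : ℕ+}, Q k → P k → Prop
  zero : ∀ {k : ℕ+}, rel (0 : Q k) (0 : P k)
  add : ∀ {k : ℕ+} {U U' : Q k} {u u' : P k}, rel U u → rel U' u' → rel (U + U') (u + u')
  smul : ∀ {k : ℕ+} (c : K) {U : Q k} {u : P k}, rel U u → rel (c • U) (c • u)
  one : rel Q.one P.one
  comp : ∀ {k : ℕ+} {n : Fin k → ℕ+} {m : ℕ+} (f : ShuffleSurjection n m) {U : Q k} {u : P k}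
    {V : ∀ i, Q (n i)} {v : ∀ i, P (n i)}, rel U u → (∀ i, rel (V i) (v i)) →
      rel (Q.comp f U V) (P.comp f u v)

/-- A tree monomial is the iterated composite of its vertices, so a morphism out of the free operad
is computed on it by `evalTree`. -/
theorem free_single {X : ℕ+ → Type u} {k : ℕ+} (t : TreeMonomial X k) :
    (Finsupp.single t 1 : free K X k) = evalTree (free K X) (fun _ x => of x) t := by
  induction t with
  | unit => rfl
  | @node k n m f x v ih =>
    simp only [evalTree]
    rw [← funext ih]
    refine Eq.trans ?_ (freeComp_single X f _ v).symm
    congr 1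
    refine TreeMonomial.node_heq x
      (ShuffleSurjection.arity_unique f ((ShuffleSurjection.refl k).comp f) fun _ => rfl) _ _
      (fun _ => rfl) _ _ fun i => ?_
    have he : ∀ a, (ShuffleSurjection.refl k).enum i a = i := fun a =>
      (ShuffleSurjection.refl k).toFun_enum i a
    simp only [TreeMonomial.comp]
    refine HEq.trans ?_ (eqRec_heq_self _ _).symm
    rw [he]

/-- A compatible relation is a suboperad of the product of `Q` and `P`; a morphism from a free
operad into the product lands in it as soon as the generators do. -/
theorem lift_rel {X : ℕ+ → Type u} {Q P : ShuffleOperad K} (R : OperadRel Q P)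
    (φ : ∀ k, X k → Q k) (Ψ : Hom (free K X) P)
    (h : ∀ k (x : X k), R.rel (φ k x) (Ψ.map (of x))) {k : ℕ+} (y : free K X k) :
    R.rel ((lift φ).map y) (Ψ.map y) := by
  have htree : ∀ {k : ℕ+} (t : TreeMonomial X k), R.rel (evalTree Q φ t)
      (evalTree P (fun k x => Ψ.map (of (K := K) x)) t) := by
    intro k t
    induction t with
    | unit => exact R.one
    | node f x v ih => exact R.comp f (h _ x) ih
  refine Finsupp.induction_linear (motive := fun y => R.rel ((lift φ).map y) (Ψ.map y)) y ?_ ?_ ?_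
  · rw [show (0 : TreeMonomial X k →₀ K) = (0 : free K X k) from rfl, map_zero, map_zero]
    exact R.zero
  · intro y z hy hz
    have h1 := map_add (lift (Q := Q) φ).map (y : free K X k) z
    have h2 := map_add Ψ.map (y : free K X k) z
    exact h1 ▸ h2 ▸ R.add hy hz
  · intro t c
    have hc : (Finsupp.single t c : free K X k) = c • (Finsupp.single t 1 : free K X k) := by
      refine Eq.symm ((Finsupp.smul_single c t (1 : K)).trans ?_)
      rw [smul_eq_mul, mul_one]
    have key : ∀ x : free K X k, x = evalTree (free K X) (fun _ x => of x) t →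
        ∀ z, z = c • x → R.rel ((lift φ).map z) (Ψ.map z) := by
      rintro x rfl z rfl
      rw [map_smul, map_smul]
      refine R.smul c ?_
      rw [map_evalTree, map_evalTree]
      simp only [lift_of]
      exact htree t
    exact key _ (free_single t) _ hc

/-- A morphism from a free operad can be chosen within a compatible relation. -/
theorem exists_hom_free {X : ℕ+ → Type u} {Q : ShuffleOperad K} (R : OperadRel Q (free K X))
    (h : ∀ {k : ℕ+} (a : free K X k), ∃ U, R.rel U a) :
    ∃ Φ : Hom (free K X) Q, ∀ {k : ℕ+} (a : free K X k), R.rel (Φ.map a) a := by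
  choose φ hφ using fun k (x : X k) => h (of x)
  exact ⟨lift φ, fun a => lift_rel R φ (Hom.id _) hφ a⟩

end ShuffleOperad

open ShuffleOperad

section

variable {K : Type u} [Field K]

/-- A morphism from the operad of top cells of a free extension can be chosen within a compatible
relation, if the relation forces the exchange laws. -/
theorem CellExt.exists_hom_freeTop {n : ℕ} {S : NOperad K n} (E : CellExt S) {Q : ShuffleOperad K}
    (R : OperadRel Q E.freeTop) (I : Hom S.top Q)
    (hI : ∀ {k : ℕ+} (a : S.top k), R.rel (I.map a) (E.freeId.map a))
    (h : ∀ {k : ℕ+} (a : E.freeTop k), ∃ U, R.rel U a)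
    (hex : ∀ {k : ℕ}, k ≤ n → ∀ {r : ℕ+} {p : Fin r → ℕ+} {m : ℕ+} (f : ShuffleSurjection p m)
      (A B : Q r) (a b : E.freeTop r) (V W : ∀ i, Q (p i)) (v w : ∀ i, E.freeTop (p i)),
      R.rel A a → R.rel B b → (∀ i, R.rel (V i) (v i)) → (∀ i, R.rel (W i) (w i)) →
      (S.tgt k).map (E.freeTgt.map a) = (S.src k).map (E.freeSrc.map b) →
      (∀ i, (S.tgt k).map (E.freeTgt.map (v i)) = (S.src k).map (E.freeSrc.map (w i))) →
      Q.comp f (A - I.map ((S.tgt k).map (E.freeTgt.map a)) + B)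
          (fun i => V i - I.map ((S.tgt k).map (E.freeTgt.map (v i))) + W i) =
        Q.comp f A V - I.map ((S.tgt k).map (E.freeTgt.map (E.freeTop.comp f a v))) +
          Q.comp f B W) :
    ∃ Φ : Hom E.freeTop Q, ∀ {k : ℕ+} (a : E.freeTop k), R.rel (Φ.map a) a := by
  choose φ hφ using fun k (x : E.gen k) => h (E.proj.map (of (Sum.inr x)))
  -- Only the new generators involve a choice. The identities are sent where `I` prescribes, which
  -- settles every relation except exchange because `I` is a morphism.
  let ψ : ∀ k, S.top k ⊕ E.gen k → Q k := fun k => Sum.elim (fun a => I.map a) (φ k)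
  have hid : ∀ {k : ℕ+} (a : S.top k), (lift (K := K) ψ).map (E.preId a) = I.map a := fun a =>
    lift_of (K := K) ψ (Sum.inl a)
  have hR : ∀ {k : ℕ+} (y : E.Pre k), R.rel ((lift (K := K) ψ).map y) (E.proj.map y) := by
    refine lift_rel R ψ E.proj fun k x => ?_
    rcases x with a | x
    · exact hI a
    · exact hφ k x
  have hrel : ∀ k a b, E.Rel k a b → (lift (K := K) ψ).map a = (lift (K := K) ψ).map b := by
    intro k a b hab
    induction hab with
    | add a b => rw [map_add, hid, hid, hid, map_add]
    | smul c a => rw [map_smul, hid, hid, map_smul]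
    | one => rw [hid, I.map_one, Hom.map_one]
    | comp f a v => simp only [hid, Hom.map_comp]
    | exchange hk f a b v w hab hvw =>
      -- The images of formal cells are already known to be related to these cells by `hR`, so the
      -- exchange hypothesis on related elements applies.
      have key := hex hk f _ _ _ _ _ _ _ _ (hR a) (hR b) (fun i => hR (v i)) (fun i => hR (w i))
        hab hvw
      have hs : ∀ (k : ℕ) {m : ℕ+} (a b : E.Pre m), (lift (K := K) ψ).map (E.preStar k a b) =
          (lift (K := K) ψ).map a - I.map ((S.tgt k).map (E.freeTgt.map (E.proj.map a))) +
            (lift (K := K) ψ).map b := by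
        intro k m a b
        rw [CellExt.preStar, map_add, map_sub, hid]
        rfl
      rw [Hom.map_comp, hs, hs, Hom.map_comp, Hom.map_comp]
      simp only [hs]
      refine key.trans ?_
      rw [← E.proj.map_comp, (lift ψ).map_comp f b w]
  refine ⟨quotLift (lift ψ) hrel, fun a => ?_⟩
  obtain ⟨y, rfl⟩ := E.proj_surjective a
  exact hR y

/-! ### Globular identities and the abstract data for the construction -/

namespace ShuffleOperad

variable (T : ShuffleOperad K) {k : ℕ+} {p : Fin k → ℕ+} {m : ℕ+} (f : ShuffleSurjection p m)

theorem comp_sub_left (a b : T k) (v : ∀ i, T (p i)) :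
    T.comp f (a - b) v = T.comp f a v - T.comp f b v := by
  rw [map_sub]; rfl

theorem comp_zero_left (v : ∀ i, T (p i)) : T.comp f 0 v = 0 := by
  rw [map_zero]; rfl

end ShuffleOperad

namespace GlobularOperad

variable (P : GlobularOperad K)

/-- The composition `a - tₖ(a) + b` of cells is compatible with shuffle composition. -/
def HasExchange : Prop :=
  ∀ {n k : ℕ}, k < n → ∀ {r : ℕ+} {p : Fin r → ℕ+} {m : ℕ+}
    (f : ShuffleSurjection p m) (a b : P.cell n r) (v w : ∀ j, P.cell n (p j)),
    P.Composable k a b → (∀ j, P.Composable k (v j) (w j)) →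
    (P.cell n).comp f (a - (P.tgt n k).map a + b) (fun j => v j - (P.tgt n k).map (v j) + w j) =
      (P.cell n).comp f a v - (P.tgt n k).map ((P.cell n).comp f a v) + (P.cell n).comp f b w

theorem src_src {n j k : ℕ} (h : j ≤ k) {m : ℕ+} (a : P.cell n m) :
    (P.src n j).map ((P.src n k).map a) = (P.src n j).map a := by
  induction n with
  | zero => rfl
  | succ n ih =>
    rcases le_or_gt k n with hk | hk
    · rw [P.src_le (h.trans hk), s_src _ hk, ih, ← P.src_le (h.trans hk)]
    · rw [P.src_ge hk]

theorem src_id_tgt {n j k : ℕ} (h : j ≤ k) {m : ℕ+} (a : P.cell n m) :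
    (P.src n k).map ((P.tgt n j).map a) = (P.tgt n j).map a := by
  induction n with
  | zero => rfl
  | succ n ih =>
    rcases le_or_gt k n with hk | hk
    · rw [P.src_le hk, s_tgt _ (h.trans hk), ih, ← P.tgt_le (h.trans hk)]
    · rw [P.src_ge hk]

theorem src_succ_self {n : ℕ} {m : ℕ+} (a : P.cell (n + 1) m) :
    (P.src (n + 1) n).map a = (P.i n).map ((P.s n).map a) := by
  rw [P.src_le le_rfl, P.src_ge le_rfl]

theorem tgt_succ_self {n : ℕ} {m : ℕ+} (a : P.cell (n + 1) m) :
    (P.tgt (n + 1) n).map a = (P.i n).map ((P.t n).map a) := by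
  rw [P.tgt_le le_rfl, P.tgt_ge le_rfl]

end GlobularOperad

/-- The data on the free `ω`-operad of a polygraph with a unital section that are used to build a
contraction. The field `connected` says that `B` is the operad presented by the `1`-cells, the field
`acyclic` that loops in positive dimension are filled, and the last two fields that the operads of
cells are free extensions. -/
structure AcyclicData (P : GlobularOperad K) (B : ShuffleOperad K) where
  exchange : P.HasExchange
  bar : ∀ n, Hom (P.cell n) B
  bar_succ : ∀ n {m : ℕ+} (a : P.cell (n + 1) m),
    (bar (n + 1)).map a = (bar n).map ((P.s n).map a)
  bar_t : ∀ n {m : ℕ+} (a : P.cell (n + 1) m),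
    (bar n).map ((P.t n).map a) = (bar n).map ((P.s n).map a)
  sec : ∀ n {m : ℕ+}, B m →ₗ[K] P.cell n m
  sec_succ : ∀ n {m : ℕ+} (b : B m), sec (n + 1) b = (P.i n).map (sec n b)
  bar_sec : ∀ n {m : ℕ+} (b : B m), (bar n).map (sec n b) = b
  sec_one : sec 0 B.one = (P.cell 0).one
  connected : ∀ {m : ℕ+} (a b : P.cell 0 m), (bar 0).map a = (bar 0).map b →
    ∃ c, (P.s 0).map c = a ∧ (P.t 0).map c = b
  acyclic : ∀ n {m : ℕ+} (z : P.cell (n + 1) m), (P.s n).map z = 0 → (P.t n).map z = 0 →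
    ∃ c, (P.s (n + 1)).map c = 0 ∧ (P.t (n + 1)).map c = z
  exists_hom_zero : ∀ {Q : ShuffleOperad K} (R : OperadRel Q (P.cell 0)),
    (∀ {k : ℕ+} (a : P.cell 0 k), ∃ U, R.rel U a) →
      ∃ Φ : Hom (P.cell 0) Q, ∀ {k : ℕ+} (a : P.cell 0 k), R.rel (Φ.map a) a
  exists_hom_succ : ∀ (n : ℕ) {Q : ShuffleOperad K} (R : OperadRel Q (P.cell (n + 1)))
    (I : Hom (P.cell n) Q), (∀ {k : ℕ+} (a : P.cell n k), R.rel (I.map a) ((P.i n).map a)) →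
    (∀ {k : ℕ+} (a : P.cell (n + 1) k), ∃ U, R.rel U a) →
    (∀ {k : ℕ}, k ≤ n → ∀ {r : ℕ+} {p : Fin r → ℕ+} {m : ℕ+} (f : ShuffleSurjection p m)
      (A B : Q r) (a b : P.cell (n + 1) r) (V W : ∀ i, Q (p i)) (v w : ∀ i, P.cell (n + 1) (p i)),
      R.rel A a → R.rel B b → (∀ i, R.rel (V i) (v i)) → (∀ i, R.rel (W i) (w i)) →
      P.Composable k a b → (∀ i, P.Composable k (v i) (w i)) →
      Q.comp f (A - I.map ((P.tgt n k).map ((P.t n).map a)) + B)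
          (fun i => V i - I.map ((P.tgt n k).map ((P.t n).map (v i))) + W i) =
        Q.comp f A V - I.map ((P.tgt n k).map ((P.t n).map ((P.cell (n + 1)).comp f a v))) +
          Q.comp f B W) →
    ∃ Φ : Hom (P.cell (n + 1)) Q, ∀ {k : ℕ+} (a : P.cell (n + 1) k), R.rel (Φ.map a) a

/-! ### Consequences of the exchange law -/

namespace AcyclicData

variable {P : GlobularOperad K} {B : ShuffleOperad K} (D : AcyclicData P B)

/-- Exchange applied to the decomposition u = sₖ(u) ⋆ₖ u. -/
theorem comp_star_left (D : AcyclicData P B) {n k : ℕ} (hk : k < n) {r : ℕ+} {p : Fin r → ℕ+} {m : ℕ+}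
    (f : ShuffleSurjection p m) (u : P.cell n r) (v w : ∀ j, P.cell n (p j))
    (h : ∀ j, P.Composable k (v j) (w j)) :
    (P.cell n).comp f u (fun j => v j - (P.tgt n k).map (v j) + w j) =
      (P.cell n).comp f ((P.src n k).map u) v -
        (P.cell n).comp f ((P.src n k).map u) (fun j => (P.tgt n k).map (v j)) +
          (P.cell n).comp f u w := by
  have := D.exchange hk f ((P.src n k).map u) u v w (P.tgt_id_src le_rfl u) h
  rwa [P.tgt_id_src le_rfl, sub_self, zero_add, Hom.map_comp, P.tgt_id_src le_rfl] at this

/-- Exchange applied to the other decomposition u = u ⋆ₖ tₖ(u). -/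
theorem comp_star_right (D : AcyclicData P B) {n k : ℕ} (hk : k < n) {r : ℕ+} {p : Fin r → ℕ+} {m : ℕ+}
    (f : ShuffleSurjection p m) (u : P.cell n r) (v w : ∀ j, P.cell n (p j))
    (h : ∀ j, P.Composable k (v j) (w j)) :
    (P.cell n).comp f u (fun j => v j - (P.tgt n k).map (v j) + w j) =
      (P.cell n).comp f u v -
        (P.cell n).comp f ((P.tgt n k).map u) (fun j => (P.tgt n k).map (v j)) +
          (P.cell n).comp f ((P.tgt n k).map u) w := by
  have := D.exchange hk f u ((P.tgt n k).map u) v w (P.src_id_tgt le_rfl u).symm h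
  rwa [sub_add_cancel, Hom.map_comp] at this

theorem bar_i (n : ℕ) {m : ℕ+} (a : P.cell n m) :
    (D.bar (n + 1)).map ((P.i n).map a) = (D.bar n).map a := by
  rw [D.bar_succ, P.s_i]

theorem bar_src (n k : ℕ) {m : ℕ+} (a : P.cell n m) :
    (D.bar n).map ((P.src n k).map a) = (D.bar n).map a := by
  induction n with
  | zero => rfl
  | succ n ih =>
    rcases le_or_gt k n with hk | hk
    · rw [P.src_le hk, bar_i, ih, ← D.bar_succ]
    · rw [P.src_ge hk]

theorem bar_tgt (n k : ℕ) {m : ℕ+} (a : P.cell n m) :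
    (D.bar n).map ((P.tgt n k).map a) = (D.bar n).map a := by
  induction n with
  | zero => rfl
  | succ n ih =>
    rcases le_or_gt k n with hk | hk
    · rw [P.tgt_le hk, bar_i, ih, D.bar_t, ← D.bar_succ]
    · rw [P.tgt_ge hk]

/-- The endomorphism `ι ∘ π` of the `n`-cells. -/
def hat (n : ℕ) {m : ℕ+} : P.cell n m →ₗ[K] P.cell n m := (D.sec n).comp (D.bar n).map

theorem bar_hat (n : ℕ) {m : ℕ+} (a : P.cell n m) : (D.bar n).map (D.hat n a) = (D.bar n).map a :=
  D.bar_sec n _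

theorem hat_congr {n : ℕ} {m : ℕ+} {a b : P.cell n m} (h : (D.bar n).map a = (D.bar n).map b) :
    D.hat n a = D.hat n b := congrArg (D.sec n) h

theorem hat_hat (n : ℕ) {m : ℕ+} (a : P.cell n m) : D.hat n (D.hat n a) = D.hat n a :=
  D.hat_congr (D.bar_hat n a)

theorem hat_succ (n : ℕ) {m : ℕ+} (a : P.cell (n + 1) m) :
    D.hat (n + 1) a = (P.i n).map (D.hat n ((P.s n).map a)) := by
  change D.sec (n + 1) _ = _
  rw [D.sec_succ, D.bar_succ]
  rfl

theorem hat_t (n : ℕ) {m : ℕ+} (a : P.cell (n + 1) m) :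
    D.hat n ((P.t n).map a) = D.hat n ((P.s n).map a) := D.hat_congr (D.bar_t n a)

theorem hat_one (n : ℕ) : D.hat n (P.cell n).one = (P.cell n).one := by
  induction n with
  | zero =>
    change D.sec 0 _ = _
    rw [Hom.map_one, D.sec_one]
  | succ n ih => rw [hat_succ, Hom.map_one, ih, Hom.map_one]

/-- The 0-targets of a and b have the same image in `B`, hence are joined by a 1-cell; in higher
dimension its iterated identity serves. Equality of classes thereby becomes a path along which
composites can be transported. -/
theorem exists_connecting (n : ℕ) {m : ℕ+} (a b : P.cell (n + 1) m)
    (h : (D.bar (n + 1)).map a = (D.bar (n + 1)).map b) :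
    ∃ e, (P.src (n + 1) 0).map e = (P.tgt (n + 1) 0).map a ∧
      (P.tgt (n + 1) 0).map e = (P.tgt (n + 1) 0).map b := by
  have h' : (D.bar n).map ((P.t n).map a) = (D.bar n).map ((P.t n).map b) := by
    rw [D.bar_t, D.bar_t, ← D.bar_succ, ← D.bar_succ, h]
  induction n with
  | zero =>
    obtain ⟨c, hs, ht⟩ := D.connected _ _ h'
    refine ⟨c, ?_, ?_⟩
    · rw [P.src_succ_self, P.tgt_succ_self, hs]
    · rw [P.tgt_succ_self, P.tgt_succ_self, ht]
  | succ n ih =>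
    obtain ⟨c, hs, ht⟩ := ih _ _ h' (by rw [D.bar_t, D.bar_t, ← D.bar_succ, ← D.bar_succ, h'])
    refine ⟨(P.i (n + 1)).map c, ?_, ?_⟩
    · rw [P.src_i (Nat.zero_le _), hs, P.tgt_le (Nat.zero_le _) a]
    · rw [P.tgt_i (Nat.zero_le _), ht, P.tgt_le (Nat.zero_le _) b]

section

variable {n : ℕ} {r : ℕ+} {p : Fin r → ℕ+} {m : ℕ+} (f : ShuffleSurjection p m)

/-- The composites of a cell with trivial `0`-source and `0`-target only depend on the classes of the
other cells in the presented operad. -/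
theorem comp_congr_of_core (u : P.cell (n + 1) r) (hs : (P.src (n + 1) 0).map u = 0)
    (ht : (P.tgt (n + 1) 0).map u = 0) (c c' : ∀ j, P.cell (n + 1) (p j))
    (h : ∀ j, (D.bar (n + 1)).map (c j) = (D.bar (n + 1)).map (c' j)) :
    (P.cell (n + 1)).comp f u c = (P.cell (n + 1)).comp f u c' := by
  have h1 : ∀ c : ∀ j, P.cell (n + 1) (p j), (P.cell (n + 1)).comp f u c =
      (P.cell (n + 1)).comp f u fun j => (P.tgt (n + 1) 0).map (c j) := by
    intro c
    have := D.comp_star_left (Nat.succ_pos n) f u c (fun j => (P.tgt (n + 1) 0).map (c j))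
      fun j => (P.src_id_tgt le_rfl _).symm
    simpa only [sub_add_cancel, hs, comp_zero_left, sub_self, zero_add] using this
  have h2 : ∀ c : ∀ j, P.cell (n + 1) (p j), (P.cell (n + 1)).comp f u c =
      (P.cell (n + 1)).comp f u fun j => (P.src (n + 1) 0).map (c j) := by
    intro c
    have := D.comp_star_right (Nat.succ_pos n) f u (fun j => (P.src (n + 1) 0).map (c j)) c
      fun j => P.tgt_id_src le_rfl _
    simpa only [P.tgt_id_src le_rfl, sub_self, zero_add, ht, comp_zero_left, sub_zero,
      add_zero] using this
  choose e hes het using fun j => D.exists_connecting n _ _ (h j)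
  -- The chain is u∘c = u∘t₀(c) = u∘s₀(e) = u∘e = u∘t₀(e) = u∘t₀(c') = u∘c'.
  rw [h1 c, h1 c', ← funext hes, ← funext het, ← h1, ← h2]

/-- The contribution of cells with trivial `0`-source and `0`-target to a composite only depends on
the classes of the other cells in the presented operad. -/
theorem comp_add_sub_congr (u : P.cell (n + 1) r) (z : ∀ j, P.cell (n + 1) (p j))
    (hs : ∀ j, (P.src (n + 1) 0).map (z j) = 0) (ht : ∀ j, (P.tgt (n + 1) 0).map (z j) = 0)
    (y y' : ∀ j, P.cell (n + 1) (p j))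
    (h : ∀ j, (D.bar (n + 1)).map (y j) = (D.bar (n + 1)).map (y' j)) :
    (P.cell (n + 1)).comp f u (fun j => y j + z j) - (P.cell (n + 1)).comp f u y =
      (P.cell (n + 1)).comp f u (fun j => y' j + z j) - (P.cell (n + 1)).comp f u y' := by
  have h1 : ∀ (u : P.cell (n + 1) r) (y : ∀ j, P.cell (n + 1) (p j)),
      (P.cell (n + 1)).comp f u (fun j => y j + z j) - (P.cell (n + 1)).comp f u y =
        (P.cell (n + 1)).comp f ((P.tgt (n + 1) 0).map u)
          (fun j => (P.tgt (n + 1) 0).map (y j) + z j) -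
        (P.cell (n + 1)).comp f ((P.tgt (n + 1) 0).map u) fun j => (P.tgt (n + 1) 0).map (y j) := by
    intro u y
    have := D.comp_star_right (Nat.succ_pos n) f u y
      (fun j => (P.tgt (n + 1) 0).map (y j) + z j) fun j => by
        rw [GlobularOperad.Composable, map_add, P.src_id_tgt le_rfl, hs, add_zero]
    -- Because s₀(z) = 0, the sum y + z is y ⋆₀ (t₀(y) + z); this pushes the contribution of z to
    -- the target side. The equation `h2` is the mirror image (s₀(y) + z) ⋆₀ y, which uses t₀(z) =
    -- 0.
    have he : (fun j => y j - (P.tgt (n + 1) 0).map (y j) + ((P.tgt (n + 1) 0).map (y j) + z j)) =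
        fun j => y j + z j := by
      funext j
      abel
    rw [he] at this
    rw [this]
    abel
  have h2 : ∀ (u : P.cell (n + 1) r) (y : ∀ j, P.cell (n + 1) (p j)),
      (P.cell (n + 1)).comp f u (fun j => y j + z j) - (P.cell (n + 1)).comp f u y =
        (P.cell (n + 1)).comp f ((P.src (n + 1) 0).map u)
          (fun j => (P.src (n + 1) 0).map (y j) + z j) -
        (P.cell (n + 1)).comp f ((P.src (n + 1) 0).map u) fun j => (P.src (n + 1) 0).map (y j) := by
    intro u y
    have := D.comp_star_left (Nat.succ_pos n) f u
      (fun j => (P.src (n + 1) 0).map (y j) + z j) y fun j => by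
        rw [GlobularOperad.Composable, map_add, P.tgt_id_src le_rfl, ht, add_zero]
    simp only [map_add, P.tgt_id_src le_rfl, ht, add_zero] at this
    have he : (fun j => (P.src (n + 1) 0).map (y j) + z j - (P.src (n + 1) 0).map (y j) + y j) =
        fun j => y j + z j := by
      funext j
      abel
    rw [he] at this
    rw [this]
    abel
  choose e hes het using fun j => D.exists_connecting n _ _ (h j)
  -- Applied to the connecting cells e, the two forms compare the contributions at the 0-targets of
  -- y and of y'. The root is first replaced by t₀(u), which is fixed by both s₀ and t₀.
  have h3 := h2 ((P.tgt (n + 1) 0).map u) e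
  have h4 := h1 ((P.tgt (n + 1) 0).map u) e
  rw [P.src_id_tgt le_rfl] at h3
  rw [P.tgt_tgt le_rfl] at h4
  simp only [hes] at h3
  simp only [het] at h4
  rw [h1 u y, h1 u y', ← h3, h4]

end

end AcyclicData

/-! ### Retractions, and lifts to grafting operations -/

namespace AcyclicData

variable {P : GlobularOperad K} {B : ShuffleOperad K} (D : AcyclicData P B)

/-- A projector of the `n`-cells, onto the kernel of `π` for `n = 0` and onto the loops for `n > 0`. -/
structure Retraction (n : ℕ) where
  map : ∀ {m : ℕ+}, P.cell n m →ₗ[K] P.cell n m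
  map_map : ∀ {m : ℕ+} (a : P.cell n m), map (map a) = map a
  map_hat : ∀ {m : ℕ+} (a : P.cell n m), map (D.hat n a) = 0
  -- Equivalently, (1 − N)(u∘v) = u∘(v − N(v)) − N(u∘v̂): the reduced form of a composite depends on
  -- its inputs only through their reduced forms.
  map_comp : ∀ {r : ℕ+} {p : Fin r → ℕ+} {m : ℕ+} (f : ShuffleSurjection p m) (u : P.cell n r)
    (v : ∀ j, P.cell n (p j)),
    map ((P.cell n).comp f u v) = map ((P.cell n).comp f u fun j => D.hat n (v j)) +
      (P.cell n).comp f u v - (P.cell n).comp f u fun j => v j - map (v j)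
  map_boundary : ∀ {m : ℕ+} (a : P.cell (n + 1) m),
    map ((P.t n).map a - (P.s n).map a) = (P.t n).map a - (P.s n).map a
  exists_filler : ∀ {m : ℕ+} (a : P.cell n m), ∃ c, (P.s n).map c = 0 ∧ (P.t n).map c = map a
  tgt_map : ∀ k, k < n → ∀ {m : ℕ+} (a : P.cell n m), (P.tgt n k).map (map a) = 0
  map_src : ∀ k, k < n → ∀ {m : ℕ+} (a : P.cell n m), map ((P.src n k).map a) = 0
  -- In degree 0 the reduced form is exactly the section; in positive degree only their classes
  -- agree, and the comparison goes through cells with trivial 0-boundary.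
  sub_map : n = 0 → ∀ {m : ℕ+} (a : P.cell n m), a - map a = D.hat n a

/-- A linear right inverse of the target map on the cells with trivial source. -/
theorem _root_.GlobularOperad.exists_section (P : GlobularOperad K) (n : ℕ) (m : ℕ+) :
    ∃ κ : P.cell n m →ₗ[K] P.cell (n + 1) m, (∀ z, (P.s n).map (κ z) = 0) ∧
      ∀ z, (∃ c, (P.s n).map c = 0 ∧ (P.t n).map c = z) → (P.t n).map (κ z) = z := by
  let V : Submodule K (P.cell (n + 1) m) := LinearMap.ker (P.s n).map
  let τ : V →ₗ[K] P.cell n m := (P.t n).map.comp V.subtype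
  obtain ⟨g, hg⟩ := τ.rangeRestrict.exists_rightInverse_of_surjective τ.range_rangeRestrict
  -- The right inverse lives on the range of the target map. Extending it to all n-cells keeps κ
  -- linear everywhere; its target is controlled on that range only.
  obtain ⟨g', hg'⟩ := g.exists_extend
  refine ⟨V.subtype.comp g', fun z => (g' z).2, ?_⟩
  rintro _ ⟨c, hs, rfl⟩
  have h1 := LinearMap.congr_fun hg (τ.rangeRestrict ⟨c, hs⟩)
  have h2 := LinearMap.congr_fun hg' (τ.rangeRestrict ⟨c, hs⟩)
  have h3 := congrArg Subtype.val h1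
  change (τ (g (τ.rangeRestrict ⟨c, hs⟩))) = _ at h3
  rw [← h2] at h3
  exact h3

namespace Retraction

variable {D} {n : ℕ} (N : D.Retraction n)

theorem map_one : N.map (P.cell n).one = 0 := by
  rw [← D.hat_one, N.map_hat]

theorem map_sub_self {m : ℕ+} (a : P.cell n m) : N.map (a - N.map a) = 0 := by
  rw [map_sub, N.map_map, sub_self]

theorem bar_map {m : ℕ+} (a : P.cell n m) : (D.bar n).map (N.map a) = 0 := by
  obtain ⟨c, hs, ht⟩ := N.exists_filler a
  rw [← ht, D.bar_t, hs, map_zero]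

theorem hat_sub_map {m : ℕ+} (a : P.cell n m) : D.hat n (a - N.map a) = D.hat n a :=
  D.hat_congr (by rw [map_sub, N.bar_map, sub_zero])

theorem map_comp_of_eq_zero {r : ℕ+} {p : Fin r → ℕ+} {m : ℕ+} (f : ShuffleSurjection p m)
    (u : P.cell n r) (v : ∀ j, P.cell n (p j)) (h : ∀ j, N.map (v j) = 0) :
    N.map ((P.cell n).comp f u v) = N.map ((P.cell n).comp f u fun j => D.hat n (v j)) := by
  rw [N.map_comp]
  simp only [h, sub_zero]
  abel

/-- Both v and v − N(v) have the same hat, and N kills v − N(v), so `map_comp` gives the same result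
for both. Reducing the inputs before the composite is thus harmless, which is what makes the target
condition of `IsLift` stable under composition. -/
theorem comp_sub_map {r : ℕ+} {p : Fin r → ℕ+} {m : ℕ+} (f : ShuffleSurjection p m)
    (u : P.cell n r) (v : ∀ j, P.cell n (p j)) :
    (P.cell n).comp f u (fun j => v j - N.map (v j)) -
        N.map ((P.cell n).comp f u fun j => v j - N.map (v j)) =
      (P.cell n).comp f u v - N.map ((P.cell n).comp f u v) := by
  rw [N.map_comp_of_eq_zero f u (fun j => v j - N.map (v j)) fun j => N.map_sub_self _,
    N.map_comp f u v]
  simp only [N.hat_sub_map]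
  abel

/-- The grafting operation `U` on `(n + 1)`-cells behaves like grafting onto the identity of the
`n`-cell `u`, corrected so that its targets lie in the kernel of the retraction. -/
structure IsLift {k : ℕ+} (U : (P.cell (n + 1)).GraftingOperation k) (u : P.cell n k) : Prop where
  s_apply : ∀ {q : Fin k → ℕ+} {m : ℕ+} (f : ShuffleSurjection q m) (c : ∀ j, P.cell (n + 1) (q j)),
    (P.s n).map (U q m f c) = (P.cell n).comp f u fun j => (P.s n).map (c j)
  -- Inputs are required to have reduced targets; the output then has a reduced target too, so lifts
  -- can be iterated.
  t_apply : ∀ {q : Fin k → ℕ+} {m : ℕ+} (f : ShuffleSurjection q m) (c : ∀ j, P.cell (n + 1) (q j)),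
    (∀ j, N.map ((P.t n).map (c j)) = 0) →
    (P.t n).map (U q m f c) = ((P.cell n).comp f u fun j => (P.t n).map (c j)) -
      N.map ((P.cell n).comp f u fun j => (P.t n).map (c j))
  tgt_apply : ∀ {j : ℕ}, j < n → ∀ {q : Fin k → ℕ+} {m : ℕ+} (f : ShuffleSurjection q m)
    (c : ∀ i, P.cell (n + 1) (q i)),
    (P.tgt (n + 1) j).map (U q m f c) = (P.cell (n + 1)).comp f ((P.tgt (n + 1) j).map ((P.i n).map u))
      fun i => (P.tgt (n + 1) j).map (c i)
  -- The case j = n is included here, unlike in `tgt_apply` and `star_right`: the n-source of a lift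
  -- is that of plain grafting, whereas its n-target is corrected. That case yields the composition
  -- law of fillings.
  star_left : ∀ {j : ℕ}, j ≤ n → ∀ {q : Fin k → ℕ+} {m : ℕ+} (f : ShuffleSurjection q m)
    (c c' : ∀ i, P.cell (n + 1) (q i)), (∀ i, P.Composable j (c i) (c' i)) →
    U q m f (fun i => c i - (P.tgt (n + 1) j).map (c i) + c' i) =
      (P.cell (n + 1)).comp f ((P.src (n + 1) j).map ((P.i n).map u)) c -
        (P.cell (n + 1)).comp f ((P.src (n + 1) j).map ((P.i n).map u))
          (fun i => (P.tgt (n + 1) j).map (c i)) + U q m f c'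
  star_right : ∀ {j : ℕ}, j < n → ∀ {q : Fin k → ℕ+} {m : ℕ+} (f : ShuffleSurjection q m)
    (c c' : ∀ i, P.cell (n + 1) (q i)), (∀ i, P.Composable j (c i) (c' i)) →
    U q m f (fun i => c i - (P.tgt (n + 1) j).map (c i) + c' i) =
      U q m f c - (P.cell (n + 1)).comp f ((P.tgt (n + 1) j).map ((P.i n).map u))
          (fun i => (P.tgt (n + 1) j).map (c i)) +
        (P.cell (n + 1)).comp f ((P.tgt (n + 1) j).map ((P.i n).map u)) c'

variable {N}

theorem IsLift.src_apply {k : ℕ+} {U : (P.cell (n + 1)).GraftingOperation k} {u : P.cell n k}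
    (h : N.IsLift U u) {j : ℕ} (hj : j ≤ n) {q : Fin k → ℕ+} {m : ℕ+} (f : ShuffleSurjection q m)
    (c : ∀ i, P.cell (n + 1) (q i)) :
    (P.src (n + 1) j).map (U q m f c) = (P.cell (n + 1)).comp f
      ((P.src (n + 1) j).map ((P.i n).map u)) fun i => (P.src (n + 1) j).map (c i) := by
  rw [P.src_le hj, h.s_apply, Hom.map_comp, Hom.map_comp, P.src_i hj]
  simp only [P.src_le hj]

/-- Plain grafting satisfies every condition of a lift by the exchange law, except that its target
carries no correction; the hypothesis says that none is needed. It is used for the operadic unit and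
for identity cells. -/
theorem isLift_graftingOnto (u : P.cell n k)
    (h : ∀ {q : Fin k → ℕ+} {m : ℕ+} (f : ShuffleSurjection q m) (c : ∀ j, P.cell n (q j)),
      (∀ j, N.map (c j) = 0) → N.map ((P.cell n).comp f u c) = 0) :
    N.IsLift ((P.cell (n + 1)).graftingOnto.map ((P.i n).map u)) u where
  s_apply f c := by rw [graftingOnto_apply, Hom.map_comp, P.s_i]
  t_apply f c hc := by rw [graftingOnto_apply, Hom.map_comp, P.t_i, h f _ hc, sub_zero]
  tgt_apply _ _ _ f c := by rw [graftingOnto_apply, Hom.map_comp]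
  star_left hj _ _ f c c' hc := D.comp_star_left (Nat.lt_succ_of_le hj) f _ c c' hc
  star_right hj _ _ f c c' hc := D.comp_star_right (hj.trans n.lt_succ_self) f _ c c' hc

variable (N)

/-- Compatibility of lifts with the structure of shuffle operad. -/
noncomputable def liftRel : OperadRel (P.cell (n + 1)).grafting (P.cell n) where
  rel U u := N.IsLift U u
  zero {k} := by
    have h0 : ∀ {q : Fin k → ℕ+} {m : ℕ+} (f : ShuffleSurjection q m)
      (c : ∀ j, P.cell (n + 1) (q j)),
      (0 : (P.cell (n + 1)).grafting k) q m f c = 0 := fun f c => rfl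
    refine ⟨fun f c => ?_, fun f c _ => ?_, fun _ _ _ f c => ?_, fun _ _ _ f c c' _ => ?_,
      fun _ _ _ f c c' _ => ?_⟩ <;>
    simp only [h0, map_zero, _root_.zero_apply, sub_self, add_zero]
  add {k U U' u u'} hU hU' := by
    have h0 : ∀ {q : Fin k → ℕ+} {m : ℕ+} (f : ShuffleSurjection q m)
      (c : ∀ j, P.cell (n + 1) (q j)),
      (U + U') q m f c = U q m f c + U' q m f c := fun f c => rfl
    refine ⟨fun f c => ?_, fun f c hc => ?_, fun hj _ _ f c => ?_, fun hj _ _ f c c' hc => ?_,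
      fun hj _ _ f c c' hc => ?_⟩ <;> simp only [h0, map_add, _root_.add_apply]
    · rw [hU.s_apply, hU'.s_apply]
    · rw [hU.t_apply f c hc, hU'.t_apply f c hc]
      abel
    · rw [hU.tgt_apply hj, hU'.tgt_apply hj]
    · rw [hU.star_left hj f c c' hc, hU'.star_left hj f c c' hc]
      abel
    · rw [hU.star_right hj f c c' hc, hU'.star_right hj f c c' hc]
      abel
  smul {k} a {U u} hU := by
    have h0 : ∀ {q : Fin k → ℕ+} {m : ℕ+} (f : ShuffleSurjection q m)
      (c : ∀ j, P.cell (n + 1) (q j)), (a • U) q m f c = a • U q m f c := fun f c => rfl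
    refine ⟨fun f c => ?_, fun f c hc => ?_, fun hj _ _ f c => ?_, fun hj _ _ f c c' hc => ?_,
      fun hj _ _ f c c' hc => ?_⟩ <;> simp only [h0, map_smul, _root_.smul_apply]
    · rw [hU.s_apply]
    · rw [hU.t_apply f c hc, smul_sub]
    · rw [hU.tgt_apply hj]
    · rw [hU.star_left hj f c c' hc, smul_add, smul_sub]
    · rw [hU.star_right hj f c c' hc, smul_add, smul_sub]
  one := by
    have h := isLift_graftingOnto (N := N) (P.cell n).one fun {q m} f c hc => by
      obtain rfl := TreeMonomial.arity_of_unit f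
      rw [one_comp_eq, hc]
    rwa [Hom.map_one, Hom.map_one] at h
  comp {k p m} f {U u V v} hU hV := by
    refine ⟨fun {q l} f' c => ?_, fun {q l} f' c hc => ?_, fun {j} hj {q l} f' c => ?_,
      fun {j} hj {q l} f' c c' hc => ?_, fun {j} hj {q l} f' c c' hc => ?_⟩ <;>
    rw [grafting_comp_apply]
    · rw [hU.s_apply, (P.cell n).assoc]
      congr 1
      funext i
      exact (hV i).s_apply _ _
    · have ht : ∀ i, (P.t n).map (V i _ _ (f.restr f' i) fun a => c (f.enum i a)) = _ := fun i =>
        (hV i).t_apply (f.restr f' i) (fun a => c (f.enum i a)) fun a => hc _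
      -- The intermediate outputs have targets of the form x − N(x), killed by N, so the target
      -- condition for `U` may be used.
      rw [hU.t_apply _ _ fun i => by rw [ht, N.map_sub_self], (P.cell n).assoc]
      simp only [ht]
      exact N.comp_sub_map _ _ _
    · rw [hU.tgt_apply hj, Hom.map_comp, Hom.map_comp, (P.cell (n + 1)).assoc]
      congr 1
      funext i
      exact (hV i).tgt_apply hj _ _
    · have hX : ∀ i, V i _ _ (f.restr f' i) (fun a => c (f.enum i a) -
          (P.tgt (n + 1) j).map (c (f.enum i a)) + c' (f.enum i a)) = _ := fun i =>
        (hV i).star_left hj (f.restr f' i) (fun a => c (f.enum i a)) (fun a => c' (f.enum i a))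
          fun a => hc _
      have ht : ∀ i, (P.tgt (n + 1) j).map ((P.cell (n + 1)).comp (f.restr f' i)
          ((P.src (n + 1) j).map ((P.i n).map (v i))) fun a => c (f.enum i a)) =
          (P.cell (n + 1)).comp (f.restr f' i) ((P.src (n + 1) j).map ((P.i n).map (v i)))
            fun a => (P.tgt (n + 1) j).map (c (f.enum i a)) := fun i => by
        rw [Hom.map_comp, P.tgt_id_src le_rfl]
      simp only [hX, ← ht]
      rw [hU.star_left hj]
      · simp only [ht, Hom.map_comp, (P.cell (n + 1)).assoc, grafting_comp_apply]
      · intro i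
        rw [GlobularOperad.Composable, ht, (hV i).src_apply hj]
        congr 1
        funext a
        exact hc _
    · have hX : ∀ i, V i _ _ (f.restr f' i) (fun a => c (f.enum i a) -
          (P.tgt (n + 1) j).map (c (f.enum i a)) + c' (f.enum i a)) = _ := fun i =>
        (hV i).star_right hj (f.restr f' i) (fun a => c (f.enum i a)) (fun a => c' (f.enum i a))
          fun a => hc _
      have ht : ∀ i, (P.tgt (n + 1) j).map (V i _ _ (f.restr f' i) fun a => c (f.enum i a)) =
          (P.cell (n + 1)).comp (f.restr f' i) ((P.tgt (n + 1) j).map ((P.i n).map (v i)))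
            fun a => (P.tgt (n + 1) j).map (c (f.enum i a)) := fun i =>
        (hV i).tgt_apply hj _ _
      simp only [hX, ← ht]
      rw [hU.star_right hj]
      · simp only [ht, Hom.map_comp, (P.cell (n + 1)).assoc, grafting_comp_apply]
      · intro i
        rw [GlobularOperad.Composable, ht, Hom.map_comp, P.src_id_tgt le_rfl]
        congr 1
        funext a
        exact hc _

end Retraction

end AcyclicData

/-! ### Existence of coherent lifts and of fillings -/

namespace AcyclicData

variable {P : GlobularOperad K} {B : ShuffleOperad K} {D : AcyclicData P B}

namespace Retraction

variable {n : ℕ} {N : D.Retraction n}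

/-- The conditions `star_left` and `star_right` describe a lift on a ⋆ₖ-composite by plain grafting
plus one uncomposed term. Both sides can therefore be expanded into the same terms whatever lifts
were chosen, so that choices on generators automatically respect the exchange relations. -/
theorem IsLift.exchange {k : ℕ} (hk : k < n) {r : ℕ+} {p : Fin r → ℕ+} {m : ℕ+}
    (f : ShuffleSurjection p m) {A B : (P.cell (n + 1)).grafting r} {a b : P.cell n r}
    {V W : ∀ i, (P.cell (n + 1)).grafting (p i)} {v w : ∀ i, P.cell n (p i)}
    (hA : N.IsLift A a) (hB : N.IsLift B b) (hV : ∀ i, N.IsLift (V i) (v i))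
    (hW : ∀ i, N.IsLift (W i) (w i)) (hab : P.Composable k a b)
    (hvw : ∀ i, P.Composable k (v i) (w i)) :
    (P.cell (n + 1)).grafting.comp f
        (A - (P.cell (n + 1)).graftingOnto.map ((P.i n).map ((P.tgt n k).map a)) + B)
        (fun i => V i - (P.cell (n + 1)).graftingOnto.map ((P.i n).map ((P.tgt n k).map (v i))) +
          W i) =
      (P.cell (n + 1)).grafting.comp f A V - (P.cell (n + 1)).graftingOnto.map
          ((P.i n).map ((P.tgt n k).map ((P.cell n).comp f a v))) +
        (P.cell (n + 1)).grafting.comp f B W := by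
  have hs : ∀ {k : ℕ+} (U U' : (P.cell (n + 1)).grafting k) (u : P.cell (n + 1) k)
      {q : Fin k → ℕ+} {m : ℕ+} (f : ShuffleSurjection q m) (c : ∀ j, P.cell (n + 1) (q j)),
      (U - (P.cell (n + 1)).graftingOnto.map u + U') q m f c =
        U q m f c - (P.cell (n + 1)).comp f u c + U' q m f c := by intros; rfl
  have hi : ∀ {m : ℕ+} (a b : P.cell n m), P.Composable k a b →
      (P.src (n + 1) k).map ((P.i n).map b) = (P.tgt (n + 1) k).map ((P.i n).map a) := by
    intro m a b h
    rw [P.src_i hk.le, P.tgt_i hk.le, h]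
  funext q l f'
  ext c
  rw [hs]
  simp only [grafting_comp_apply, hs, ← P.tgt_i hk.le]
  have htV : ∀ i, (P.tgt (n + 1) k).map (V i _ _ (f.restr f' i) fun a => c (f.enum i a)) =
      (P.cell (n + 1)).comp (f.restr f' i) ((P.tgt (n + 1) k).map ((P.i n).map (v i)))
        fun a => (P.tgt (n + 1) k).map (c (f.enum i a)) := fun i => (hV i).tgt_apply hk _ _
  have hWc : ∀ i, W i _ _ (f.restr f' i) (fun a => c (f.enum i a)) =
      (P.cell (n + 1)).comp (f.restr f' i) ((P.tgt (n + 1) k).map ((P.i n).map (v i)))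
          (fun a => c (f.enum i a)) -
        (P.tgt (n + 1) k).map (V i _ _ (f.restr f' i) fun a => c (f.enum i a)) +
        W i _ _ (f.restr f' i) fun a => (P.tgt (n + 1) k).map (c (f.enum i a)) := by
    intro i
    have := (hW i).star_left hk.le (f.restr f' i) (fun a => c (f.enum i a))
      (fun a => (P.tgt (n + 1) k).map (c (f.enum i a))) fun a => (P.src_id_tgt le_rfl _).symm
    rw [hi _ _ (hvw i), ← htV] at this
    simpa only [sub_add_cancel] using this
  have hX : ∀ i, (P.tgt (n + 1) k).map ((P.cell (n + 1)).comp (f.restr f' i)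
      ((P.tgt (n + 1) k).map ((P.i n).map (v i))) fun a => c (f.enum i a)) =
      (P.tgt (n + 1) k).map (V i _ _ (f.restr f' i) fun a => c (f.enum i a)) := by
    intro i
    rw [Hom.map_comp, P.tgt_tgt le_rfl, htV]
  have hcW : ∀ i, P.Composable k (V i _ _ (f.restr f' i) fun a => c (f.enum i a))
      (W i _ _ (f.restr f' i) fun a => (P.tgt (n + 1) k).map (c (f.enum i a))) := by
    intro i
    rw [GlobularOperad.Composable, htV, (hW i).src_apply hk.le, hi _ _ (hvw i)]
    simp only [P.src_id_tgt le_rfl]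
  -- Expanding W(c) along c = c ⋆ₖ tₖ(c) shows that the combined operation on inputs returns V(c) ⋆ₖ
  -- W(tₖ(c)), a genuine composite to which the conditions on `A` and `B` apply.
  have hU : ∀ i, V i _ _ (f.restr f' i) (fun a => c (f.enum i a)) -
      (P.cell (n + 1)).comp (f.restr f' i) ((P.tgt (n + 1) k).map ((P.i n).map (v i)))
        (fun a => c (f.enum i a)) + W i _ _ (f.restr f' i) (fun a => c (f.enum i a)) =
      V i _ _ (f.restr f' i) (fun a => c (f.enum i a)) -
        (P.tgt (n + 1) k).map (V i _ _ (f.restr f' i) fun a => c (f.enum i a)) +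
        W i _ _ (f.restr f' i) fun a => (P.tgt (n + 1) k).map (c (f.enum i a)) := by
    intro i
    rw [hWc]
    abel
  simp only [hU]
  rw [hA.star_right hk _ _ _ hcW, hB.star_left hk.le _ _ _ hcW, hi _ _ hab,
    D.comp_star_right (n := n + 1) (hk.trans n.lt_succ_self) _ _ _ _ hcW, P.tgt_tgt le_rfl]
  simp only [hWc, ← hX]
  rw [hB.star_left hk.le _ _ _ fun i => by rw [GlobularOperad.Composable, hX]; exact hcW i,
    hi _ _ hab, Hom.map_comp, Hom.map_comp, (P.cell (n + 1)).assoc]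
  abel

variable (N)

/-- Plain grafting onto 1_x has the right source, and the excess N(x∘t(c)) in its target bounds a
cell with zero source, which is subtracted by means of the linear section κ. -/
theorem exists_isLift {k : ℕ+} (x : P.cell n k) :
    ∃ U : (P.cell (n + 1)).grafting k, N.IsLift U x := by
  choose κ hsκ htκ using P.exists_section n
  have ht : ∀ {m : ℕ+} (a : P.cell n m), (P.t n).map (κ m (N.map a)) = N.map a := fun a =>
    htκ _ _ (N.exists_filler a)
  have hbar : ∀ {m : ℕ+} (a : P.cell (n + 1) m),
      (D.bar n).map ((P.t n).map a) = (D.bar (n + 1)).map a := fun a => by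
    rw [D.bar_t, ← D.bar_succ]
  let ψ : ∀ m, P.cell (n + 1) m →ₗ[K] P.cell n m := fun m => (D.hat n).comp (P.t n).map
  -- The correction is built from the hats of the targets rather than from the targets: on inputs
  -- with reduced targets N has the same value, and the hats depend only on the classes in `B`. It
  -- is thus insensitive to the compositions occurring in `star_left` and `star_right`.
  let U : (P.cell (n + 1)).GraftingOperation k := fun q m f =>
    (P.cell (n + 1)).comp f ((P.i n).map x) -
      ((κ m).comp N.map).compMultilinearMap (((P.cell n).comp f x).compLinearMap fun j => ψ (q j))
  have hU : ∀ {q : Fin k → ℕ+} {m : ℕ+} (f : ShuffleSurjection q m)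
      (c : ∀ j, P.cell (n + 1) (q j)), U q m f c = (P.cell (n + 1)).comp f ((P.i n).map x) c -
        κ m (N.map ((P.cell n).comp f x fun j => D.hat n ((P.t n).map (c j)))) := fun f c => rfl
  have hstar : ∀ {j : ℕ} {m : ℕ+} {c c' : P.cell (n + 1) m}, P.Composable j c c' →
      (D.bar (n + 1)).map c = (D.bar (n + 1)).map c' := by
    intro j m c c' h
    have := congrArg (D.bar (n + 1)).map h
    rwa [D.bar_tgt, D.bar_src] at this
  refine ⟨U, fun f c => ?_, fun f c hc => ?_, fun {j} hj _ _ f c => ?_,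
    fun {j} hj _ _ f c c' hc => ?_, fun {j} hj _ _ f c c' hc => ?_⟩
  · rw [hU, map_sub, hsκ, sub_zero, Hom.map_comp, P.s_i]
  · rw [hU, map_sub, ht, Hom.map_comp, P.t_i, ← N.map_comp_of_eq_zero _ _ _ hc]
  · rw [hU, map_sub, P.tgt_le hj.le (κ _ _), ht, N.tgt_map j hj, map_zero, sub_zero, Hom.map_comp]
  · have hh : ∀ i, D.hat n ((P.t n).map (c i - (P.tgt (n + 1) j).map (c i) + c' i)) =
        D.hat n ((P.t n).map (c' i)) := fun i => D.hat_congr (by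
      rw [hbar, hbar, map_add, map_sub, D.bar_tgt, sub_self, zero_add])
    rw [hU, hU, D.comp_star_left (Nat.lt_succ_of_le hj) _ _ _ _ hc]
    simp only [hh]
    abel
  · have hh : ∀ i, D.hat n ((P.t n).map (c i - (P.tgt (n + 1) j).map (c i) + c' i)) =
        D.hat n ((P.t n).map (c i)) := fun i => D.hat_congr (by
      rw [hbar, hbar, map_add, map_sub, D.bar_tgt, sub_self, zero_add, hstar (hc i)])
    rw [hU, hU, D.comp_star_right (hj.trans n.lt_succ_self) _ _ _ _ hc]
    simp only [hh]
    abel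

/-- Freeness turns separate lifts of the generators into a single operad morphism; in positive
degree identities act by plain grafting, and the exchange relations are forced by `IsLift.exchange`.
-/
theorem exists_hom_isLift : ∃ Φ : Hom (P.cell n) (P.cell (n + 1)).grafting,
    ∀ {k : ℕ+} (a : P.cell n k), N.IsLift (Φ.map a) a := by
  cases n with
  | zero => exact D.exists_hom_zero N.liftRel fun a => N.exists_isLift a
  | succ n =>
    have hsrc : ∀ {m : ℕ+} (a : P.cell n m),
        (P.src (n + 1) n).map ((P.i n).map a) = (P.i n).map a := fun a => by
      rw [P.src_i le_rfl, P.src_ge le_rfl]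
    refine D.exists_hom_succ n N.liftRel
      ((P.cell (n + 2)).graftingOnto.comp ((P.i (n + 1)).comp (P.i n))) (fun a => ?_)
      (fun a => N.exists_isLift a) ?_
    -- For c killed by N, the value N(1_a∘c) equals N(1_a∘ĉ). Hats in positive degree are
    -- identities, so this composite is an identity, and N kills it.
    · refine isLift_graftingOnto _ fun f c hc => ?_
      rw [N.map_comp_of_eq_zero _ _ _ hc]
      simp only [D.hat_succ]
      rw [← Hom.map_comp, ← hsrc, N.map_src n n.lt_succ_self]
    · intro k hk r p m f A B a b V W v w hA hB hV hW hab hvw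
      have ht : ∀ {m : ℕ+} (a : P.cell (n + 1) m),
          ((P.cell (n + 2)).graftingOnto.comp ((P.i (n + 1)).comp (P.i n))).map
            ((P.tgt n k).map ((P.t n).map a)) =
          (P.cell (n + 2)).graftingOnto.map ((P.i (n + 1)).map ((P.tgt (n + 1) k).map a)) := by
        intro m a
        rw [P.tgt_le hk]
        rfl
      simp only [ht]
      exact IsLift.exchange (Nat.lt_succ_of_le hk) f hA hB hV hW hab hvw

/-- A contracting homotopy in degree `n`, that is compatible with grafting onto `n`-cells. -/
structure Filling where
  map : ∀ {m : ℕ+}, P.cell n m →ₗ[K] P.cell (n + 1) m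
  s_map : ∀ {m : ℕ+} (a : P.cell n m), (P.s n).map (map a) = 0
  t_map : ∀ {m : ℕ+} (a : P.cell n m), (P.t n).map (map a) = -N.map a
  map_map : ∀ {m : ℕ+} (a : P.cell n m), map (N.map a) = map a
  map_comp : ∀ {r : ℕ+} {p : Fin r → ℕ+} {m : ℕ+} (f : ShuffleSurjection p m) (u : P.cell n r)
    (v : ∀ j, P.cell n (p j)),
    map ((P.cell n).comp f u v) = map ((P.cell n).comp f u fun j => D.hat n (v j)) +
      ((P.cell (n + 1)).comp f ((P.i n).map u) fun j => (P.i n).map (v j) + map (v j)) -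
        (P.i n).map ((P.cell n).comp f u v)

/-- Evaluating the coherent lifts at units gives e(a), a cell from a to a − N(a). Then h(a) =
e(N(a)) − 1_{N(a)} has zero source and target −N(a), and the multiplicativity e(u∘v) = Φ(u)(e(v))
becomes the composition law for h. -/
theorem nonempty_filling : Nonempty N.Filling := by
  obtain ⟨Φ, hΦ⟩ := N.exists_hom_isLift
  let e : ∀ {m : ℕ+}, P.cell n m →ₗ[K] P.cell (n + 1) m :=
    ((P.cell (n + 1)).graftingEval _).comp Φ.map
  have he : ∀ {m : ℕ+} (a : P.cell n m),
      e a = Φ.map a _ m (.refl m) fun _ => (P.cell (n + 1)).one := fun a => rfl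
  have hecomp : ∀ {r : ℕ+} {p : Fin r → ℕ+} {m : ℕ+} (f : ShuffleSurjection p m) (u : P.cell n r)
      (v : ∀ j, P.cell n (p j)), e ((P.cell n).comp f u v) = Φ.map u p m f fun j => e (v j) := by
    intro r p m f u v
    change (P.cell (n + 1)).graftingEval _ (Φ.map _) = _
    rw [Φ.map_comp, graftingEval_comp]
    rfl
  have hse : ∀ {m : ℕ+} (a : P.cell n m), (P.s n).map (e a) = a := by
    intro m a
    rw [he, (hΦ a).s_apply]
    simp only [Hom.map_one]
    exact (P.cell n).comp_one _ _
  have hte : ∀ {m : ℕ+} (a : P.cell n m), (P.t n).map (e a) = a - N.map a := by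
    intro m a
    rw [he, (hΦ a).t_apply _ _ fun _ => by rw [Hom.map_one, N.map_one]]
    simp only [Hom.map_one, (P.cell n).comp_one]
  refine ⟨⟨e.comp N.map - (P.i n).map.comp N.map, fun a => ?_, fun a => ?_, fun a => ?_,
    fun {r p m} f u v => ?_⟩⟩
  · change (P.s n).map (e (N.map a) - (P.i n).map (N.map a)) = 0
    rw [map_sub, hse, P.s_i, sub_self]
  · change (P.t n).map (e (N.map a) - (P.i n).map (N.map a)) = _
    rw [map_sub, hte, P.t_i, N.map_map]
    abel
  · change e (N.map (N.map a)) - (P.i n).map (N.map (N.map a)) = e (N.map a) - (P.i n).map (N.map a)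
    rw [N.map_map]
  · change e (N.map _) - (P.i n).map (N.map _) = e (N.map _) - (P.i n).map (N.map _) +
      (P.cell (n + 1)).comp f ((P.i n).map u)
        (fun j => (P.i n).map (v j) + (e (N.map (v j)) - (P.i n).map (N.map (v j)))) - _
    have hc : ∀ j, (P.tgt (n + 1) n).map
        ((P.i n).map (v j) + (e (N.map (v j)) - (P.i n).map (N.map (v j)))) =
        (P.i n).map (v j - N.map (v j)) := by
      intro j
      rw [P.tgt_succ_self, map_add, map_sub, hte, P.t_i, P.t_i, N.map_map, sub_self, zero_sub,
        sub_eq_add_neg]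
    -- The cell e(v) factors as (1_v + h(v)) ⋆ₙ e(v − N(v)). Applying Φ(u) through `star_left` in
    -- the extreme case j = n splits e(u∘v) into plain grafting onto 1_u and e(u∘(v − N(v))).
    have key := (hΦ u).star_left le_rfl f
      (fun j => (P.i n).map (v j) + (e (N.map (v j)) - (P.i n).map (N.map (v j))))
      (fun j => e (v j - N.map (v j))) fun j => by
        rw [GlobularOperad.Composable, hc, P.src_succ_self, hse]
    simp only [hc] at key
    have hsum : ∀ j, (P.i n).map (v j) + (e (N.map (v j)) - (P.i n).map (N.map (v j))) -
        (P.i n).map (v j - N.map (v j)) + e (v j - N.map (v j)) = e (v j) := by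
      intro j
      rw [map_sub, map_sub]
      abel
    simp only [hsum] at key
    rw [← hecomp, ← hecomp, P.src_i le_rfl, P.src_ge le_rfl, ← Hom.map_comp] at key
    rw [N.map_comp f u v]
    simp only [map_sub, map_add, key]
    abel

end Retraction

end AcyclicData

/-! ### Induction on the dimension -/

namespace AcyclicData

variable {P : GlobularOperad K} {B : ShuffleOperad K} (D : AcyclicData P B)

/-- The projector onto the kernel of `π` along the image of `ι`. -/
def Retraction.zero : D.Retraction 0 where
  map := LinearMap.id - D.hat 0
  map_map a := by
    simp only [LinearMap.sub_apply, LinearMap.id_apply, map_sub, D.hat_hat]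
    abel
  map_hat a := by
    simp only [LinearMap.sub_apply, LinearMap.id_apply, D.hat_hat, sub_self]
  map_comp f u v := by
    have h : D.hat 0 ((P.cell 0).comp f u fun j => D.hat 0 (v j)) =
        D.hat 0 ((P.cell 0).comp f u v) :=
      D.hat_congr (by simp only [Hom.map_comp, D.bar_hat])
    simp only [LinearMap.sub_apply, LinearMap.id_apply, sub_sub_cancel, h]
    abel
  map_boundary a := by
    simp only [LinearMap.sub_apply, LinearMap.id_apply, map_sub, D.hat_t]
    abel
  exists_filler a := by
    obtain ⟨c, hs, ht⟩ := D.connected 0 (a - D.hat 0 a) (by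
      rw [map_zero, map_sub, D.bar_hat, sub_self])
    exact ⟨c, hs, ht⟩
  tgt_map k hk := absurd hk (Nat.not_lt_zero k)
  map_src k hk := absurd hk (Nat.not_lt_zero k)
  sub_map _ _ a := sub_sub_cancel _ _

variable {D}

namespace Retraction

variable {n : ℕ} {N : D.Retraction n} (F : N.Filling)

/-- The projector onto the loops in degree `n + 1`, along a filling in degree `n`. -/
def succMap {m : ℕ+} : P.cell (n + 1) m →ₗ[K] P.cell (n + 1) m :=
  LinearMap.id - (P.i n).map.comp (P.s n).map + F.map.comp ((P.t n).map - (P.s n).map)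

theorem succMap_apply {m : ℕ+} (a : P.cell (n + 1) m) :
    succMap F a = a - (P.i n).map ((P.s n).map a) + F.map ((P.t n).map a - (P.s n).map a) := rfl

theorem s_succMap {m : ℕ+} (a : P.cell (n + 1) m) : (P.s n).map (succMap F a) = 0 := by
  rw [succMap_apply, map_add, map_sub, P.s_i, F.s_map, sub_self, add_zero]

theorem t_succMap {m : ℕ+} (a : P.cell (n + 1) m) : (P.t n).map (succMap F a) = 0 := by
  rw [succMap_apply, map_add, map_sub, P.t_i, F.t_map, N.map_boundary, add_neg_cancel]

theorem succMap_of_loop {m : ℕ+} (a : P.cell (n + 1) m) (hs : (P.s n).map a = 0)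
    (ht : (P.t n).map a = 0) : succMap F a = a := by
  rw [succMap_apply, hs, ht, map_zero, sub_self, map_zero, sub_zero, add_zero]

theorem succMap_i {m : ℕ+} (a : P.cell n m) : succMap F ((P.i n).map a) = 0 := by
  rw [succMap_apply, P.s_i, P.t_i, sub_self, sub_self, map_zero, add_zero]

/-- Since h(a) goes from 0 to −N(a) and h∘N = h, the two terms cancel. This makes successive
fillings square to zero, as needed for σ to be trivial on its own image. -/
theorem succMap_map {m : ℕ+} (a : P.cell n m) : succMap F (F.map a) = 0 := by
  rw [succMap_apply, F.s_map, F.t_map, map_zero, sub_zero, sub_zero, map_neg, F.map_map,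
    add_neg_cancel]

section comp

variable {r : ℕ+} {p : Fin r → ℕ+} {m : ℕ+} (f : ShuffleSurjection p m)

/-- The root is u − 1_{s(u)} on both sides. For n > 0 it has zero 0-source and 0-target and sees
only the classes of the inputs, which N does not change; for n = 0 the inputs w − N(w) and ŵ
coincide. -/
theorem comp_sub_src_congr (N : D.Retraction n) (u : P.cell (n + 1) r) (w : ∀ j, P.cell n (p j)) :
    ((P.cell (n + 1)).comp f u fun j => (P.i n).map (w j - N.map (w j))) -
        (P.cell (n + 1)).comp f ((P.i n).map ((P.s n).map u))
          (fun j => (P.i n).map (w j - N.map (w j))) =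
      ((P.cell (n + 1)).comp f u fun j => (P.i n).map (D.hat n (w j))) -
        (P.cell (n + 1)).comp f ((P.i n).map ((P.s n).map u))
          (fun j => (P.i n).map (D.hat n (w j))) := by
  cases n with
  | zero => simp only [N.sub_map rfl]
  | succ n =>
    rw [← comp_sub_left, ← comp_sub_left]
    refine D.comp_congr_of_core f _ ?_ ?_ _ _ fun j => ?_
    · rw [map_sub, P.src_i (Nat.zero_le _), P.src_le (Nat.zero_le _) u, sub_self]
    · rw [map_sub, P.tgt_i (Nat.zero_le _), P.tgt_le (Nat.zero_le _) u,
        P.tgt_succ_lt (Nat.succ_pos n), sub_self]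
    · rw [D.bar_i, D.bar_i, map_sub, N.bar_map, sub_zero, D.bar_hat]

/-- For n > 0 the values of h have zero 0-source and 0-target, so `comp_add_sub_congr` applies. For
n = 0 only the source vanishes; the contribution can still be moved to the target of y, whence the
additional hypothesis `h0`. -/
theorem comp_add_map_congr (u : P.cell (n + 1) r) (w' : ∀ j, P.cell n (p j))
    (y y' : ∀ j, P.cell (n + 1) (p j))
    (h : ∀ j, (D.bar (n + 1)).map (y j) = (D.bar (n + 1)).map (y' j))
    (h0 : n = 0 → ∀ j, (P.t n).map (y j) = (P.t n).map (y' j)) :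
    (P.cell (n + 1)).comp f u (fun j => y j + F.map (w' j)) - (P.cell (n + 1)).comp f u y =
      (P.cell (n + 1)).comp f u (fun j => y' j + F.map (w' j)) - (P.cell (n + 1)).comp f u y' := by
  cases n with
  | zero =>
    have key : ∀ y : ∀ j, P.cell 1 (p j),
        (P.cell 1).comp f u (fun j => y j + F.map (w' j)) - (P.cell 1).comp f u y =
        ((P.cell 1).comp f ((P.tgt 1 0).map u) fun j =>
          (P.i 0).map ((P.t 0).map (y j)) + F.map (w' j)) -
        (P.cell 1).comp f ((P.tgt 1 0).map u) fun j => (P.i 0).map ((P.t 0).map (y j)) := by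
      intro y
      have := D.comp_star_right Nat.zero_lt_one f u y
        (fun j => (P.i 0).map ((P.t 0).map (y j)) + F.map (w' j)) fun j => by
          rw [GlobularOperad.Composable, P.tgt_succ_self, P.src_succ_self, map_add, P.s_i, F.s_map,
            add_zero]
      simp only [P.tgt_succ_self (n := 0) (y _)] at this
      have he : (fun j => y j - (P.i 0).map ((P.t 0).map (y j)) +
          ((P.i 0).map ((P.t 0).map (y j)) + F.map (w' j))) = fun j => y j + F.map (w' j) := by
        funext j
        abel
      rw [he] at this
      rw [this]
      abel
    rw [key y, key y']
    simp only [h0 rfl]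
  | succ n =>
    refine D.comp_add_sub_congr f u _ (fun j => ?_) (fun j => ?_) y y' h
    · rw [P.src_le (Nat.zero_le _), F.s_map, map_zero, map_zero]
    · rw [P.tgt_le (Nat.zero_le _), F.t_map, map_neg, N.tgt_map 0 n.succ_pos, neg_zero, map_zero]

/-- The composition law of h is applied to the target and to the source of u∘v. Their difference is
rewritten by exchange, and the remaining discrepancies involve only cells that are insensitive to
representatives. -/
theorem succMap_comp (u : P.cell (n + 1) r) (v : ∀ j, P.cell (n + 1) (p j)) :
    succMap F ((P.cell (n + 1)).comp f u v) =
      succMap F ((P.cell (n + 1)).comp f u fun j => D.hat (n + 1) (v j)) +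
        (P.cell (n + 1)).comp f u v - (P.cell (n + 1)).comp f u fun j => v j - succMap F (v j) := by
  have h1 : (P.cell (n + 1)).comp f u (fun j => v j + F.map ((P.t n).map (v j))) =
      (P.cell (n + 1)).comp f u v -
        (P.cell (n + 1)).comp f ((P.i n).map ((P.t n).map u))
          (fun j => (P.i n).map ((P.t n).map (v j))) +
        (P.cell (n + 1)).comp f ((P.i n).map ((P.t n).map u))
          fun j => (P.i n).map ((P.t n).map (v j)) + F.map ((P.t n).map (v j)) := by
    have := D.comp_star_right n.lt_succ_self f u v
      (fun j => (P.i n).map ((P.t n).map (v j)) + F.map ((P.t n).map (v j))) fun j => by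
        rw [GlobularOperad.Composable, P.tgt_succ_self, P.src_succ_self, map_add, P.s_i, F.s_map,
          add_zero]
    simp only [P.tgt_succ_self] at this
    rw [← this]
    congr 1
    funext j
    abel
  have h2 : (P.cell (n + 1)).comp f u
        (fun j => (P.i n).map ((P.s n).map (v j)) + F.map ((P.s n).map (v j))) =
      (P.cell (n + 1)).comp f ((P.i n).map ((P.s n).map u))
          (fun j => (P.i n).map ((P.s n).map (v j)) + F.map ((P.s n).map (v j))) -
        (P.cell (n + 1)).comp f ((P.i n).map ((P.s n).map u))
          (fun j => (P.i n).map ((P.s n).map (v j) - N.map ((P.s n).map (v j)))) +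
        (P.cell (n + 1)).comp f u
          fun j => (P.i n).map ((P.s n).map (v j) - N.map ((P.s n).map (v j))) := by
    have ht : ∀ j, (P.tgt (n + 1) n).map
        ((P.i n).map ((P.s n).map (v j)) + F.map ((P.s n).map (v j))) =
        (P.i n).map ((P.s n).map (v j) - N.map ((P.s n).map (v j))) := fun j => by
      rw [P.tgt_succ_self, map_add, P.t_i, F.t_map, sub_eq_add_neg]
    have := D.comp_star_left n.lt_succ_self f u
      (fun j => (P.i n).map ((P.s n).map (v j)) + F.map ((P.s n).map (v j)))
      (fun j => (P.i n).map ((P.s n).map (v j) - N.map ((P.s n).map (v j)))) fun j => by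
        rw [GlobularOperad.Composable, ht, P.src_i le_rfl, P.src_ge le_rfl]
    simp only [ht, sub_add_cancel, P.src_succ_self] at this
    exact this
  -- This cancels the terms left when grafting onto u and onto 1_{s(u)} are compared on reduced
  -- sources and on hats.
  have h3 := comp_sub_src_congr f N u fun j => (P.s n).map (v j)
  have h4 := comp_add_map_congr F f u (fun j => (P.t n).map (v j)) v (fun j => v j - succMap F (v j))
    (fun j => by rw [map_sub, D.bar_succ n (succMap F (v j)), s_succMap, map_zero, sub_zero])
    fun _ j => by rw [map_sub, t_succMap, sub_zero]
  -- By definition of the new projector N', the cell v − N'(v) is 1_{s(v)} − h(t(v) − s(v)); adding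
  -- h(t(v)) leaves the source-side expression of `h2`, so `h4` links the two sides.
  have h5 : ∀ j, v j - succMap F (v j) + F.map ((P.t n).map (v j)) =
      (P.i n).map ((P.s n).map (v j)) + F.map ((P.s n).map (v j)) := by
    intro j
    rw [succMap_apply, map_sub F.map]
    abel
  simp only [h5] at h4
  have h6 : succMap F ((P.cell (n + 1)).comp f u v) -
      succMap F ((P.cell (n + 1)).comp f u fun j => D.hat (n + 1) (v j)) =
      (P.cell (n + 1)).comp f u (fun j => v j + F.map ((P.t n).map (v j))) -
      (P.cell (n + 1)).comp f u
        (fun j => (P.i n).map ((P.s n).map (v j)) + F.map ((P.s n).map (v j))) := by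
    rw [succMap_apply, succMap_apply, h1, h2]
    simp only [D.hat_succ]
    simp only [Hom.map_comp, P.s_i, P.t_i]
    rw [map_sub F.map, map_sub F.map, F.map_comp f ((P.t n).map u), F.map_comp f ((P.s n).map u)]
    simp only [D.hat_t]
    rw [Hom.map_comp, Hom.map_comp]
    rw [← sub_eq_zero]
    refine Eq.trans ?_ (sub_eq_zero.2 h3)
    abel
  rw [← sub_eq_zero]
  refine Eq.trans ?_ (congrArg₂ (· + ·) (sub_eq_zero.2 h6) (sub_eq_zero.2 h4) |>.trans (add_zero 0))
  abel

end comp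

/-- The retraction in degree `n + 1` given by a filling in degree `n`. -/
def succ : D.Retraction (n + 1) where
  map := succMap F
  map_map a := succMap_of_loop F _ (s_succMap F a) (t_succMap F a)
  map_hat a := by rw [D.hat_succ, succMap_i]
  map_comp f u v := succMap_comp F f u v
  map_boundary a := by
    refine succMap_of_loop F _ ?_ ?_
    · rw [map_sub, P.s_s, sub_self]
    · rw [map_sub, P.t_t, sub_self]
  exists_filler a := D.acyclic n _ (s_succMap F a) (t_succMap F a)
  tgt_map k hk _ a := by
    rw [P.tgt_le (Nat.le_of_lt_succ hk), t_succMap, map_zero, map_zero]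
  map_src k hk _ a := by rw [P.src_le (Nat.le_of_lt_succ hk), succMap_i]
  sub_map h := absurd h n.succ_ne_zero

end Retraction

variable (D)

/-- The retractions and the fillings in all degrees. -/
noncomputable def stage : ∀ n, Σ N : D.Retraction n, N.Filling
  | 0 => ⟨.zero D, (Retraction.zero D).nonempty_filling.some⟩
  | n + 1 => ⟨.succ (stage n).2, (Retraction.succ (stage n).2).nonempty_filling.some⟩

/-- The contracting homotopy of the cells of `P`. -/
noncomputable def filling (n : ℕ) {m : ℕ+} : P.cell n m →ₗ[K] P.cell (n + 1) m :=
  (D.stage n).2.map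

theorem s_filling (n : ℕ) {m : ℕ+} (a : P.cell n m) : (P.s n).map (D.filling n a) = 0 :=
  (D.stage n).2.s_map a

theorem t_filling_zero {m : ℕ+} (a : P.cell 0 m) :
    (P.t 0).map (D.filling 0 a) = D.hat 0 a - a :=
  ((D.stage 0).2.t_map a).trans (neg_sub _ _)

theorem t_filling_succ (n : ℕ) {m : ℕ+} (a : P.cell (n + 1) m) :
    (P.t (n + 1)).map (D.filling (n + 1) a) =
      -(a - (P.i n).map ((P.s n).map a) + D.filling n ((P.t n).map a - (P.s n).map a)) :=
  (D.stage (n + 1)).2.t_map a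

theorem filling_hat (n : ℕ) {m : ℕ+} (a : P.cell n m) : D.filling n (D.hat n a) = 0 := by
  refine ((D.stage n).2.map_map _).symm.trans ?_
  rw [(D.stage n).1.map_hat, map_zero]

theorem filling_i (n : ℕ) {m : ℕ+} (a : P.cell n m) : D.filling (n + 1) ((P.i n).map a) = 0 := by
  refine ((D.stage (n + 1)).2.map_map _).symm.trans ?_
  exact (congrArg _ (Retraction.succMap_i (D.stage n).2 a)).trans (map_zero _)

theorem filling_filling (n : ℕ) {m : ℕ+} (a : P.cell n m) :
    D.filling (n + 1) (D.filling n a) = 0 := by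
  refine ((D.stage (n + 1)).2.map_map _).symm.trans ?_
  exact (congrArg _ (Retraction.succMap_map (D.stage n).2 a)).trans (map_zero _)

theorem filling_comp (n : ℕ) {r : ℕ+} {p : Fin r → ℕ+} {m : ℕ+} (f : ShuffleSurjection p m)
    (u : P.cell n r) (v : ∀ j, P.cell n (p j)) :
    D.filling n ((P.cell n).comp f u v) =
      D.filling n ((P.cell n).comp f u fun j => D.hat n (v j)) +
        ((P.cell (n + 1)).comp f ((P.i n).map u) fun j => (P.i n).map (v j) + D.filling n (v j)) -
          (P.i n).map ((P.cell n).comp f u v) :=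
  (D.stage n).2.map_comp f u v

end AcyclicData

/-! ### Elementary compositions -/

namespace ShuffleOperad

variable (T : ShuffleOperad K) {k : ℕ+} {p : Fin k → ℕ+} {m : ℕ+} (τ : ShuffleSurjection p m)
  (i : Fin k) (hp : ∀ j, j ≠ i → p j = 1)

/-- A family of maps that preserves the unit preserves the inputs of elementary compositions. -/
theorem map_elemComp_input {T T' : ShuffleOperad K} (F : ∀ {m : ℕ+}, T m → T' m)
    (hF : F T.one = T'.one) (g : T (p i)) (j : Fin k) :
    F (if h : j = i then h ▸ g else hp j h ▸ T.one : T (p j)) =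
      if h : j = i then h ▸ F g else hp j h ▸ T'.one := by
  have key : ∀ {q : ℕ+} (e : q = 1), F (e ▸ T.one : T q) = e ▸ T'.one := by
    rintro q rfl
    exact hF
  split_ifs with h
  · subst h
    rfl
  · exact key (hp j h)

theorem Hom.map_elemComp {T T' : ShuffleOperad K} (φ : Hom T T') (f : T k) (g : T (p i)) :
    φ.map (T.elemComp τ i hp f g) = T'.elemComp τ i hp (φ.map f) (φ.map g) := by
  unfold elemComp
  rw [φ.map_comp]
  congr 1
  exact funext fun j => map_elemComp_input i hp (fun {m} => φ.map (k := m)) φ.map_one g j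

theorem elemComp_sub_left (f f' : T k) (g : T (p i)) :
    T.elemComp τ i hp (f - f') g = T.elemComp τ i hp f g - T.elemComp τ i hp f' g :=
  T.comp_sub_left τ f f' _

theorem elemComp_zero_left (g : T (p i)) : T.elemComp τ i hp 0 g = 0 := T.comp_zero_left τ _

theorem elemComp_eq_update (f : T k) (g : T (p i)) :
    T.elemComp τ i hp f g = T.comp τ f
      (Function.update (fun j => if h : j = i then 0 else hp j h ▸ T.one) i g) := by
  unfold elemComp
  congr 1
  funext j
  rcases eq_or_ne j i with rfl | h
  · simp
  · rw [Function.update_of_ne h]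
    simp [h]

theorem elemComp_add_right (f : T k) (g g' : T (p i)) :
    T.elemComp τ i hp f (g + g') = T.elemComp τ i hp f g + T.elemComp τ i hp f g' := by
  simp only [elemComp_eq_update, MultilinearMap.map_update_add]

theorem elemComp_sub_right (f : T k) (g g' : T (p i)) :
    T.elemComp τ i hp f (g - g') = T.elemComp τ i hp f g - T.elemComp τ i hp f g' := by
  simp only [elemComp_eq_update, MultilinearMap.map_update_sub]

theorem elemComp_zero_right (f : T k) : T.elemComp τ i hp f 0 = 0 := by
  simp only [elemComp_eq_update, MultilinearMap.map_update_zero]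

end ShuffleOperad

/-! ### Iterated ⋆-composites in linear form -/

namespace GlobularOperad

variable (P : GlobularOperad K) {n : ℕ} {m : ℕ+}

/-- The iterated composite of `OmegaOperad.starRight`, for the composition `a - tₖ(a) + b`. -/
def starRight (a : P.cell n m) (e : ℕ → P.cell n m) : ℕ → P.cell n m
  | 0 => a
  | k + 1 => starRight a e k - (P.tgt n k).map (starRight a e k) + e k

/-- The iterated composite of `OmegaOperad.starLeft`, for the composition `a - tₖ(a) + b`. -/
def starLeft (e : ℕ → P.cell n m) (a : P.cell n m) : ℕ → P.cell n m
  | 0 => a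
  | k + 1 => e k - (P.tgt n k).map (e k) + starLeft e a k

theorem tgt_starRight {l k : ℕ} (hk : k ≤ l) (a : P.cell n m) (e : ℕ → P.cell n m)
    (ha : (P.tgt n l).map a = a) (he : ∀ j < k, (P.tgt n l).map (e j) = e j) :
    (P.tgt n l).map (P.starRight a e k) = P.starRight a e k := by
  induction k with
  | zero => exact ha
  | succ k ih =>
    rw [starRight, map_add, map_sub, P.tgt_id_tgt (Nat.le_of_succ_le hk), he k k.lt_succ_self,
      ih (Nat.le_of_succ_le hk) fun j hj => he j (hj.trans k.lt_succ_self)]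

/-- Each step adds a term depending on the first argument only through a k-target, and by induction
a difference with zero k-target is preserved. -/
theorem starRight_sub_starRight (a b : P.cell n m) (e : ℕ → P.cell n m) (k : ℕ)
    (h : ∀ j < k, (P.tgt n j).map a = (P.tgt n j).map b) :
    P.starRight a e k - P.starRight b e k = a - b := by
  induction k with
  | zero => rfl
  | succ k ih =>
    have ih' := ih fun j hj => h j (hj.trans k.lt_succ_self)
    have h' := congrArg (P.tgt n k).map ih'
    rw [map_sub, map_sub, h k k.lt_succ_self, sub_self] at h'
    rw [starRight, starRight, sub_eq_zero.1 h', add_sub_add_right_eq_sub, sub_sub_sub_cancel_right,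
      ih']

end GlobularOperad

/-! ### The contraction obtained by summing the fillings -/

namespace AcyclicData

variable {P : GlobularOperad K} {B : ShuffleOperad K} (D : AcyclicData P B)

/-- The sum of the contracting homotopies of the iterated targets of a cell. -/
noncomputable def totalFilling : ∀ (n : ℕ) {m : ℕ+}, P.cell n m →ₗ[K] P.cell (n + 1) m
  | 0, _ => D.filling 0
  | n + 1, _ => (P.i (n + 1)).map ∘ₗ totalFilling n ∘ₗ (P.t n).map + D.filling (n + 1)

/-- The underlying map of a right contraction. -/
noncomputable def contract (n : ℕ) {m : ℕ+} : P.cell n m →ₗ[K] P.cell (n + 1) m :=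
  (P.i n).map + D.totalFilling n

theorem contract_apply (n : ℕ) {m : ℕ+} (a : P.cell n m) :
    D.contract n a = (P.i n).map a + D.totalFilling n a := rfl

theorem totalFilling_zero {m : ℕ+} (a : P.cell 0 m) : D.totalFilling 0 a = D.filling 0 a := rfl

theorem totalFilling_succ (n : ℕ) {m : ℕ+} (a : P.cell (n + 1) m) :
    D.totalFilling (n + 1) a =
      (P.i (n + 1)).map (D.totalFilling n ((P.t n).map a)) + D.filling (n + 1) a := rfl

theorem totalFilling_i (n : ℕ) {m : ℕ+} (a : P.cell n m) :
    D.totalFilling (n + 1) ((P.i n).map a) = (P.i (n + 1)).map (D.totalFilling n a) := by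
  rw [totalFilling_succ, P.t_i, filling_i, add_zero]

theorem contract_i (n : ℕ) {m : ℕ+} (a : P.cell n m) :
    D.contract (n + 1) ((P.i n).map a) = (P.i (n + 1)).map (D.contract n a) := by
  rw [contract_apply, totalFilling_i, contract_apply, map_add]

theorem s_totalFilling_zero {m : ℕ+} (a : P.cell 0 m) :
    (P.s 0).map (D.totalFilling 0 a) = 0 := D.s_filling 0 a

theorem s_totalFilling_succ (n : ℕ) {m : ℕ+} (a : P.cell (n + 1) m) :
    (P.s (n + 1)).map (D.totalFilling (n + 1) a) = D.totalFilling n ((P.t n).map a) := by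
  rw [totalFilling_succ, map_add, s_filling, P.s_i, add_zero]

/-- The source and the target of a have the same lower targets, so their total fillings differ only
in the top layer. -/
theorem totalFilling_t (n : ℕ) {m : ℕ+} (a : P.cell (n + 1) m) :
    D.totalFilling n ((P.t n).map a) = D.totalFilling n ((P.s n).map a) +
      D.filling n ((P.t n).map a - (P.s n).map a) := by
  cases n with
  | zero => rw [totalFilling_zero, totalFilling_zero, map_sub, add_sub_cancel]
  | succ n =>
    rw [totalFilling_succ, totalFilling_succ, P.t_t, map_sub]
    abel

theorem t_contract_zero {m : ℕ+} (a : P.cell 0 m) :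
    (P.t 0).map (D.contract 0 a) = D.hat 0 a := by
  rw [contract_apply, map_add, P.t_i, totalFilling_zero, t_filling_zero, add_sub_cancel]

/-- The term h(t(a) − s(a)) in the target of the top filling is exactly what converts the total
filling of t(a) into that of s(a). -/
theorem t_contract_succ (n : ℕ) {m : ℕ+} (a : P.cell (n + 1) m) :
    (P.t (n + 1)).map (D.contract (n + 1) a) = D.contract n ((P.s n).map a) := by
  rw [contract_apply, map_add, P.t_i, totalFilling_succ, map_add, P.t_i, t_filling_succ,
    totalFilling_t, contract_apply]
  abel

theorem tgt_succ_contract {n k : ℕ} (hk : k < n) {m : ℕ+} (a : P.cell n m) :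
    (P.tgt (n + 1) (k + 1)).map (D.contract n a) = D.contract n ((P.src n k).map a) := by
  induction n with
  | zero => omega
  | succ n ih =>
    rw [P.tgt_le (by omega), t_contract_succ, P.src_le (by omega), contract_i]
    rcases (Nat.lt_succ_iff.1 hk).lt_or_eq with hk' | rfl
    · rw [ih hk']
    · rw [P.tgt_ge le_rfl, P.src_ge le_rfl]

theorem tgt_zero_contract (n : ℕ) {m : ℕ+} (a : P.cell n m) :
    (P.tgt (n + 1) 0).map (D.contract n a) = (P.i n).map (D.hat n a) := by
  induction n with
  | zero => rw [P.tgt_succ_self, t_contract_zero]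
  | succ n ih => rw [P.tgt_le (Nat.zero_le _), t_contract_succ, ih, D.hat_succ]

theorem tgt_contract_src {n k : ℕ} (hk : k ≤ n) {m : ℕ+} (a : P.cell n m) :
    (P.tgt (n + 1) k).map (D.contract n ((P.src n k).map a)) =
      (P.tgt (n + 1) k).map (D.contract n a) := by
  cases k with
  | zero => rw [tgt_zero_contract, tgt_zero_contract, D.hat_congr (D.bar_src n 0 a)]
  | succ k =>
    rw [D.tgt_succ_contract hk, D.tgt_succ_contract hk, P.src_src k.le_succ]

theorem tgt_succ_contract_tgt {n j k : ℕ} (hj : j ≤ k) (hk : k < n) {m : ℕ+} (a : P.cell n m) :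
    (P.tgt (n + 1) (k + 1)).map (D.contract n ((P.tgt n j).map a)) =
      D.contract n ((P.tgt n j).map a) := by
  rw [D.tgt_succ_contract hk, P.src_id_tgt hj]

/-- The product telescopes: the next composition subtracts a k-target that contains the accumulated
total filling, then adds the total filling of the following iterated target. -/
theorem starRight_contract {n k : ℕ} (hk : k < n) {m : ℕ+} (a : P.cell n m) :
    P.starRight ((P.i n).map a) (fun j => D.contract n ((P.tgt n j).map a)) (k + 1) =
      (P.i n).map a + D.totalFilling n ((P.tgt n k).map a) := by
  induction k with
  | zero =>
    simp only [GlobularOperad.starRight]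
    rw [P.tgt_i (Nat.zero_le _), contract_apply]
    abel
  | succ k ih =>
    have h := D.tgt_succ_contract_tgt le_rfl (Nat.lt_of_succ_lt hk) a
    rw [contract_apply, map_add, P.tgt_i hk.le, P.tgt_id_tgt k.le_succ, add_right_inj] at h
    rw [GlobularOperad.starRight, ih (Nat.lt_of_succ_lt hk), map_add, h, P.tgt_i hk.le,
      contract_apply]
    abel

/-- Each factor σ(sₖ(a)) has the k-target tₖ(σ_a) already accumulated, so composing returns that
factor, which is tₖ₊₁(σ_a). -/
theorem starLeft_contract {n k : ℕ} (hk : k ≤ n) {m : ℕ+} (a : P.cell n m) :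
    P.starLeft (fun j => D.contract n ((P.src n j).map a)) ((P.i n).map (D.hat n a)) k =
      (P.tgt (n + 1) k).map (D.contract n a) := by
  induction k with
  | zero => exact (D.tgt_zero_contract n a).symm
  | succ k ih =>
    rw [GlobularOperad.starLeft, ih (Nat.le_of_succ_le hk), D.tgt_contract_src (Nat.le_of_succ_le hk),
      sub_add_cancel, D.tgt_succ_contract hk]

theorem src_contract (n : ℕ) {m : ℕ+} (a : P.cell n m) :
    (P.src (n + 1) n).map (D.contract n a) =
      P.starRight ((P.i n).map a) (fun j => D.contract n ((P.tgt n j).map a)) n := by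
  rw [P.src_succ_self, contract_apply, map_add, P.s_i]
  cases n with
  | zero => rw [s_totalFilling_zero, add_zero]; rfl
  | succ n =>
    rw [s_totalFilling_succ, map_add, D.starRight_contract n.lt_succ_self, P.tgt_succ_self,
      totalFilling_i]

/-- `R` is fixed by tₖ₊₁ and therefore drops out of the outer composite, while `L` equals tₖ(σ_a).
What survives is σ_a − σ(sₖ(b)) + σ_b, and sₖ(b) = tₖ(a), so the axiom reduces to linearity of σ. -/
theorem contract_star {n k : ℕ} (hk : k < n) {m : ℕ+} (a b : P.cell n m)
    (h : P.Composable k a b) {R A L : P.cell (n + 1) m}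
    (hR : R = P.starRight ((P.i n).map ((P.src n (k + 1)).map a))
      (fun j => D.contract n ((P.tgt n j).map b)) k)
    (hA : A = R - (P.tgt (n + 1) k).map R + D.contract n b)
    (hL : L = P.starLeft (fun j => D.contract n ((P.src n j).map a))
      ((P.i n).map (D.hat n ((P.tgt n (k + 1)).map b))) k) :
    D.contract n (a - (P.tgt n k).map a + b) = A - (P.tgt (n + 1) (k + 1)).map A +
      (D.contract n a - (P.tgt (n + 1) k).map (D.contract n a) + L) := by
  have hab : D.hat n ((P.tgt n (k + 1)).map b) = D.hat n a := by
    refine D.hat_congr ?_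
    rw [D.bar_tgt, ← D.bar_tgt n k a, h, D.bar_src]
  have hR' : (P.tgt (n + 1) (k + 1)).map R = R := by
    rw [hR]
    refine P.tgt_starRight k.le_succ _ _ ?_ fun j hj => ?_
    · rw [P.tgt_i hk, P.tgt_id_src le_rfl]
    · exact D.tgt_succ_contract_tgt hj.le hk b
  have hL' : L = (P.tgt (n + 1) k).map (D.contract n a) := by
    rw [hL, hab, D.starLeft_contract hk.le]
  rw [hL', hA, map_add (P.tgt (n + 1) (k + 1)).map, map_sub (P.tgt (n + 1) (k + 1)).map, hR',
    P.tgt_id_tgt k.le_succ, D.tgt_succ_contract hk, ← h, map_add, map_sub]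
  abel

theorem totalFilling_sec (n : ℕ) {m : ℕ+} (b : B m) : D.totalFilling n (D.sec n b) = 0 := by
  induction n with
  | zero =>
    have h : D.sec 0 b = D.hat 0 (D.sec 0 b) := (congrArg (D.sec 0) (D.bar_sec 0 b)).symm
    rw [h, totalFilling_zero, filling_hat]
  | succ n ih => rw [D.sec_succ, totalFilling_i, ih, map_zero]

theorem contract_sec (n : ℕ) {m : ℕ+} (b : B m) :
    D.contract n (D.sec n b) = (P.i n).map (D.sec n b) := by
  rw [contract_apply, totalFilling_sec, add_zero]

theorem filling_totalFilling (n : ℕ) {m : ℕ+} (a : P.cell n m) :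
    D.filling (n + 1) (D.totalFilling n a) = 0 := by
  cases n with
  | zero => exact D.filling_filling 0 a
  | succ n => rw [totalFilling_succ, map_add, filling_i, filling_filling, add_zero]

theorem filling_contract (n : ℕ) {m : ℕ+} (a : P.cell n m) :
    D.filling (n + 1) (D.contract n a) = 0 := by
  rw [contract_apply, map_add, filling_i, filling_totalFilling, add_zero]

/-- The target of σ_a is σ(s(a)), or â in degree 0, so induction leaves only the top filling of σ_a;
this vanishes since fillings kill identities and earlier fillings. -/
theorem contract_contract (n : ℕ) {m : ℕ+} (a : P.cell n m) :
    D.contract (n + 1) (D.contract n a) = (P.i (n + 1)).map (D.contract n a) := by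
  have h : D.totalFilling (n + 1) (D.contract n a) = 0 := by
    induction n with
    | zero =>
      rw [totalFilling_succ, t_contract_zero, totalFilling_zero, filling_hat, map_zero,
        filling_contract, add_zero]
    | succ n ih =>
      rw [totalFilling_succ, t_contract_succ, ih, map_zero, filling_contract, add_zero]
  rw [contract_apply, h, add_zero]

end AcyclicData

/-! ### The right contraction identity -/

namespace AcyclicData

variable {P : GlobularOperad K} {B : ShuffleOperad K} (D : AcyclicData P B)
  {k : ℕ+} {p : Fin k → ℕ+} {m : ℕ+} (τ : ShuffleSurjection p m)
  (i : Fin k) (hp : ∀ j, j ≠ i → p j = 1)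

/-- Decompose g as g ⋆₀ t₀(g): the terms grafted onto s₀(u) vanish, and the unit inputs are fixed by
t₀. -/
theorem elemComp_tgt_right (D : AcyclicData P B) {n : ℕ} (u : P.cell (n + 1) k)
    (hu : (P.src (n + 1) 0).map u = 0) (g : P.cell (n + 1) (p i)) :
    (P.cell (n + 1)).elemComp τ i hp u g =
      (P.cell (n + 1)).elemComp τ i hp u ((P.tgt (n + 1) 0).map g) := by
  have h := D.comp_star_left n.succ_pos τ u
    (fun j => if h : j = i then h ▸ g else hp j h ▸ (P.cell (n + 1)).one)
    (fun j => (P.tgt (n + 1) 0).map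
      (if h : j = i then h ▸ g else hp j h ▸ (P.cell (n + 1)).one))
    fun j => (P.src_id_tgt le_rfl _).symm
  simp only [sub_add_cancel, hu, comp_zero_left, sub_self, zero_add] at h
  refine h.trans ?_
  unfold elemComp
  congr 1
  exact funext fun j => map_elemComp_input i hp
    (fun {m} => ((P.tgt (n + 1) 0).map (k := m))) (P.tgt (n + 1) 0).map_one g j

/-- Decompose y as s₀(y) ⋆₀ y: the terms with s₀(y) at input i vanish by multilinearity. -/
theorem elemComp_src_right (D : AcyclicData P B) {n : ℕ} (u : P.cell (n + 1) k)
    (y : P.cell (n + 1) (p i)) (hy : (P.src (n + 1) 0).map y = 0) :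
    (P.cell (n + 1)).elemComp τ i hp u y =
      (P.cell (n + 1)).elemComp τ i hp ((P.tgt (n + 1) 0).map u) y := by
  have h := D.comp_star_right n.succ_pos τ u
    (fun j => (P.src (n + 1) 0).map
      (if h : j = i then h ▸ y else hp j h ▸ (P.cell (n + 1)).one))
    (fun j => if h : j = i then h ▸ y else hp j h ▸ (P.cell (n + 1)).one)
    fun j => P.tgt_id_src le_rfl _
  simp only [P.tgt_id_src le_rfl, sub_self, zero_add] at h
  have h' : (fun j => (P.src (n + 1) 0).map
      (if h : j = i then h ▸ y else hp j h ▸ (P.cell (n + 1)).one)) =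
      fun j => if h : j = i then h ▸ (0 : P.cell (n + 1) (p i)) else
        hp j h ▸ (P.cell (n + 1)).one := by
    funext j
    rw [← hy]
    exact map_elemComp_input i hp
      (fun {m} => ((P.src (n + 1) 0).map (k := m))) (P.src (n + 1) 0).map_one y j
  rw [h'] at h
  have h0 := fun u : P.cell (n + 1) k => (P.cell (n + 1)).elemComp_zero_right τ i hp u
  unfold elemComp at h0 ⊢
  rw [h0, h0, sub_zero, zero_add] at h
  exact h

theorem elemComp_congr_of_core {n : ℕ} (u : P.cell (n + 1) k)
    (hs : (P.src (n + 1) 0).map u = 0) (ht : (P.tgt (n + 1) 0).map u = 0)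
    (g g' : P.cell (n + 1) (p i)) (h : (D.bar (n + 1)).map g = (D.bar (n + 1)).map g') :
    (P.cell (n + 1)).elemComp τ i hp u g = (P.cell (n + 1)).elemComp τ i hp u g' := by
  refine D.comp_congr_of_core τ u hs ht _ _ fun j => ?_
  have key := fun g => map_elemComp_input i hp
    (fun {m} => ((D.bar (n + 1)).map (k := m))) (D.bar (n + 1)).map_one g j
  exact (key g).trans ((congrArg (fun b : B (p i) =>
    (if h : j = i then h ▸ b else hp j h ▸ B.one : B (p j))) h).trans (key g').symm)

theorem filling_one (n : ℕ) : D.filling n (P.cell n).one = 0 := by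
  rw [← D.hat_one, filling_hat]

theorem filling_elemComp (n : ℕ) (f : P.cell n k) (g : P.cell n (p i)) :
    D.filling n ((P.cell n).elemComp τ i hp f g) =
      D.filling n ((P.cell n).elemComp τ i hp f (D.hat n g)) +
        (P.cell (n + 1)).elemComp τ i hp ((P.i n).map f) ((P.i n).map g + D.filling n g) -
          (P.i n).map ((P.cell n).elemComp τ i hp f g) := by
  have h1 : (fun j => D.hat n
      (if h : j = i then h ▸ g else hp j h ▸ (P.cell n).one : P.cell n (p j))) =
      fun j => if h : j = i then h ▸ D.hat n g else hp j h ▸ (P.cell n).one :=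
    funext fun j => map_elemComp_input i hp (fun {m} => D.hat n (m := m)) (D.hat_one n) g j
  have h2 : (fun j =>
      (P.i n).map (if h : j = i then h ▸ g else hp j h ▸ (P.cell n).one : P.cell n (p j)) +
      D.filling n (if h : j = i then h ▸ g else hp j h ▸ (P.cell n).one : P.cell n (p j))) =
      fun j => if h : j = i then h ▸ ((P.i n).map g + D.filling n g) else
        hp j h ▸ (P.cell (n + 1)).one :=
    funext fun j => map_elemComp_input i hp
      (fun {m} (a : P.cell n m) => (P.i n).map a + D.filling n a)
      (by rw [filling_one, add_zero, Hom.map_one]) g j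
  have h := D.filling_comp n τ f
    (fun j => if h : j = i then h ▸ g else hp j h ▸ (P.cell n).one)
  rw [h1, h2] at h
  exact h

/-- In positive degree the target of a filling is, up to sign, a loop, so its 0-target is zero. The
degree-0 fillings do not have this property, hence the shift in the indices. -/
theorem tgt_zero_filling (n : ℕ) {m : ℕ+} (a : P.cell (n + 1) m) :
    (P.tgt (n + 2) 0).map (D.filling (n + 1) a) = 0 := by
  rw [P.tgt_le (Nat.zero_le _), t_filling_succ]
  have h : (P.tgt (n + 1) 0).map (a - (P.i n).map ((P.s n).map a) +
      D.filling n ((P.t n).map a - (P.s n).map a)) = 0 := by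
    induction n with
    | zero =>
      rw [P.tgt_succ_self, map_add, map_sub, P.t_i, t_filling_zero, map_sub, D.hat_t]
      rw [sub_self, zero_sub, neg_sub, sub_add_sub_cancel, sub_self, map_zero]
    | succ n ih =>
      have h1 := ih ((P.t (n + 1)).map a - (P.s (n + 1)).map a)
      have h2 : (P.s n).map ((P.t (n + 1)).map a - (P.s (n + 1)).map a) = 0 := by
        rw [map_sub, P.s_s, sub_self]
      have h3 : (P.t n).map ((P.t (n + 1)).map a - (P.s (n + 1)).map a) = 0 := by
        rw [map_sub, P.t_t, sub_self]
      rw [h2, h3, sub_self, map_zero, map_zero, sub_zero, add_zero] at h1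
      rw [map_add, P.tgt_le (Nat.zero_le _) (D.filling _ _), t_filling_succ, h2, h3, sub_self,
        map_zero, map_zero, sub_zero, add_zero, map_neg, h1, neg_zero, map_zero, add_zero,
        map_sub, P.tgt_i (Nat.zero_le _), P.tgt_le (Nat.zero_le _) a,
        P.tgt_succ_lt n.succ_pos, sub_self]
  rw [map_neg, h, neg_zero, map_zero]

/-- This reconciles the defect term one dimension lower, at t(f) and t(g), with the one produced by
the top filling. For n = 0 it compares the two ways of composing f − s₀(f) with h(t(g)); for n > 0
the cell f − 1_{t(f)} has trivial 0-boundary and cannot distinguish t₀(g) from ĝ. -/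
theorem totalFilling_elemComp_step (n : ℕ) (f : P.cell (n + 1) k) (g : P.cell (n + 1) (p i)) :
    (P.cell (n + 1)).elemComp τ i hp ((P.i n).map ((P.src n 0).map ((P.t n).map f)))
        (D.totalFilling n ((P.t n).map g)) +
      (P.i n).map ((P.cell n).elemComp τ i hp
        ((P.src n 0).map ((P.t n).map f) - (P.t n).map f)
        ((P.t n).map g - D.hat n ((P.t n).map g))) +
      (P.cell (n + 1)).elemComp τ i hp (f - (P.src (n + 1) 0).map f) ((P.tgt (n + 1) 0).map g) =
    (P.cell (n + 1)).elemComp τ i hp ((P.src (n + 1) 0).map f) (D.totalFilling n ((P.t n).map g)) +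
      (P.cell (n + 1)).elemComp τ i hp (f - (P.src (n + 1) 0).map f) (D.hat (n + 1) g) := by
  have hs : (P.src (n + 1) 0).map (f - (P.src (n + 1) 0).map f) = 0 := by
    rw [map_sub, P.src_src le_rfl, sub_self]
  cases n with
  | zero =>
    have h1 := D.elemComp_tgt_right τ i hp _ hs (D.filling 0 ((P.t 0).map g))
    have h2 := D.elemComp_src_right τ i hp (f - (P.src 1 0).map f) (D.filling 0 ((P.t 0).map g))
      (by rw [P.src_succ_self, s_filling, map_zero])
    rw [h2, map_sub, P.tgt_id_src le_rfl, P.tgt_succ_self, P.tgt_succ_self, t_filling_zero, map_sub,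
      D.hat_t, ← D.hat_succ, ← P.tgt_succ_self g, elemComp_sub_right, elemComp_sub_left] at h1
    rw [P.src_ge le_rfl, sub_self, elemComp_zero_left, map_zero, add_zero, totalFilling_zero,
      eq_add_of_sub_eq h1]
    abel
  | succ n =>
    have hf : (P.i (n + 1)).map ((P.src (n + 1) 0).map ((P.t (n + 1)).map f)) =
        (P.src (n + 2) 0).map f := by
      rw [← P.src_succ_lt n.succ_pos f, ← P.src_le (Nat.zero_le _) f]
    have hg : (P.i (n + 1)).map (D.hat (n + 1) ((P.t (n + 1)).map g)) = D.hat (n + 2) g := by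
      rw [D.hat_succ (n + 1), D.hat_t]
    have h1 := D.elemComp_tgt_right τ i hp
      ((P.src (n + 2) 0).map f - (P.i (n + 1)).map ((P.t (n + 1)).map f)) (by
        rw [map_sub, P.src_src le_rfl, P.src_i (Nat.zero_le _), hf, sub_self])
      ((P.i (n + 1)).map ((P.t (n + 1)).map g))
    have h2 := D.elemComp_congr_of_core τ i hp (f - (P.i (n + 1)).map ((P.t (n + 1)).map f))
      (by rw [map_sub, P.src_i (Nat.zero_le _), hf, sub_self])
      (by rw [map_sub, P.tgt_i (Nat.zero_le _), P.tgt_le (Nat.zero_le _) f, sub_self])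
      ((P.tgt (n + 2) 0).map g) (D.hat (n + 2) g) (by rw [D.bar_tgt, D.bar_hat])
    rw [P.tgt_i (Nat.zero_le _), ← P.tgt_le (Nat.zero_le _) g] at h1
    rw [Hom.map_elemComp, map_sub, map_sub, hf, hg, elemComp_sub_right, h1]
    simp only [elemComp_sub_left] at h2 ⊢
    rw [eq_add_of_sub_eq h2]
    abel

/-- The law of h grafts onto 1_f, whereas a right contraction grafts onto s₀(f); the last term is
the price of the replacement. In the inductive step f − s₀(f) has zero 0-source, so it sees only the
0-target of 1_g + h(g), from which h(g) disappears. -/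
theorem totalFilling_elemComp (n : ℕ) (f : P.cell n k) (g : P.cell n (p i)) :
    D.totalFilling n ((P.cell n).elemComp τ i hp f g) =
      D.totalFilling n ((P.cell n).elemComp τ i hp f (D.hat n g)) +
        (P.cell (n + 1)).elemComp τ i hp ((P.i n).map ((P.src n 0).map f)) (D.totalFilling n g) +
          (P.i n).map ((P.cell n).elemComp τ i hp ((P.src n 0).map f - f) (g - D.hat n g)) := by
  induction n with
  | zero =>
    have hf : (P.src 0 0).map f = f := P.src_ge le_rfl f
    rw [hf, sub_self, elemComp_zero_left, map_zero, add_zero, totalFilling_zero,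
      totalFilling_zero, totalFilling_zero, filling_elemComp, elemComp_add_right,
      Hom.map_elemComp]
    abel
  | succ n ih =>
    have htgt : (P.tgt (n + 2) 0).map ((P.i (n + 1)).map g + D.filling (n + 1) g) =
        (P.i (n + 1)).map ((P.tgt (n + 1) 0).map g) := by
      rw [map_add, tgt_zero_filling, add_zero, P.tgt_i (Nat.zero_le _)]
    have hcore := D.elemComp_tgt_right τ i hp
      ((P.i (n + 1)).map (f - (P.src (n + 1) 0).map f)) (by
        rw [P.src_i (Nat.zero_le _), map_sub, P.src_src le_rfl, sub_self, map_zero])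
      ((P.i (n + 1)).map g + D.filling (n + 1) g)
    rw [htgt, ← Hom.map_elemComp, map_sub, elemComp_sub_left] at hcore
    have hhat : (P.t n).map (D.hat (n + 1) g) = D.hat n ((P.t n).map g) := by
      rw [D.hat_succ, P.t_i, D.hat_t]
    have hstep := congrArg (P.i (n + 1)).map (D.totalFilling_elemComp_step τ i hp n f g)
    rw [map_add, map_add, map_add, Hom.map_elemComp _ _ _ _ ((P.src (n + 1) 0).map f)] at hstep
    rw [totalFilling_succ, totalFilling_succ, totalFilling_succ, filling_elemComp, Hom.map_elemComp,
      Hom.map_elemComp _ _ _ _ _ (D.hat _ _), hhat, ih, map_add, map_add, eq_add_of_sub_eq hcore]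
    have e1 := (Hom.map_elemComp τ i hp (P.i (n + 1)) ((P.src (n + 1) 0).map f) g).symm
    simp only [elemComp_add_right, elemComp_sub_right, elemComp_sub_left, map_sub]
      at hstep e1 ⊢
    rw [← sub_eq_zero] at hstep e1 ⊢
    rw [← add_zero (0 : P.cell (n + 2) m)]
    nth_rewrite 1 [← hstep]
    rw [← e1]
    abel

/-- The defect (s₀(f) − f)∘(g − ĝ) exactly offsets the identities 1_{f∘g}, 1_{f∘ĝ}, the identity
part of x and its 0-target s₀(f)∘ĝ. -/
theorem contract_elemComp (n : ℕ) (f : P.cell n k) (g : P.cell n (p i))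
    {x : P.cell (n + 1) m} (hx : x = (P.cell (n + 1)).elemComp τ i hp
      ((P.i n).map ((P.src n 0).map f)) (D.contract n g)) :
    D.contract n ((P.cell n).elemComp τ i hp f g) =
      x - (P.tgt (n + 1) 0).map x +
        D.contract n ((P.cell n).elemComp τ i hp f (D.hat n g)) := by
  have hx' : (P.tgt (n + 1) 0).map x =
      (P.i n).map ((P.cell n).elemComp τ i hp ((P.src n 0).map f) (D.hat n g)) := by
    rw [hx, Hom.map_elemComp, Hom.map_elemComp, tgt_zero_contract, P.tgt_i (Nat.zero_le _),
      P.tgt_id_src le_rfl]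
  rw [hx', hx, contract_apply, contract_apply, contract_apply, totalFilling_elemComp,
    elemComp_add_right, ← Hom.map_elemComp]
  simp only [elemComp_sub_right, elemComp_sub_left, map_sub]
  abel

end AcyclicData

/-! ### From a homotopy back to acyclicity -/

namespace GlobularOperad

variable (P : GlobularOperad K) {n : ℕ} {m : ℕ+}

theorem starRight_congr (a : P.cell n m) {e e' : ℕ → P.cell n m} {k : ℕ}
    (h : ∀ j < k, e j = e' j) : P.starRight a e k = P.starRight a e' k := by
  induction k with
  | zero => rfl
  | succ k ih =>
    rw [starRight, starRight, ih fun j hj => h j (hj.trans k.lt_succ_self), h k k.lt_succ_self]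

theorem starLeft_congr (a : P.cell n m) {e e' : ℕ → P.cell n m} {k : ℕ}
    (h : ∀ j < k, e j = e' j) : P.starLeft e a k = P.starLeft e' a k := by
  induction k with
  | zero => rfl
  | succ k ih =>
    rw [starLeft, starLeft, ih fun j hj => h j (hj.trans k.lt_succ_self), h k k.lt_succ_self]

/-- Parallel cells are connected by a cell if they are contracted to the same cell. -/
theorem exists_cell_of_homotopy (σ : P.cell n m → P.cell (n + 1) m) (f g c : P.cell n m)
    (h : ∀ j < n, (P.src n j).map f = (P.src n j).map g ∧ (P.tgt n j).map f = (P.tgt n j).map g)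
    (hsf : (P.src (n + 1) n).map (σ f) =
      P.starRight ((P.i n).map f) (fun j => σ ((P.tgt n j).map f)) n)
    (hsg : (P.src (n + 1) n).map (σ g) =
      P.starRight ((P.i n).map g) (fun j => σ ((P.tgt n j).map g)) n)
    (htf : (P.tgt (n + 1) n).map (σ f) =
      P.starLeft (fun j => σ ((P.src n j).map f)) ((P.i n).map c) n)
    (htg : (P.tgt (n + 1) n).map (σ g) =
      P.starLeft (fun j => σ ((P.src n j).map g)) ((P.i n).map c) n) :
    ∃ A, (P.s n).map A = f ∧ (P.t n).map A = g := by
  have hs : (P.src (n + 1) n).map (σ f) - (P.src (n + 1) n).map (σ g) =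
      (P.i n).map f - (P.i n).map g := by
    rw [hsf, hsg, P.starRight_congr ((P.i n).map g) fun j hj => congrArg σ (h j hj).2.symm]
    refine P.starRight_sub_starRight _ _ _ _ fun j hj => ?_
    rw [P.tgt_i hj.le, P.tgt_i hj.le, (h j hj).2]
  have ht : (P.tgt (n + 1) n).map (σ f) = (P.tgt (n + 1) n).map (σ g) := by
    rw [htf, htg, P.starLeft_congr _ fun j hj => congrArg σ (h j hj).1]
  rw [src_succ_self, src_succ_self] at hs
  rw [tgt_succ_self, tgt_succ_self] at ht
  have hs' := congrArg (P.s n).map hs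
  have ht' := congrArg (P.t n).map ht
  rw [map_sub, map_sub] at hs'
  simp only [P.s_i] at hs'
  simp only [P.t_i] at ht'
  -- The two normalized cells have zero source and targets t(σ_f) − s(σ_f) and t(σ_g) − s(σ_g). As
  -- the targets of σ_f and σ_g agree and their sources differ by f − g, the total target is f − (f
  -- − g) = g.
  refine ⟨(P.i n).map f + (σ f - (P.i n).map ((P.s n).map (σ f))) -
    (σ g - (P.i n).map ((P.s n).map (σ g))), ?_, ?_⟩
  · simp only [map_add, map_sub, P.s_i, sub_self, add_zero, sub_zero]
  · simp only [map_add, map_sub, P.t_i]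
    rw [ht', sub_eq_iff_eq_add.1 hs']
    abel

end GlobularOperad

/-! ### The free ω-operad of a polygraph as an instance -/

/-- The stages of a polygraph are free extensions only up to a propositional equality; generalizing
over `S'` allows that equality to be substituted. -/
theorem NOperad.exists_hom_top_of_eq {n : ℕ} {S : NOperad K n} {E : CellExt S}
    {S' : NOperad K (n + 1)} (h : S' = E.freeExtension) {Q : ShuffleOperad K}
    (R : OperadRel Q S'.top) (I : Hom S.top Q)
    (hI : ∀ {k : ℕ+} (a : S.top k), R.rel (I.map a) ((idOfEq h).map a))
    (hR : ∀ {k : ℕ+} (a : S'.top k), ∃ U, R.rel U a)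
    (hex : ∀ {k : ℕ}, k ≤ n → ∀ {r : ℕ+} {p : Fin r → ℕ+} {m : ℕ+} (f : ShuffleSurjection p m)
      (A B : Q r) (a b : S'.top r) (V W : ∀ i, Q (p i)) (v w : ∀ i, S'.top (p i)),
      R.rel A a → R.rel B b → (∀ i, R.rel (V i) (v i)) → (∀ i, R.rel (W i) (w i)) →
      (S.tgt k).map ((tgtOfEq h).map a) = (S.src k).map ((srcOfEq h).map b) →
      (∀ i, (S.tgt k).map ((tgtOfEq h).map (v i)) = (S.src k).map ((srcOfEq h).map (w i))) →
      Q.comp f (A - I.map ((S.tgt k).map ((tgtOfEq h).map a)) + B)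
          (fun i => V i - I.map ((S.tgt k).map ((tgtOfEq h).map (v i))) + W i) =
        Q.comp f A V - I.map ((S.tgt k).map ((tgtOfEq h).map (S'.top.comp f a v))) +
          Q.comp f B W) :
    ∃ Φ : Hom S'.top Q, ∀ {k : ℕ+} (a : S'.top k), R.rel (Φ.map a) a := by
  subst h
  exact E.exists_hom_freeTop R I hI hR hex

theorem NOperad.exists_hom_top_of_eq_free {gen : ℕ+ → Type u} {S : NOperad K 0}
    (h : S = NOperad.ofOperad (ShuffleOperad.free K gen)) {Q : ShuffleOperad K}
    (R : OperadRel Q S.top) (hR : ∀ {k : ℕ+} (a : S.top k), ∃ U, R.rel U a) :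
    ∃ Φ : Hom S.top Q, ∀ {k : ℕ+} (a : S.top k), R.rel (Φ.map a) a := by
  subst h
  exact exists_hom_free R hR

namespace OmegaPolygraph

variable (X : OmegaPolygraph K)

theorem globular_src_eq (n k : ℕ) : X.globular.src n k = (X.stage n).src k :=
  Hom.ext_map fun a => X.globular_src n k a

theorem globular_tgt_eq (n k : ℕ) : X.globular.tgt n k = (X.stage n).tgt k :=
  Hom.ext_map fun a => X.globular_tgt n k a

theorem globular_exchange : X.globular.HasExchange := by
  intro n k hk r p m f a b v w h hv
  unfold GlobularOperad.Composable at h hv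
  rw [globular_tgt_eq, globular_src_eq] at h
  rw [globular_tgt_eq, globular_src_eq] at hv
  rw [globular_tgt_eq]
  exact (X.stage n).exchange k hk f a b v w h hv

/-- The elements of the ideal that defines the presented operad are the targets of the `1`-cells with
trivial source. -/
theorem exists_of_idealGen {k : ℕ+} {x : X.globular.cell 0 k}
    (hx : IdealGen (X.globular.cell 0)
      (fun _ a b => ∃ c, (X.globular.s 0).map c = a ∧ (X.globular.t 0).map c = b) k x) :
    ∃ c, (X.globular.s 0).map c = 0 ∧ (X.globular.t 0).map c = x := by
  induction hx with
  | base a b h =>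
    obtain ⟨c, rfl, rfl⟩ := h
    -- Subtracting from the identity on its source normalizes c and makes its target the difference
    -- a − b.
    refine ⟨(X.globular.i 0).map ((X.globular.s 0).map c) - c, ?_, ?_⟩
    · rw [map_sub, X.globular.s_i, sub_self]
    · rw [map_sub, X.globular.t_i]
  | zero => exact ⟨0, map_zero _, map_zero _⟩
  | add a b _ _ iha ihb =>
    obtain ⟨c, hc, rfl⟩ := iha
    obtain ⟨d, hd, rfl⟩ := ihb
    exact ⟨c + d, by rw [map_add, hc, hd, add_zero], map_add _ _ _⟩
  | smul r a _ ih =>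
    obtain ⟨c, hc, rfl⟩ := ih
    exact ⟨r • c, by rw [map_smul, hc, smul_zero], map_smul _ _ _⟩
  | root f u v _ ih =>
    obtain ⟨c, hc, rfl⟩ := ih
    refine ⟨(X.globular.cell 1).comp f c fun j => (X.globular.i 0).map (v j), ?_, ?_⟩
    · rw [Hom.map_comp, hc, comp_zero_left]
    · simp only [Hom.map_comp, X.globular.t_i]
  | input f u v i _ ih =>
    obtain ⟨c, hc, hv⟩ := ih
    -- Identities are put at every place but i. Composition is multilinear and the source at i is
    -- zero, so the composite has zero source.
    refine ⟨(X.globular.cell 1).comp f ((X.globular.i 0).map u)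
      (Function.update (fun j => (X.globular.i 0).map (v j)) i c), ?_, ?_⟩
    · rw [Hom.map_comp]
      refine MultilinearMap.map_coord_zero _ i ?_
      rw [Function.update_self, hc]
    · rw [Hom.map_comp, X.globular.t_i]
      congr 1
      funext j
      rcases eq_or_ne j i with rfl | hj
      · rw [Function.update_self, hv]
      · rw [Function.update_of_ne hj, X.globular.t_i]

theorem exists_cell_of_toPresented_eq {m : ℕ+} (a b : X.globular.cell 0 m)
    (h : (X.toPresented 0).map a = (X.toPresented 0).map b) :
    ∃ c, (X.globular.s 0).map c = a ∧ (X.globular.t 0).map c = b := by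
  have hab : IdealGen (X.globular.cell 0)
      (fun _ a b => ∃ c, (X.globular.s 0).map c = a ∧ (X.globular.t 0).map c = b) m (a - b) :=
    (Submodule.Quotient.eq _).1 h
  obtain ⟨c, hs, ht⟩ := X.exists_of_idealGen hab
  refine ⟨(X.globular.i 0).map a - c, ?_, ?_⟩
  · rw [map_sub, X.globular.s_i, hs, sub_zero]
  · rw [map_sub, X.globular.t_i, ht, sub_sub_cancel]

/-- The data that yield a right contraction, from a unital section and the acyclicity of the
extensions in dimension at least two. -/
noncomputable def acyclicData (ι : X.UnitalSection) (h : ∀ n, 1 ≤ n → (X.ext n).Acyclic) :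
    AcyclicData X.globular X.presented where
  exchange := X.globular_exchange
  bar := X.toPresented
  bar_succ _ _ _ := rfl
  bar_t n _ a := (X.toPresented_t n a).symm
  sec n _ := ι.functor.map n
  sec_succ n _ b := ι.functor.map_i n b
  bar_sec n _ b := ι.proj_map n b
  sec_one := ι.map_one
  connected a b hab := X.exists_cell_of_toPresented_eq a b hab
  acyclic n m z hs ht := by
    have hsrc : ∀ j < n + 1, (X.globular.src (n + 1) j).map z = 0 := fun j hj => by
      rw [X.globular.src_le (Nat.le_of_lt_succ hj), hs, map_zero, map_zero]
    have htgt : ∀ j < n + 1, (X.globular.tgt (n + 1) j).map z = 0 := fun j hj => by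
      rw [X.globular.tgt_le (Nat.le_of_lt_succ hj), ht, map_zero, map_zero]
    simp only [globular_src_eq] at hsrc
    simp only [globular_tgt_eq] at htgt
    -- A loop z is parallel to 0, so acyclicity provides a cell from 0 to z.
    have hA := h (n + 1) n.succ_pos (0 : (X.stage (n + 1)).top m) z fun j hj =>
      ⟨(map_zero _).trans (hsrc j hj).symm, (map_zero _).trans (htgt j hj).symm⟩
    have key : ∀ {S' : NOperad K (n + 2)} (e : S' = (X.ext (n + 1)).freeExtension),
        ∃ c : S'.top m, (NOperad.srcOfEq e).map c = 0 ∧ (NOperad.tgtOfEq e).map c = z := by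
      rintro S' rfl
      exact hA
    exact key (X.stage_succ (n + 1))
  exists_hom_zero R hR := NOperad.exists_hom_top_of_eq_free X.stage_zero R hR
  exists_hom_succ n {Q} R I hI hR hex := by
    refine NOperad.exists_hom_top_of_eq (X.stage_succ n) R I hI hR ?_
    intro k hk r p m f A B a b V W v w hA hB hV hW hab hvw
    have hc : ∀ {m : ℕ+} (a b : X.globular.cell (n + 1) m),
        ((X.stage n).tgt k).map ((X.globular.t n).map a) =
          ((X.stage n).src k).map ((X.globular.s n).map b) → X.globular.Composable k a b := by
      intro m a b h
      rw [← globular_tgt_eq, ← globular_src_eq] at h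
      rw [GlobularOperad.Composable, X.globular.tgt_le hk, X.globular.src_le hk]
      exact congrArg (X.globular.i n).map h
    have := hex hk f A B a b V W v w hA hB hV hW (hc a b hab) fun i => hc _ _ (hvw i)
    rw [globular_tgt_eq] at this
    exact this

theorem free_starRight {n : ℕ} {m : ℕ+} (a : X.globular.cell n m) (e : ℕ → X.globular.cell n m)
    (k : ℕ) : X.free.starRight a e k = X.globular.starRight a e k := by
  induction k with
  | zero => rfl
  | succ k ih =>
    rw [GlobularOperad.starRight, ← ih]
    rfl

theorem free_starLeft {n : ℕ} {m : ℕ+} (a : X.globular.cell n m) (e : ℕ → X.globular.cell n m)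
    (k : ℕ) : X.free.starLeft e a k = X.globular.starLeft e a k := by
  induction k with
  | zero => rfl
  | succ k ih =>
    rw [GlobularOperad.starLeft, ← ih]
    rfl

/-- The right contraction of a polygraph whose extensions in dimension at least two are acyclic. -/
noncomputable def contraction (ι : X.UnitalSection) (h : ∀ n, 1 ≤ n → (X.ext n).Acyclic) :
    X.Contraction ι where
  map n _ := (X.acyclicData ι h).contract n
  src_map n _ a := ((X.acyclicData ι h).src_contract n a).trans (X.free_starRight _ _ n).symm
  tgt_map n _ a := by
    refine ((X.acyclicData ι h).starLeft_contract le_rfl a).symm.trans ?_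
    exact (X.free_starLeft _ _ n).symm
  -- The composition of the free ω-operad is by definition a − tₖ(a) + b, so the outer composites
  -- match on the nose; only the iterated ones need translating.
  map_star hk _ a b hab := (X.acyclicData ι h).contract_star hk a b hab
    (X.free_starRight _ _ _) rfl (X.free_starLeft _ _ _)
  map_i n _ a := (X.acyclicData ι h).contract_i n a
  map_section n _ a := (X.acyclicData ι h).contract_sec n a
  map_map n _ a := (X.acyclicData ι h).contract_contract n a

theorem contraction_isRight (ι : X.UnitalSection) (h : ∀ n, 1 ≤ n → (X.ext n).Acyclic) :
    (X.contraction ι h).IsRight := fun n {_ _ _} τ i hp f g =>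
  (X.acyclicData ι h).contract_elemComp τ i hp n f g rfl

/-- The cellular extensions of a contractible polygraph are acyclic in dimension at least two. -/
theorem Contraction.acyclic {X : OmegaPolygraph K} {ι : X.UnitalSection} (σ : X.Contraction ι)
    (n : ℕ) (hn : 1 ≤ n) : (X.ext n).Acyclic := by
  have main : ∀ {m : ℕ+} (f g : X.globular.cell n m),
      (∀ j < n, (X.globular.src n j).map f = (X.globular.src n j).map g ∧
        (X.globular.tgt n j).map f = (X.globular.tgt n j).map g) →
      ∃ A, (X.globular.s n).map A = f ∧ (X.globular.t n).map A = g := by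
    intro m f g hfg
    have h : ∀ a : X.globular.cell n m,
        X.proj.map n ((X.globular.src n 0).map a) = X.proj.map n a := by
      intro a
      refine (X.proj.map_src n 0 a).trans ?_
      change ((GlobularOperad.disc X.presented).src n 0).map _ = _
      rw [GlobularOperad.disc_src]
      rfl
    -- The projection depends only on 0-sources, and these agree for parallel cells because n ≥ 1;
    -- this is where the dimension bound enters.
    have hproj : (ι.functor.comp X.proj).map n f = (ι.functor.comp X.proj).map n g := by
      refine congrArg (ι.functor.map n) ?_
      rw [← h f, ← h g, (hfg 0 hn).1]
    refine X.globular.exists_cell_of_homotopy (fun a => σ.map n a) f g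
      ((ι.functor.comp X.proj).map n f) hfg
      ((σ.src_map n f).trans (X.free_starRight _ _ n))
      ((σ.src_map n g).trans (X.free_starRight _ _ n))
      ((σ.tgt_map n f).trans (X.free_starLeft _ _ n)) ?_
    rw [hproj]
    exact (σ.tgt_map n g).trans (X.free_starLeft _ _ n)
  intro m f g hfg
  have key : ∀ {S' : NOperad K (n + 1)} (e : S' = (X.ext n).freeExtension),
      (∃ A : S'.top m, (NOperad.srcOfEq e).map A = f ∧ (NOperad.tgtOfEq e).map A = g) →
      ∃ A : (X.ext n).freeExtension.top m,
        (X.ext n).freeSrc.map A = f ∧ (X.ext n).freeTgt.map A = g := by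
    rintro S' rfl h
    exact h
  refine key (X.stage_succ n) (main f g fun j hj => ?_)
  rw [globular_src_eq, globular_tgt_eq]
  exact hfg j hj

end OmegaPolygraph

end

theorem propositionP {K : Type u} [Field K] [CharZero K] (X : OmegaPolygraph K)
    (ι : X.UnitalSection) :
    X.IsPolygraphicResolution X.presented ↔ ∃ σ : X.Contraction ι, σ.IsRight :=
  -- The presentation half of a resolution is witnessed by the identity of `X.presented`, so the
  -- equivalence rests on acyclicity alone.
  ⟨fun h => ⟨X.contraction ι h.2, X.contraction_isRight ι h.2⟩,
    fun ⟨σ, _⟩ => ⟨⟨Hom.id _, fun _ => Function.bijective_id⟩, σ.acyclic⟩⟩
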